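/- Let $G=(V,E,w)$ be a finite undirected graph without loops, with positive real edge weights and without isolated vertices, $V=\{0,\dots,n-1\}$. For $v\in V$ put $w(v)=\sum_{u\sim v}w(u,v)$, for $S\subseteq V$ put $\mathrm{vol}(S)=\sum_{v\in S}w(v)$ and $$\phi(S)=\frac{w(E(S,\overline S))}{\min\{\mathrm{vol}(S),\mathrm{vol}(\overline S)\}},$$ where $w(E(S,\overline S))$ is the total weight of the edges between $S$ and $\overline S=V\setminus S$. Let $\lambda_1\le\lambda_2\le\dots\le\lambda_n$ be the eigenvalues of the normalized Laplacian $I-D^{-1/2}AD^{-1/2}$, where $A=(w(u,v))_{u,v\in V}$, with $w(u,v)=0$ for non-adjacent $u,v$, and $D=\mathrm{diag}(w(v))_{v\in V}$. A set $T\subseteq V$ with $\mathrm{vol}(T)=\mathrm{vol}(V)/2$ is called a bisection; if $G$ has a bisection, put $$\epsilon=\min_{\mathrm{vol}(T)=\mathrm{vol}(V)/2}\phi(T).$$ Theorem. There are a universal constant $C>0$ and a polynomial-time algorithm which takes $G$ as input and which, whenever $G$ has a bisection, returns a set $S\subseteq V$ such that $$\tfrac15\,\mathrm{vol}(V)\le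 \mathrm{vol}(S)\le\tfrac45\,\mathrm{vol}(V)\qquad\text{and}\qquad \phi(S)\le C\cdot\frac{k\,\epsilon}{\lambda_k}\quad\text{for every } 2\le k\le n \text{ with } \lambda_k>0 .$$ Here an algorithm is a program of a random access machine that works with natural numbers and, by exact field operations and comparisons, with the edge weights, and polynomial time means that on every such $G$ (with or without a bisection) it halts with the following cost, operations on natural numbers being charged by bit length in both cases: for arbitrary real weights, with each operation on scalars (numbers obtained from the weights) at unit cost, the cost is bounded by a polynomial in $n$; and, if the weights are rational, with each scalar charged by its bit length as a reduced fraction, the cost is bounded by a polynomial in the total bit length of the input. -/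

import Mathlib

noncomputable section

/-! ## Weighted graphs, conductance, normalized Laplacian -/

/-- A finite undirected graph on `V` with positive edge weights and no isolated vertex, given by
its weight function: `{u, v}` is an edge iff `w u v ≠ 0`. -/
structure WeightedGraph (V : Type*) [Fintype V] where
  w : V → V → ℝ
  symm : ∀ u v, w u v = w v u
  loopless : ∀ v, w v v = 0
  nonneg : ∀ u v, 0 ≤ w u v
  deg_pos : ∀ v, 0 < ∑ u, w v u

namespace WeightedGraph

variable {V : Type*} [Fintype V] [DecidableEq V]

/-- The weighted degree of a vertex. -/
def deg (G : WeightedGraph V) (v : V) : ℝ := ∑ u, G.w v u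

/-- The volume of a set of vertices. -/
def vol (G : WeightedGraph V) (S : Finset V) : ℝ := ∑ v ∈ S, G.deg v

/-- The total weight of the edges between `S` and its complement. -/
def cut (G : WeightedGraph V) (S : Finset V) : ℝ := ∑ u ∈ S, ∑ v ∈ Sᶜ, G.w u v

/-- The conductance `φ(S)`. -/
def conductance (G : WeightedGraph V) (S : Finset V) : ℝ :=
  G.cut S / min (G.vol S) (G.vol Sᶜ)

/-- `S` carries exactly half of the total volume. -/
def IsBisection (G : WeightedGraph V) (S : Finset V) : Prop :=
  G.vol S = G.vol Finset.univ / 2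

/-- The minimum conductance of a bisection. It is the infimum of a finite set, hence a minimum
as soon as `G` has a bisection. -/
def minBisectionConductance (G : WeightedGraph V) : ℝ :=
  sInf (G.conductance '' {S | G.IsBisection S})

/-- The normalized Laplacian `I - D^{-1/2} A D^{-1/2}`. -/
def normLaplacian (G : WeightedGraph V) : Matrix V V ℝ :=
  1 - Matrix.diagonal (fun v => (√(G.deg v))⁻¹) * Matrix.of G.w *
    Matrix.diagonal (fun v => (√(G.deg v))⁻¹)

theorem normLaplacian_isHermitian (G : WeightedGraph V) : G.normLaplacian.IsHermitian := by
  ext u v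
  simp only [normLaplacian, Matrix.conjTranspose_apply, Matrix.sub_apply, Matrix.mul_diagonal,
    Matrix.diagonal_mul, Matrix.of_apply, star_trivial, G.symm v u, Matrix.one_apply,
    eq_comm (a := v) (b := u)]
  ring

/-- The `k`-th smallest eigenvalue `λ_k` of the normalized Laplacian, with multiplicity,
`1 ≤ k ≤ |V|`. (Mathlib's `eigenvalues₀` lists the eigenvalues in decreasing order.) -/
def lam (G : WeightedGraph V) (k : ℕ) (hk : 1 ≤ k) (hkn : k ≤ Fintype.card V) : ℝ :=
  G.normLaplacian_isHermitian.eigenvalues₀ ⟨Fintype.card V - k, by omega⟩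

end WeightedGraph

/-! ## A random access machine with exact arithmetic

Programs are finite syntax trees. The memory consists of integer registers and of arrays of natural
numbers and of scalars (real numbers). On scalars a program can do exact field arithmetic and
comparisons, and nothing else. The cost of every operation is charged: the cost of an integer is
its bit length, and the cost of a scalar is given by a parameter `size`, so that the same program
can be measured in arithmetic operations or in bit operations. -/

namespace RAM

/-- Integer expressions; `sub` is truncated and `div` is the floor division of `ℕ`. -/
inductive IExpr where
  | const (c : ℕ)
  | var (x : ℕ)
  | get (a : ℕ) (i : IExpr)
  | add (e f : IExpr)
  | sub (e f : IExpr)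
  | mul (e f : IExpr)
  | div (e f : IExpr)

/-- Scalar expressions; `get a i` reads the entry `i` of the scalar array `a`. -/
inductive SExpr where
  | const (c : ℤ)
  | get (a : ℕ) (i : IExpr)
  | add (e f : SExpr)
  | sub (e f : SExpr)
  | mul (e f : SExpr)
  | div (e f : SExpr)

/-- Tests. -/
inductive BExpr where
  | ilt (e f : IExpr)
  | slt (e f : SExpr)
  | not (b : BExpr)
  | and (b c : BExpr)

/-- Programs. -/
inductive Cmd where
  | skip
  | setVar (x : ℕ) (e : IExpr)
  | setInt (a : ℕ) (i : IExpr) (e : IExpr)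
  | setScal (a : ℕ) (i : IExpr) (e : SExpr)
  | seq (c d : Cmd)
  | ite (b : BExpr) (c d : Cmd)
  | while (b : BExpr) (c : Cmd)

/-- The memory: registers, arrays of natural numbers, arrays of scalars. -/
structure State where
  var : ℕ → ℕ
  int : ℕ → ℕ → ℕ
  scal : ℕ → ℕ → ℝ

def IExpr.eval (s : State) : IExpr → ℕ
  | .const c => c
  | .var x => s.var x
  | .get a i => s.int a (i.eval s)
  | .add e f => e.eval s + f.eval s
  | .sub e f => e.eval s - f.eval s
  | .mul e f => e.eval s * f.eval s
  | .div e f => e.eval s / f.eval s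

def SExpr.eval (s : State) : SExpr → ℝ
  | .const c => c
  | .get a i => s.scal a (i.eval s)
  | .add e f => e.eval s + f.eval s
  | .sub e f => e.eval s - f.eval s
  | .mul e f => e.eval s * f.eval s
  | .div e f => e.eval s / f.eval s

def BExpr.eval (s : State) : BExpr → Prop
  | .ilt e f => e.eval s < f.eval s
  | .slt e f => e.eval s < f.eval s
  | .not b => ¬ b.eval s
  | .and b c => b.eval s ∧ c.eval s

/-- Cost of an integer. -/
def intSize (m : ℕ) : ℕ := Nat.size m + 1

/-- The cost of evaluating an integer expression: every node is charged the size of its value. -/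
def IExpr.cost (s : State) : IExpr → ℕ
  | .const c => intSize c
  | .var x => intSize (s.var x)
  | .get a i => i.cost s + intSize (s.int a (i.eval s))
  | .add e f => e.cost s + f.cost s + intSize (e.eval s + f.eval s)
  | .sub e f => e.cost s + f.cost s + intSize (e.eval s - f.eval s)
  | .mul e f => e.cost s + f.cost s + intSize (e.eval s * f.eval s)
  | .div e f => e.cost s + f.cost s + intSize (e.eval s / f.eval s)

/-- The cost of evaluating a scalar expression. -/
def SExpr.cost (size : ℝ → ℕ) (s : State) : SExpr → ℕ
  | .const c => size c
  | .get a i => i.cost s + size (s.scal a (i.eval s))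
  | .add e f => e.cost size s + f.cost size s + size (e.eval s + f.eval s)
  | .sub e f => e.cost size s + f.cost size s + size (e.eval s - f.eval s)
  | .mul e f => e.cost size s + f.cost size s + size (e.eval s * f.eval s)
  | .div e f => e.cost size s + f.cost size s + size (e.eval s / f.eval s)

/-- The cost of evaluating a test. -/
def BExpr.cost (size : ℝ → ℕ) (s : State) : BExpr → ℕ
  | .ilt e f => e.cost s + f.cost s + 1
  | .slt e f => e.cost size s + f.cost size s + 1
  | .not b => b.cost size s + 1
  | .and b c => b.cost size s + c.cost size s + 1

/-- `Exec size c s s' t`: the program `c`, started in memory `s`, halts in memory `s'`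
with total cost `t`. -/
inductive Exec (size : ℝ → ℕ) : Cmd → State → State → ℕ → Prop where
  | skip (s : State) : Exec size .skip s s 1
  | setVar (s : State) (x : ℕ) (e : IExpr) :
      Exec size (.setVar x e) s
        { s with var := Function.update s.var x (e.eval s) } (e.cost s + 1)
  | setInt (s : State) (a : ℕ) (i e : IExpr) :
      Exec size (.setInt a i e) s
        { s with int := Function.update s.int a (Function.update (s.int a) (i.eval s) (e.eval s)) }
        (i.cost s + e.cost s + 1)
  | setScal (s : State) (a : ℕ) (i : IExpr) (e : SExpr) :
      Exec size (.setScal a i e) s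
        { s with scal := Function.update s.scal a (Function.update (s.scal a) (i.eval s) (e.eval s)) }
        (i.cost s + e.cost size s + 1)
  | seq {c d : Cmd} {s s' s'' : State} {t t' : ℕ} :
      Exec size c s s' t → Exec size d s' s'' t' → Exec size (.seq c d) s s'' (t + t' + 1)
  | iteTrue {b : BExpr} {c d : Cmd} {s s' : State} {t : ℕ} :
      b.eval s → Exec size c s s' t → Exec size (.ite b c d) s s' (b.cost size s + t + 1)
  | iteFalse {b : BExpr} {c d : Cmd} {s s' : State} {t : ℕ} :
      ¬ b.eval s → Exec size d s s' t → Exec size (.ite b c d) s s' (b.cost size s + t + 1)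
  | whileTrue {b : BExpr} {c : Cmd} {s s' s'' : State} {t t' : ℕ} :
      b.eval s → Exec size c s s' t → Exec size (.while b c) s' s'' t' →
        Exec size (.while b c) s s'' (b.cost size s + t + t' + 1)
  | whileFalse {b : BExpr} {c : Cmd} {s : State} :
      ¬ b.eval s → Exec size (.while b c) s s (b.cost size s + 1)

/-- Unit-cost scalars: every exact arithmetic operation or comparison on scalars counts one. -/
def unitSize (_ : ℝ) : ℕ := 1

open Classical in
/-- Bit-cost scalars: the bit length of a rational number, as a reduced fraction. (The value at
irrational numbers plays no role: a program with rational input only meets rational numbers.) -/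
def bitSize (x : ℝ) : ℕ :=
  if h : ∃ q : ℚ, (q : ℝ) = x then Nat.size h.choose.num.natAbs + Nat.size h.choose.den else 1

/-- The initial memory on input `G`: register `0` holds the number `n` of vertices and scalar array
`0` the weight matrix, row by row (entry `i * n + j` is `w i j`); everything else is zero. -/
def inputState {n : ℕ} (G : WeightedGraph (Fin n)) : State where
  var x := if x = 0 then n else 0
  int _ _ := 0
  scal a m :=
    if h : a = 0 ∧ m < n * n then G.w (Fin.divNat ⟨m, h.2⟩) (Fin.modNat ⟨m, h.2⟩) else 0

/-- The set of vertices returned in memory `s`: the nonzero entries of integer array `0`. -/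
def outputSet (n : ℕ) (s : State) : Finset (Fin n) :=
  Finset.univ.filter (fun v => s.int 0 (v : ℕ) ≠ 0)

/-- All edge weights are rational. -/
def HasRationalWeights {n : ℕ} (G : WeightedGraph (Fin n)) : Prop :=
  ∀ u v, ∃ q : ℚ, (q : ℝ) = G.w u v

/-- The bit length of a graph with rational weights. -/
def inputLength {n : ℕ} (G : WeightedGraph (Fin n)) : ℕ :=
  n + ∑ u, ∑ v, bitSize (G.w u v)

end RAM

end

/-!
**The algorithm.** It maintains a set `U`, initially empty. While `vol(U) < vol(V) / 5`, it forms the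
Laplacian of the graph induced on the complement `W` of `U`, regularized by a small multiple `s D` of
the degree matrix, inverts it to `B`, and computes `F = (B D) ^ n`. The candidates are the sets of
vertices of `W` at which a column of `F` has a value in some interval. Among the candidates with at
most half the volume of `W`, the one for which adding it to `U` increases the cut least in
proportion to its volume is added to `U`.

**Why it works.** Restricted to `W`, a bisection has conductance `O(ε)` in the induced graph, so its
centred indicator has Rayleigh quotient `O(ε)`, and inverse power iteration brings one of the columns
of `F` to this quality (`exists_rayleigh_pow_le`, `WeightedGraph.exists_good_column`); `n` steps
suffice since `4 ^ n > n`, and no eigenvector has to be computed. The key is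
`WeightedGraph.expansion_le`, which is of the type of the improved Cheeger inequality: for a
nonnegative function of Rayleigh quotient `μ` on `W`, some set of values in an interval has marginal
cut, which counts edges to `U` as savings, at most `O(k μ / λ_k)` times its volume. If this failed,
cutting the range into `2 k` pieces of equal mass would yield `k` disjointly supported functions
whose Rayleigh quotients in the whole graph are below `λ_k / 2`, a contradiction to the
Courant–Fischer theorem; and if the range cannot be cut in this way, then the function is close to a
step function with few steps, and the co-area inequality `sum_mul_le_variation` applied to the
integral of the distance to the steps gives the bound. The parameter `s` is so small that it is
negligible against `ε`, unless `ε = 0`; in that case Cheeger's inequality shows that the best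
candidate does not increase the cut (`WeightedGraph.le_of_forall_candidate`). Summing up over the
rounds, `cut(U) = O(k ε / λ_k) vol(U)`, and the volume of `U` ends up between a fifth and three fifths
of the total (`WeightedGraph.RoundInvariant`).

**Running time.** All numbers are obtained by exact rational arithmetic, so their bit lengths have to
be controlled. `RAM.Height` is a bound for numerator and denominator. The entries of `B` are bounded
by Cramer's rule (`RAM.Height.matrix_inv`), also in the intermediate stages, since the inverse is
computed by rank-one updates, each of which leaves the inverse of a matrix with small entries
(`WeightedGraph.inv_partialLaplacian_insert`); those of `F` are bounded by using a common denominator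
(`RAM.Height.matrix_pow`). A weakest precondition calculus `RAM.wp`, whose soundness theorem
`RAM.exec_of_wp` includes the cost bound, reduces the analysis of the program to its loop invariants
and to these height bounds; the same derivation serves both cost measures.
-/

open Finset Matrix

/-! ### Energy, total variation and the co-area inequality -/

/-- The Dirichlet energy `½ ∑ β(u,v) (f u - f v)²` of `f` for a symmetric kernel `β`. -/
noncomputable def energy {V : Type*} [Fintype V] (β : V → V → ℝ) (f : V → ℝ) : ℝ :=
  (∑ u, ∑ v, β u v * (f u - f v) ^ 2) / 2

/-- The total variation `½ ∑ β(u,v) |f u - f v|`. -/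
noncomputable def variation {V : Type*} [Fintype V] (β : V → V → ℝ) (f : V → ℝ) : ℝ :=
  (∑ u, ∑ v, β u v * |f u - f v|) / 2

/-- The total `β`-weight between `B` and its complement. -/
noncomputable def kcut {V : Type*} [Fintype V] [DecidableEq V] (β : V → V → ℝ) (B : Finset V) :
    ℝ :=
  ∑ u ∈ B, ∑ v ∈ Bᶜ, β u v

section energy

variable {V : Type*} [Fintype V] {β : V → V → ℝ} {d : V → ℝ}

theorem energy_nonneg (h0 : ∀ u v, 0 ≤ β u v) (f : V → ℝ) : 0 ≤ energy β f := by
  unfold energy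
  have : 0 ≤ ∑ u, ∑ v, β u v * (f u - f v) ^ 2 :=
    sum_nonneg fun u _ => sum_nonneg fun v _ => mul_nonneg (h0 u v) (sq_nonneg _)
  linarith

theorem sum_kernel_sq_le (hs : ∀ u v, β u v = β v u) (h0 : ∀ u v, 0 ≤ β u v)
    (hd : ∀ u, ∑ v, β u v ≤ d u) (a : V → ℝ) :
    ∑ u, ∑ v, β u v * (a u + a v) ^ 2 ≤ 4 * ∑ u, d u * a u ^ 2 := by
  have h1 : ∑ u, ∑ v, β u v * (a u + a v) ^ 2
      ≤ ∑ u, ∑ v, (2 * (β u v * a u ^ 2) + 2 * (β u v * a v ^ 2)) := by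
    gcongr with u _ v _
    nlinarith [mul_nonneg (h0 u v) (sq_nonneg (a u - a v))]
  have h2 : ∑ u, ∑ v, β u v * a v ^ 2 = ∑ u, ∑ v, β u v * a u ^ 2 := by
    rw [sum_comm]
    exact sum_congr rfl fun u _ => sum_congr rfl fun v _ => by rw [hs]
  have h3 : ∑ u, ∑ v, β u v * a u ^ 2 ≤ ∑ u, d u * a u ^ 2 := by
    gcongr with u _
    rw [← sum_mul]
    exact mul_le_mul_of_nonneg_right (hd u) (sq_nonneg _)
  simp only [sum_add_distrib, ← mul_sum] at h1
  linarith

/-- The Cauchy–Schwarz inequality behind Cheeger's inequality. -/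
theorem sum_abs_mul_le (hs : ∀ u v, β u v = β v u) (h0 : ∀ u v, 0 ≤ β u v)
    (hd : ∀ u, ∑ v, β u v ≤ d u) (f a : V → ℝ) :
    ((∑ u, ∑ v, β u v * (|f u - f v| * (a u + a v))) / 2) ^ 2
      ≤ energy β f * (2 * ∑ u, d u * a u ^ 2) := by
  have h1 : (∑ p : V × V, β p.1 p.2 * (|f p.1 - f p.2| * (a p.1 + a p.2))) ^ 2
      ≤ (∑ p : V × V, β p.1 p.2 * (f p.1 - f p.2) ^ 2) *
        ∑ p : V × V, β p.1 p.2 * (a p.1 + a p.2) ^ 2 := by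
    apply sum_sq_le_sum_mul_sum_of_sq_le_mul
    · exact fun p _ => mul_nonneg (h0 _ _) (sq_nonneg _)
    · exact fun p _ => mul_nonneg (h0 _ _) (sq_nonneg _)
    · intro p _
      refine le_of_eq ?_
      rw [← sq_abs (f p.1 - f p.2)]
      ring
  rw [Fintype.sum_prod_type, Fintype.sum_prod_type, Fintype.sum_prod_type] at h1
  have h2 := sum_kernel_sq_le hs h0 hd a
  have h3 := energy_nonneg h0 f
  unfold energy at h3 ⊢
  dsimp only at h1
  nlinarith [mul_le_mul_of_nonneg_left h2 h3]

theorem energy_le_two_mul (hs : ∀ u v, β u v = β v u) (h0 : ∀ u v, 0 ≤ β u v)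
    (hd : ∀ u, ∑ v, β u v ≤ d u) (f : V → ℝ) : energy β f ≤ 2 * ∑ u, d u * f u ^ 2 := by
  have h1 : ∑ u, ∑ v, β u v * (f u - f v) ^ 2
      ≤ ∑ u, ∑ v, β u v * (|f u| + |f v|) ^ 2 := by
    gcongr ∑ u, ∑ v, ?_ with u _ v _
    refine mul_le_mul_of_nonneg_left ?_ (h0 u v)
    rw [← sq_abs (f u - f v)]
    gcongr
    exact abs_sub _ _
  have := sum_kernel_sq_le hs h0 hd fun u => |f u|
  simp only [sq_abs] at this
  unfold energy
  linarith

theorem variation_sq_le (hs : ∀ u v, β u v = β v u) (h0 : ∀ u v, 0 ≤ β u v)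
    (hd : ∀ u, ∑ v, β u v ≤ d u) (f : V → ℝ) (hf : ∀ v, 0 ≤ f v) :
    variation β (fun v => f v ^ 2) ^ 2 ≤ energy β f * (2 * ∑ u, d u * f u ^ 2) := by
  have := sum_abs_mul_le hs h0 hd f f
  have h1 : variation β (fun v => f v ^ 2)
      = (∑ u, ∑ v, β u v * (|f u - f v| * (f u + f v))) / 2 := by
    unfold variation
    congr 1
    refine sum_congr rfl fun u _ => sum_congr rfl fun v _ => ?_
    rw [← abs_of_nonneg (add_nonneg (hf u) (hf v)), ← abs_mul]
    congr 2
    ring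
  rw [h1]
  exact this

variable [DecidableEq V]

theorem sum_mul_ite_eq_kcut (β : V → V → ℝ) (S : Finset V) :
    ∑ u, ∑ v, β u v * (if u ∈ S ∧ v ∈ Sᶜ then (1 : ℝ) else 0) = kcut β S := by
  simp only [kcut, ite_and, mul_ite, mul_one, mul_zero]
  rw [← sum_filter_add_sum_filter_not univ (· ∈ S)]
  rw [add_eq_left.2]
  · rw [show univ.filter (fun v => v ∈ S) = S by ext; simp]
    refine sum_congr rfl fun u hu => ?_
    simp only [hu, if_true]
    rw [← sum_filter, show univ.filter (fun v => v ∈ Sᶜ) = Sᶜ by ext; simp]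
  · exact sum_eq_zero fun u hu => sum_eq_zero fun v _ => by
      simp only [mem_filter, mem_univ, true_and] at hu
      simp [hu]

/-- **Co-area inequality.** If every nonempty superlevel set `B` of `φ ≥ 0` has `β`-boundary at
least `ν(B)`, then the total variation of `φ` is at least `∑ ν φ`. -/
theorem sum_mul_le_variation (hs : ∀ u v, β u v = β v u) (ν : V → ℝ) (φ : V → ℝ)
    (hφ : ∀ v, 0 ≤ φ v)
    (h : ∀ t : ℝ, 0 ≤ t → (univ.filter fun v => t < φ v).Nonempty →
      ∑ v ∈ univ.filter (fun v => t < φ v), ν v ≤ kcut β (univ.filter fun v => t < φ v)) :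
    ∑ v, ν v * φ v ≤ variation β φ := by
  -- Induction on the size of the support: subtract the least positive value on the support.
  induction hn : (univ.filter fun v => 0 < φ v).card using Nat.strong_induction_on
    generalizing φ with
  | _ n ih =>
  set S := univ.filter fun v => 0 < φ v with hS
  by_cases hne : S.Nonempty
  swap
  · have hz : ∀ v, φ v = 0 := fun v => le_antisymm (by
      by_contra hv
      exact hne ⟨v, by simpa [hS] using hv⟩) (hφ v)
    simp [variation, hz]
  obtain ⟨m, hmS, hm⟩ := exists_min_image S φ hne
  have hm0 : 0 < φ m := by simpa [hS] using hmS
  set c := φ m with hc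
  let ψ : V → ℝ := fun v => if v ∈ S then φ v - c else 0
  have hψS : ∀ v ∈ S, φ v = ψ v + c := fun v hv => by simp [ψ, hv]
  have hφS : ∀ v ∉ S, φ v = 0 := fun v hv =>
    le_antisymm (by simpa [hS] using hv) (hφ v)
  have hψS' : ∀ v ∉ S, ψ v = 0 := fun v hv => by simp [ψ, hv]
  have hψ : ∀ v, 0 ≤ ψ v := fun v => by
    by_cases hv : v ∈ S
    · simp [ψ, hv, hm v hv]
    · simp [ψ, hv]
  have hlev : ∀ t : ℝ, 0 ≤ t →
      (univ.filter fun v => t < ψ v) = univ.filter fun v => t + c < φ v := by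
    intro t ht
    ext v
    simp only [mem_filter, mem_univ, true_and]
    by_cases hv : v ∈ S
    · rw [hψS v hv]; simp
    · rw [hψS' v hv, hφS v hv]
      constructor <;> intro h <;> linarith
  have hcard : (univ.filter fun v => 0 < ψ v).card < n := by
    rw [← hn]
    apply card_lt_card
    refine ⟨fun v hv => ?_, fun hsub => ?_⟩
    · by_contra hv'
      simp [hψS' v hv'] at hv
    · have := hsub hmS
      simp [ψ, hmS, hc] at this
  have key := ih _ hcard ψ hψ (fun t ht => by
    rw [hlev t ht]; exact h (t + c) (by linarith)) rfl
  have h1 : ∑ v, ν v * φ v = ∑ v, ν v * ψ v + c * ∑ v ∈ S, ν v := by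
    rw [mul_sum, ← sum_filter_add_sum_filter_not univ (· ∈ S) (fun v => ν v * φ v),
      ← sum_filter_add_sum_filter_not univ (· ∈ S) (fun v => ν v * ψ v)]
    have e1 : ∑ v ∈ univ.filter (fun v => ¬ v ∈ S), ν v * φ v = 0 :=
      sum_eq_zero fun v hv => by rw [hφS v (by simpa using hv), mul_zero]
    have e2 : ∑ v ∈ univ.filter (fun v => ¬ v ∈ S), ν v * ψ v = 0 :=
      sum_eq_zero fun v hv => by rw [hψS' v (by simpa using hv), mul_zero]
    have e3 : univ.filter (fun v => v ∈ S) = S := by ext; simp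
    rw [e1, e2, e3, add_zero, add_zero, ← sum_add_distrib]
    exact sum_congr rfl fun v hv => by rw [hψS v hv]; ring
  have h2 : ∀ u v, |φ u - φ v| = |ψ u - ψ v| + c * ((if u ∈ S ∧ v ∈ Sᶜ then 1 else 0) +
      (if v ∈ S ∧ u ∈ Sᶜ then 1 else 0)) := by
    intro u v
    have hu := hψ u
    have hv := hψ v
    by_cases hu' : u ∈ S <;> by_cases hv' : v ∈ S
    · rw [hψS u hu', hψS v hv']; simp [hu', hv']
    · rw [hψS u hu', hφS v hv', hψS' v hv']
      simp only [hu', hv', mem_compl, not_false_eq_true, and_self, if_true, false_and, if_false]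
      rw [abs_of_nonneg (by linarith), abs_of_nonneg (by linarith)]; ring
    · rw [hψS v hv', hφS u hu', hψS' u hu']
      simp only [hu', hv', mem_compl, not_false_eq_true, and_self, if_true, false_and, if_false]
      rw [abs_of_nonpos (by linarith), abs_of_nonpos (by linarith)]; ring
    · rw [hφS u hu', hφS v hv', hψS' v hv', hψS' u hu']; simp [hu', hv']
  have h3 := sum_mul_ite_eq_kcut β S
  have h4 : ∑ u, ∑ v, β u v * (if v ∈ S ∧ u ∈ Sᶜ then (1 : ℝ) else 0) = kcut β S := by
    rw [← h3, sum_comm]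
    exact sum_congr rfl fun u _ => sum_congr rfl fun v _ => by rw [hs]
  have h5 : variation β φ = variation β ψ + c * kcut β S := by
    have : ∑ u, ∑ v, β u v * |φ u - φ v| = ∑ u, ∑ v, β u v * |ψ u - ψ v| +
        c * (∑ u, ∑ v, β u v * (if u ∈ S ∧ v ∈ Sᶜ then (1 : ℝ) else 0) +
        ∑ u, ∑ v, β u v * (if v ∈ S ∧ u ∈ Sᶜ then (1 : ℝ) else 0)) := by
      simp only [mul_sum, ← sum_add_distrib]
      exact sum_congr rfl fun u _ => sum_congr rfl fun v _ => by rw [h2]; ring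
    rw [h3, h4] at this
    unfold variation
    linarith
  have h6 := h 0 le_rfl hne
  have h7 := mul_le_mul_of_nonneg_left h6 hm0.le
  rw [h1, h5]
  exact add_le_add key h7

end energy

/-! ### Courant–Fischer and disjointly supported test functions -/

/-- One half of the Courant–Fischer theorem: if the quadratic form of `A` is at most `r |y|²` on
the span of `ι` linearly independent vectors, with `ι` large enough, then the `j`-th largest
eigenvalue is at most `r`. -/
theorem Matrix.IsHermitian.eigenvalues₀_le {V : Type*} [Fintype V] [DecidableEq V]
    {A : Matrix V V ℝ} (hA : A.IsHermitian) (j : Fin (Fintype.card V)) {ι : Type*} [Fintype ι]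
    (hι : Fintype.card V - j ≤ Fintype.card ι) (x : ι → V → ℝ) (r : ℝ)
    (h : ∀ c : ι → ℝ, c ≠ 0 → 0 < (∑ i, c i • x i) ⬝ᵥ (∑ i, c i • x i) ∧
      (∑ i, c i • x i) ⬝ᵥ A *ᵥ (∑ i, c i • x i) ≤ r * ((∑ i, c i • x i) ⬝ᵥ (∑ i, c i • x i))) :
    hA.eigenvalues₀ j ≤ r := by
  classical
  let b := hA.eigenvectorBasis
  let e : Fin (Fintype.card V) ≃ V := Fintype.equivOfCardEq (Fintype.card_fin _)
  let S := {v : V // j < e.symm v}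
  let Φ : (ι → ℝ) →ₗ[ℝ] (S → ℝ) :=
    { toFun := fun c s => (b s : V → ℝ) ⬝ᵥ ∑ i, c i • x i
      map_add' := fun c c' => by
        ext s
        simp [add_smul, sum_add_distrib, dotProduct_add]
      map_smul' := fun a c => by
        ext s
        simp [mul_smul, ← smul_sum] }
  have hS : Fintype.card S < Fintype.card ι := by
    have h1 : Fintype.card S = Fintype.card {i : Fin (Fintype.card V) // j < i} :=
      Fintype.card_congr (e.symm.subtypeEquiv fun v => Iff.rfl)
    rw [h1, Fintype.card_subtype, filter_lt_eq_Ioi, Fin.card_Ioi]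
    have := j.2
    omega
  have hker : LinearMap.ker Φ ≠ ⊥ := LinearMap.ker_ne_bot_of_finrank_lt (by simpa using hS)
  obtain ⟨c, hc, hc0⟩ := Submodule.exists_mem_ne_zero_of_ne_bot hker
  obtain ⟨hpos, hle⟩ := h c hc0
  set y := ∑ i, c i • x i with hy
  have horth : ∀ v : V, j < e.symm v → (b v : V → ℝ) ⬝ᵥ y = 0 := fun v hv => by
    have := congrFun (LinearMap.mem_ker.1 hc) ⟨v, hv⟩
    simpa [Φ] using this
  let y' : EuclideanSpace ℝ V := WithLp.toLp 2 y
  have hin : ∀ v (z : V → ℝ), inner ℝ (b v) (WithLp.toLp 2 z) = (b v : V → ℝ) ⬝ᵥ z := fun v z => by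
    rw [EuclideanSpace.inner_eq_star_dotProduct, dotProduct_comm]
    simp
  have hyy : y ⬝ᵥ y = ∑ v, ((b v : V → ℝ) ⬝ᵥ y) ^ 2 := by
    have := b.sum_inner_mul_inner y' y'
    rw [EuclideanSpace.inner_eq_star_dotProduct] at this
    simp only [star_trivial, y'] at this
    rw [← this]
    refine sum_congr rfl fun v _ => ?_
    rw [real_inner_comm, hin, sq]
  have hyAy : y ⬝ᵥ A *ᵥ y = ∑ v, hA.eigenvalues v * ((b v : V → ℝ) ⬝ᵥ y) ^ 2 := by
    have := b.sum_inner_mul_inner y' (WithLp.toLp 2 (A *ᵥ y))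
    rw [EuclideanSpace.inner_eq_star_dotProduct, dotProduct_comm] at this
    simp only [star_trivial, y'] at this
    rw [← this]
    refine sum_congr rfl fun v _ => ?_
    rw [real_inner_comm, hin, hin, dotProduct_mulVec]
    have h2 : (b v : V → ℝ) ᵥ* A = hA.eigenvalues v • (b v : V → ℝ) := by
      rw [← mulVec_transpose, ← conjTranspose_eq_transpose_of_trivial, hA.eq]
      exact hA.mulVec_eigenvectorBasis v
    rw [h2, smul_dotProduct, smul_eq_mul]
    ring
  have hlow : hA.eigenvalues₀ j * (y ⬝ᵥ y) ≤ y ⬝ᵥ A *ᵥ y := by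
    rw [hyy, hyAy, mul_sum]
    refine sum_le_sum fun v _ => ?_
    rcases lt_or_ge j (e.symm v) with hv | hv
    · rw [horth v hv]; simp
    · exact mul_le_mul_of_nonneg_right (hA.eigenvalues₀_antitone hv) (sq_nonneg _)
  exact le_of_mul_le_mul_right (hlow.trans hle) hpos

namespace WeightedGraph

variable {V : Type*} [Fintype V]

theorem deg_pos' (G : WeightedGraph V) (v : V) : 0 < G.deg v := G.deg_pos v

theorem sqrt_deg_dotProduct (G : WeightedGraph V) (f : V → ℝ) :
    (fun v => √(G.deg v) * f v) ⬝ᵥ (fun v => √(G.deg v) * f v) = ∑ v, G.deg v * f v ^ 2 := by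
  simp only [dotProduct]
  refine sum_congr rfl fun v _ => ?_
  have := Real.mul_self_sqrt (G.deg_pos' v).le
  linear_combination f v ^ 2 * this

variable [DecidableEq V]

theorem normLaplacian_quadratic (G : WeightedGraph V) (f : V → ℝ) :
    (fun v => √(G.deg v) * f v) ⬝ᵥ G.normLaplacian *ᵥ (fun v => √(G.deg v) * f v)
      = energy G.w f := by
  have hd : ∀ v, √(G.deg v) ≠ 0 := fun v => (Real.sqrt_pos.2 (G.deg_pos' v)).ne'
  have hd2 : ∀ v, √(G.deg v) * √(G.deg v) = G.deg v := fun v => Real.mul_self_sqrt (G.deg_pos' v).le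
  have h1 : ∀ u, (G.normLaplacian *ᵥ (fun v => √(G.deg v) * f v)) u
      = √(G.deg u) * f u - (√(G.deg u))⁻¹ * ∑ v, G.w u v * f v := by
    intro u
    rw [normLaplacian, sub_mulVec, one_mulVec, ← mulVec_mulVec, ← mulVec_mulVec]
    simp only [Pi.sub_apply, mulVec_diagonal]
    congr 2
    have h : diagonal (fun v => (√(G.deg v))⁻¹) *ᵥ (fun v => √(G.deg v) * f v) = f := by
      ext v
      rw [mulVec_diagonal, inv_mul_cancel_left₀ (hd v)]
    rw [h]
    rfl
  have h2 : (fun v => √(G.deg v) * f v) ⬝ᵥ G.normLaplacian *ᵥ (fun v => √(G.deg v) * f v)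
      = ∑ u, ∑ v, G.w u v * (f u ^ 2 - f u * f v) := by
    simp only [dotProduct, h1]
    refine sum_congr rfl fun u _ => ?_
    have : √(G.deg u) * f u * (√(G.deg u) * f u - (√(G.deg u))⁻¹ * ∑ v, G.w u v * f v)
        = G.deg u * f u ^ 2 - f u * ∑ v, G.w u v * f v := by
      rw [mul_sub, mul_mul_mul_comm, hd2 u, ← mul_assoc, mul_comm (√(G.deg u)) (f u),
        mul_assoc (f u), mul_inv_cancel_left₀ (hd u)]
      ring
    rw [this, deg, sum_mul, mul_sum, ← sum_sub_distrib]
    exact sum_congr rfl fun v _ => by ring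
  have h3 : ∑ u, ∑ v, G.w u v * f v ^ 2 = ∑ u, ∑ v, G.w u v * f u ^ 2 := by
    rw [sum_comm]
    exact sum_congr rfl fun u _ => sum_congr rfl fun v _ => by rw [G.symm]
  have h4 : ∑ u, ∑ v, G.w u v * (f u - f v) ^ 2 = ∑ u, ∑ v, G.w u v * f u ^ 2
      + ∑ u, ∑ v, G.w u v * f v ^ 2 - 2 * ∑ u, ∑ v, G.w u v * (f u * f v) := by
    simp only [mul_sum, ← sum_add_distrib, ← sum_sub_distrib]
    exact sum_congr rfl fun u _ => sum_congr rfl fun v _ => by ring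
  have h5 : ∑ u, ∑ v, G.w u v * (f u ^ 2 - f u * f v) = ∑ u, ∑ v, G.w u v * f u ^ 2
      - ∑ u, ∑ v, G.w u v * (f u * f v) := by
    simp only [← sum_sub_distrib]
    exact sum_congr rfl fun u _ => sum_congr rfl fun v _ => by ring
  rw [h2, energy, h4, h5, h3]
  ring

theorem lam_le_two (G : WeightedGraph V) (k : ℕ) (hk : 1 ≤ k) (hkn : k ≤ Fintype.card V) :
    G.lam k hk hkn ≤ 2 := by
  refine G.normLaplacian_isHermitian.eigenvalues₀_le _ (ι := V) (by simp)
    (fun i => Pi.single i 1) 2 fun c hc => ?_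
  have hsum : ∑ i, c i • (Pi.single i 1 : V → ℝ) = c := by
    ext v
    simp [Finset.sum_apply, Pi.single_apply]
  rw [hsum]
  constructor
  · have h0 : 0 ≤ c ⬝ᵥ c := sum_nonneg fun v _ => mul_self_nonneg _
    exact lt_of_le_of_ne h0 fun h => hc (dotProduct_self_eq_zero.1 h.symm)
  · have hd : ∀ v, √(G.deg v) ≠ 0 := fun v => (Real.sqrt_pos.2 (G.deg_pos' v)).ne'
    have hc' : c = fun v => √(G.deg v) * (c v / √(G.deg v)) := by
      ext v
      field_simp [hd v]
    rw [hc', normLaplacian_quadratic, sqrt_deg_dotProduct]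
    exact energy_le_two_mul G.symm G.nonneg (fun u => le_rfl) _

/-- `λ_k` is at most twice the largest Rayleigh quotient of `k` disjointly supported functions. -/
theorem lam_le_of_disjoint (G : WeightedGraph V) (k : ℕ) (hk : 1 ≤ k) (hkn : k ≤ Fintype.card V)
    {ι : Type*} [Fintype ι] (hι : k ≤ Fintype.card ι) (τ : ι → V → ℝ) (r : ℝ)
    (hdisj : ∀ v i j, τ i v ≠ 0 → τ j v ≠ 0 → i = j)
    (hpos : ∀ i, 0 < ∑ v, G.deg v * τ i v ^ 2)
    (hr : ∀ i, energy G.w (τ i) ≤ r * ∑ v, G.deg v * τ i v ^ 2) :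
    G.lam k hk hkn ≤ 2 * r := by
  classical
  have hsq : ∀ (c : ι → ℝ) v, (∑ i, c i * τ i v) ^ 2 = ∑ i, c i ^ 2 * τ i v ^ 2 := by
    intro c v
    by_cases hv : ∃ i, τ i v ≠ 0
    · obtain ⟨i, hi⟩ := hv
      have h0 : ∀ j, j ≠ i → τ j v = 0 := fun j hj => by
        by_contra h
        exact hj (hdisj v j i h hi)
      rw [Fintype.sum_eq_single i fun j hj => by rw [h0 j hj, mul_zero],
        Fintype.sum_eq_single i fun j hj => by rw [h0 j hj]; ring]
      ring
    · push Not at hv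
      simp [hv]
  refine G.normLaplacian_isHermitian.eigenvalues₀_le _ (ι := ι) (by dsimp only; omega)
    (fun i v => √(G.deg v) * τ i v) _ fun c hc => ?_
  have hsum : ∑ i, c i • (fun v => √(G.deg v) * τ i v)
      = fun v => √(G.deg v) * ∑ i, c i * τ i v := by
    ext v
    simp only [Finset.sum_apply, Pi.smul_apply, smul_eq_mul, mul_sum]
    exact sum_congr rfl fun i _ => by ring
  rw [hsum, normLaplacian_quadratic, sqrt_deg_dotProduct]
  have hnorm : ∑ v, G.deg v * (∑ i, c i * τ i v) ^ 2
      = ∑ i, c i ^ 2 * ∑ v, G.deg v * τ i v ^ 2 := by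
    simp only [hsq, mul_sum]
    rw [sum_comm]
    exact sum_congr rfl fun i _ => sum_congr rfl fun v _ => by ring
  constructor
  · rw [hnorm]
    obtain ⟨i, hi⟩ := Function.ne_iff.1 hc
    refine sum_pos' (fun j _ => mul_nonneg (sq_nonneg _) (hpos j).le) ⟨i, mem_univ _, ?_⟩
    exact mul_pos (sq_pos_of_ne_zero hi) (hpos i)
  · -- On an edge at most two of the functions are nonzero.
    have hedge : ∀ u v, (∑ i, c i * τ i u - ∑ i, c i * τ i v) ^ 2
        ≤ 2 * ∑ i, c i ^ 2 * (τ i u - τ i v) ^ 2 := by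
      intro u v
      have hcross : ∀ i, (∑ j, c j * τ j u) * (c i * τ i u) = c i ^ 2 * τ i u ^ 2 := by
        intro i
        by_cases hi : τ i u = 0
        · simp [hi]
        · rw [Fintype.sum_eq_single i fun j hj => ?_]
          · ring
          · by_contra h
            exact hj (hdisj u j i (fun h' => h (by rw [h', mul_zero])) hi)
      by_cases huv : ∃ i, τ i u ≠ 0
      swap
      · push Not at huv
        have := hsq c v
        simp only [huv, mul_zero, sum_const_zero, zero_sub, even_two.neg_pow]
        rw [this]
        have : 0 ≤ ∑ i, c i ^ 2 * τ i v ^ 2 :=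
          sum_nonneg fun i _ => mul_nonneg (sq_nonneg _) (sq_nonneg _)
        linarith
      by_cases hvv : ∃ i, τ i v ≠ 0
      swap
      · push Not at hvv
        have := hsq c u
        simp only [hvv, mul_zero, sum_const_zero, sub_zero]
        rw [this]
        have : 0 ≤ ∑ i, c i ^ 2 * τ i u ^ 2 :=
          sum_nonneg fun i _ => mul_nonneg (sq_nonneg _) (sq_nonneg _)
        linarith
      obtain ⟨i, hi⟩ := huv
      obtain ⟨j, hj⟩ := hvv
      have hi0 : ∀ l, l ≠ i → τ l u = 0 := fun l hl => by
        by_contra h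
        exact hl (hdisj u l i h hi)
      have hj0 : ∀ l, l ≠ j → τ l v = 0 := fun l hl => by
        by_contra h
        exact hl (hdisj v l j h hj)
      rw [Fintype.sum_eq_single i fun l hl => by rw [hi0 l hl, mul_zero],
        Fintype.sum_eq_single j fun l hl => by rw [hj0 l hl, mul_zero]]
      by_cases hij : i = j
      · subst hij
        rw [Fintype.sum_eq_single i fun l hl => by rw [hi0 l hl, hj0 l hl]; ring]
        nlinarith [sq_nonneg (c i * (τ i u - τ i v))]
      · have h1 : ∑ l ∈ {i, j}, c l ^ 2 * (τ l u - τ l v) ^ 2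
            ≤ ∑ l, c l ^ 2 * (τ l u - τ l v) ^ 2 :=
          sum_le_sum_of_subset_of_nonneg (subset_univ _)
            fun l _ _ => mul_nonneg (sq_nonneg _) (sq_nonneg _)
        rw [sum_pair hij, hj0 i hij, hi0 j (Ne.symm hij)] at h1
        nlinarith [sq_nonneg (c i * τ i u + c j * τ j v)]
    have h1 : energy G.w (fun v => ∑ i, c i * τ i v) ≤ ∑ i, 2 * c i ^ 2 * energy G.w (τ i) := by
      have : ∑ u, ∑ v, G.w u v * (∑ i, c i * τ i u - ∑ i, c i * τ i v) ^ 2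
          ≤ ∑ u, ∑ v, G.w u v * (2 * ∑ i, c i ^ 2 * (τ i u - τ i v) ^ 2) :=
        sum_le_sum fun u _ => sum_le_sum fun v _ =>
          mul_le_mul_of_nonneg_left (hedge u v) (G.nonneg u v)
      have h2 : ∑ u, ∑ v, G.w u v * (2 * ∑ i, c i ^ 2 * (τ i u - τ i v) ^ 2)
          = ∑ i, 2 * c i ^ 2 * ∑ u, ∑ v, G.w u v * (τ i u - τ i v) ^ 2 := by
        simp only [mul_sum]
        rw [sum_comm]
        rw [sum_congr rfl fun v _ => sum_comm, sum_comm]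
        refine sum_congr rfl fun i _ => ?_
        rw [sum_comm]
        exact sum_congr rfl fun u _ => sum_congr rfl fun v _ => by ring
      rw [h2] at this
      unfold energy
      rw [show ∑ i, 2 * c i ^ 2 * ((∑ u, ∑ v, G.w u v * (τ i u - τ i v) ^ 2) / 2)
        = (∑ i, 2 * c i ^ 2 * ∑ u, ∑ v, G.w u v * (τ i u - τ i v) ^ 2) / 2 by
          rw [sum_div]; exact sum_congr rfl fun i _ => by ring]
      linarith
    refine h1.trans ?_
    rw [hnorm, mul_sum]
    refine sum_le_sum fun i _ => ?_
    have := mul_le_mul_of_nonneg_left (hr i) (sq_nonneg (c i))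
    nlinarith

end WeightedGraph

/-! ### Tents and thresholds on the real line -/

/-- The tent function of the interval `[a, b]`: the distance to the complement of the interval. -/
noncomputable def tent (a b x : ℝ) : ℝ := max 0 (min (x - a) (b - x))

theorem tent_nonneg (a b x : ℝ) : 0 ≤ tent a b x := le_max_left _ _

theorem tent_pos_iff {a b x : ℝ} : 0 < tent a b x ↔ a < x ∧ x < b := by
  simp [tent]

theorem tent_eq {a b : ℝ} (hab : a ≤ b) (x : ℝ) :
    tent a b x = min (min x b - min x a) (b - a - (min x b - min x a)) := by
  simp only [tent, min_def, max_def]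
  split_ifs <;> linarith

theorem min_tent_le {a b x y z : ℝ} (hxy : x ≤ y) (hyz : y ≤ z) :
    min (tent a b x) (tent a b z) ≤ tent a b y := by
  simp only [tent, min_def, max_def]
  split_ifs <;> linarith

theorem sum_tent_sub_sq_le {t : ℕ → ℝ} (ht : Monotone t) (r : ℕ) {x y : ℝ} (hx : t 0 ≤ x)
    (hy : t 0 ≤ y) :
    ∑ i ∈ range r, (tent (t i) (t (i + 1)) x - tent (t i) (t (i + 1)) y) ^ 2 ≤ (x - y) ^ 2 := by
  wlog hxy : x ≤ y generalizing x y
  · have := this hy hx (not_le.1 hxy).le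
    rw [← neg_sub x y, neg_sq] at this
    refine le_trans (le_of_eq ?_) this
    exact sum_congr rfl fun i _ => by ring
  let Δ : ℝ → ℕ → ℝ := fun z i => min z (t (i + 1)) - min z (t i)
  have hmono : ∀ i, Δ x i ≤ Δ y i := fun i => by
    have := ht (Nat.le_succ i)
    simp only [Δ, Nat.succ_eq_add_one, min_def] at this ⊢
    split_ifs <;> linarith
  have h1 : ∀ i, (tent (t i) (t (i + 1)) x - tent (t i) (t (i + 1)) y) ^ 2
      ≤ (Δ y i - Δ x i) ^ 2 := fun i => by
    rw [tent_eq (ht (Nat.le_succ i)), tent_eq (ht (Nat.le_succ i))]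
    have := hmono i
    apply sq_le_sq'
    · change -(Δ y i - Δ x i) ≤ min (Δ x i) (t (i + 1) - t i - Δ x i) -
        min (Δ y i) (t (i + 1) - t i - Δ y i)
      simp only [min_def]
      split_ifs <;> linarith
    · change min (Δ x i) (t (i + 1) - t i - Δ x i) -
        min (Δ y i) (t (i + 1) - t i - Δ y i) ≤ Δ y i - Δ x i
      simp only [min_def]
      split_ifs <;> linarith
  have h2 : ∑ i ∈ range r, (Δ y i - Δ x i) = min y (t r) - min x (t r) - (t 0 - t 0) := by
    rw [sum_sub_distrib, sum_range_sub fun i => min y (t i), sum_range_sub fun i => min x (t i),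
      min_eq_right hx, min_eq_right hy]
    ring
  calc _ ≤ ∑ i ∈ range r, (Δ y i - Δ x i) ^ 2 := sum_le_sum fun i _ => h1 i
    _ ≤ (∑ i ∈ range r, (Δ y i - Δ x i)) ^ 2 :=
        sum_sq_le_sq_sum_of_nonneg fun i _ => sub_nonneg.2 (hmono i)
    _ ≤ (y - x) ^ 2 := by
        have h0 : 0 ≤ ∑ i ∈ range r, (Δ y i - Δ x i) := sum_nonneg fun i _ => sub_nonneg.2 (hmono i)
        refine pow_le_pow_left₀ h0 ?_ 2
        rw [h2]
        simp only [min_def]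
        split_ifs <;> linarith
    _ = (x - y) ^ 2 := by ring

/-- Cut the interval `[0, M]` greedily at thresholds such that the tents between consecutive
thresholds all have the same mass `η`, until `M` is reached. -/
theorem exists_thresholds {V : Type*} [Fintype V] (d g : V → ℝ) {M η : ℝ} (hM : 0 ≤ M)
    (hη : 0 < η) :
    ∃ t : ℕ → ℝ, t 0 = 0 ∧ Monotone t ∧ (∀ i, t i ≤ M) ∧
      (∀ i, ∑ v, d v * tent (t i) (t (i + 1)) (g v) ^ 2 ≤ η) ∧
      ∀ i, t (i + 1) < M → ∑ v, d v * tent (t i) (t (i + 1)) (g v) ^ 2 = η := by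
  have hnext : ∀ a : {a : ℝ // a ≤ M}, ∃ b : {b : ℝ // b ≤ M}, a ≤ b ∧
      ∑ v, d v * tent a b (g v) ^ 2 ≤ η ∧
      ((b : ℝ) < M → ∑ v, d v * tent a b (g v) ^ 2 = η) := by
    rintro ⟨a, ha⟩
    by_cases h : ∑ v, d v * tent a M (g v) ^ 2 ≤ η
    · exact ⟨⟨M, le_rfl⟩, ha, h, fun h' => absurd h' (lt_irrefl _)⟩
    have hcont : ContinuousOn (fun b => ∑ v, d v * tent a b (g v) ^ 2) (Set.Icc a M) := by
      apply Continuous.continuousOn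
      unfold tent
      fun_prop
    have h0 : ∑ v, d v * tent a a (g v) ^ 2 = 0 := by
      refine sum_eq_zero fun v _ => ?_
      rw [tent_eq le_rfl]
      simp
    obtain ⟨b, hb, hb'⟩ := intermediate_value_Icc ha hcont
      (⟨h0.le.trans hη.le, (not_le.1 h).le⟩ : η ∈ Set.Icc (∑ v, d v * tent a a (g v) ^ 2)
        (∑ v, d v * tent a M (g v) ^ 2))
    exact ⟨⟨b, hb.2⟩, hb.1, hb'.le, fun _ => hb'⟩
  choose next h1 h2 h3 using hnext
  obtain ⟨t, ht0, ht⟩ : ∃ t : ℕ → {a : ℝ // a ≤ M}, t 0 = ⟨0, hM⟩ ∧ ∀ i, t (i + 1) = next (t i) :=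
    ⟨fun i => next^[i] ⟨0, hM⟩, rfl, fun i => Function.iterate_succ_apply' _ _ _⟩
  refine ⟨fun i => t i, by simp only [ht0], monotone_nat_of_le_succ fun i => ?_,
    fun i => (t i).2, fun i => ?_, fun i => ?_⟩
  · simp only [ht]
    exact h1 (t i)
  · simp only [ht]
    exact h2 (t i)
  · simp only [ht]
    exact h3 (t i)

theorem exists_consecutive {t : ℕ → ℝ} {x : ℝ} (h0 : t 0 ≤ x) :
    ∀ r, 0 < r → x ≤ t r → ∃ i < r, t i ≤ x ∧ x ≤ t (i + 1) := by
  intro r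
  induction r with
  | zero => simp
  | succ r ih =>
    intro _ hx
    rcases le_total (t r) x with h | h
    · exact ⟨r, r.lt_succ_self, h, hx⟩
    · rcases Nat.eq_zero_or_pos r with rfl | hr
      · exact ⟨0, Nat.one_pos, h0, hx⟩
      · obtain ⟨i, hi, h⟩ := ih hr h
        exact ⟨i, hi.trans r.lt_succ_self, h⟩

section distance

open Metric

variable {t : ℕ → ℝ} {r : ℕ}

theorem infDist_sq_le_sum_tent {x : ℝ} (hr : 0 < r) (h0 : t 0 ≤ x) (hx : x ≤ t r) :
    infDist x (t '' Set.Iic r) ^ 2 ≤ ∑ i ∈ range r, tent (t i) (t (i + 1)) x ^ 2 := by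
  obtain ⟨i, hi, h1, h2⟩ := exists_consecutive h0 r hr hx
  have h3 : infDist x (t '' Set.Iic r) ≤ tent (t i) (t (i + 1)) x := by
    refine le_max_of_le_right (le_min ?_ ?_)
    · refine (infDist_le_dist_of_mem (Set.mem_image_of_mem t (Set.mem_Iic.2 hi.le))).trans ?_
      rw [Real.dist_eq, abs_of_nonneg (by linarith)]
    · refine (infDist_le_dist_of_mem (Set.mem_image_of_mem t (Set.mem_Iic.2 hi))).trans ?_
      rw [Real.dist_eq, abs_of_nonpos (by linarith)]
      linarith
  calc _ ≤ tent (t i) (t (i + 1)) x ^ 2 := pow_le_pow_left₀ infDist_nonneg h3 2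
    _ ≤ _ := single_le_sum (f := fun i => tent (t i) (t (i + 1)) x ^ 2)
        (fun j _ => sq_nonneg _) (mem_range.2 hi)

theorem abs_integral_infDist_le (s : Set ℝ) (a b : ℝ) :
    |∫ x in a..b, infDist x s| ≤ (infDist a s + infDist b s + |a - b|) / 2 * |a - b| := by
  have : ∀ x ∈ Set.uIoc a b, ‖infDist x s‖ ≤ (infDist a s + infDist b s + |a - b|) / 2 := by
    intro x hx
    rw [Real.norm_of_nonneg infDist_nonneg]
    have h1 := infDist_le_infDist_add_dist (s := s) (x := x) (y := a)
    have h2 := infDist_le_infDist_add_dist (s := s) (x := x) (y := b)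
    rw [Real.dist_eq] at h1 h2
    have h3 : |x - a| + |x - b| ≤ |a - b| := by
      rcases Set.mem_uIoc.1 hx with ⟨h, h'⟩ | ⟨h, h'⟩
      · rw [abs_of_nonneg (by linarith), abs_of_nonpos (by linarith),
          abs_of_nonpos (by linarith)]; linarith
      · rw [abs_of_nonpos (by linarith), abs_of_nonneg (by linarith),
          abs_of_nonneg (by linarith)]; linarith
    linarith
  have h := intervalIntegral.norm_integral_le_of_norm_le_const this
  rwa [Real.norm_eq_abs, abs_sub_comm b a] at h

theorem sq_div_four_le_integral_infDist (ht : Monotone t) {i : ℕ} {c : ℝ} (h1 : t i ≤ c)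
    (h2 : c ≤ t (i + 1)) :
    (c - t i) ^ 2 / 4 ≤ ∫ x in (t i)..c, infDist x (t '' Set.Iic r) := by
  set m := (t i + c) / 2 with hm
  have hint : ∀ a b : ℝ, IntervalIntegrable (fun x => infDist x (t '' Set.Iic r))
      MeasureTheory.volume a b := fun a b => (continuous_infDist_pt _).intervalIntegrable a b
  have hlow : ∀ x, t i ≤ x → x ≤ c → min (x - t i) (c - x) ≤ infDist x (t '' Set.Iic r) := by
    intro x hx1 hx2
    refine (le_infDist ⟨t 0, Set.mem_image_of_mem t (Set.mem_Iic.2 (Nat.zero_le r))⟩).2 ?_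
    rintro y ⟨j, -, rfl⟩
    rw [Real.dist_eq]
    rcases le_or_gt j i with h | h
    · have := ht h
      exact (min_le_left _ _).trans ((by linarith : x - t i ≤ x - t j).trans (le_abs_self _))
    · have : t (i + 1) ≤ t j := ht h
      exact (min_le_right _ _).trans ((by linarith : c - x ≤ -(x - t j)).trans (neg_le_abs _))
  rw [← intervalIntegral.integral_add_adjacent_intervals (hint (t i) m) (hint m c)]
  have e1 : ∫ x in (t i)..m, (x - t i) ≤ ∫ x in (t i)..m, infDist x (t '' Set.Iic r) := by
    refine intervalIntegral.integral_mono_on (by linarith)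
      (Continuous.intervalIntegrable (by fun_prop) _ _) (hint _ _) fun x hx => ?_
    refine le_trans ?_ (hlow x hx.1 (by linarith [hx.2]))
    exact le_min le_rfl (by linarith [hx.2])
  have e2 : ∫ x in m..c, (c - x) ≤ ∫ x in m..c, infDist x (t '' Set.Iic r) := by
    refine intervalIntegral.integral_mono_on (by linarith)
      (Continuous.intervalIntegrable (by fun_prop) _ _) (hint _ _) fun x hx => ?_
    refine le_trans ?_ (hlow x (by linarith [hx.1]) hx.2)
    exact le_min (by linarith [hx.1]) le_rfl
  have e3 : ∫ x in (t i)..m, (x - t i) = (c - t i) ^ 2 / 8 := by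
    rw [intervalIntegral.integral_sub (Continuous.intervalIntegrable (by fun_prop) _ _)
      (Continuous.intervalIntegrable (by fun_prop) _ _)]
    simp only [integral_id, intervalIntegral.integral_const, smul_eq_mul, hm]
    ring
  have e4 : ∫ x in m..c, (c - x) = (c - t i) ^ 2 / 8 := by
    rw [intervalIntegral.integral_sub (Continuous.intervalIntegrable (by fun_prop) _ _)
      (Continuous.intervalIntegrable (by fun_prop) _ _)]
    simp only [integral_id, intervalIntegral.integral_const, smul_eq_mul, hm]
    ring
  linarith

/-- The integral of the distance to `r + 1` thresholds grows at least like `y² / (4 r)`. -/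
theorem sq_div_le_integral_infDist (ht : Monotone t) (h0 : t 0 = 0) {y : ℝ} (hy : 0 ≤ y)
    (hyr : y ≤ t r) :
    y ^ 2 ≤ 4 * r * ∫ x in 0..y, infDist x (t '' Set.Iic r) := by
  have hint : ∀ a b : ℝ, IntervalIntegrable (fun x => infDist x (t '' Set.Iic r))
      MeasureTheory.volume a b := fun a b => (continuous_infDist_pt _).intervalIntegrable a b
  have h1 : ∫ x in 0..y, infDist x (t '' Set.Iic r) = ∑ i ∈ range r,
      ∫ x in (min y (t i))..(min y (t (i + 1))), infDist x (t '' Set.Iic r) := by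
    rw [intervalIntegral.sum_integral_adjacent_intervals (a := fun i => min y (t i))
      fun i _ => hint _ _]
    rw [h0, min_eq_right hy, min_eq_left hyr]
  have h2 : ∀ i ∈ range r, (min y (t (i + 1)) - min y (t i)) ^ 2 / 4 ≤
      ∫ x in (min y (t i))..(min y (t (i + 1))), infDist x (t '' Set.Iic r) := by
    intro i _
    have := ht (Nat.le_succ i)
    rcases le_total y (t i) with h | h
    · rw [min_eq_left h, min_eq_left (h.trans this)]
      simp
    · rw [min_eq_right h]
      exact sq_div_four_le_integral_infDist ht (le_min h this) (min_le_right _ _)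
  have h3 := sq_sum_le_card_mul_sum_sq (s := range r)
    (f := fun i => min y (t (i + 1)) - min y (t i))
  rw [sum_range_sub (fun i => min y (t i)), h0, min_eq_right hy, min_eq_left hyr, sub_zero,
    card_range] at h3
  have h4 := sum_le_sum h2
  rw [← sum_div, ← h1] at h4
  refine h3.trans ?_
  have : (0 : ℝ) ≤ r := Nat.cast_nonneg r
  nlinarith

end distance

/-! ### Expansion of the level sets of a function bounds an eigenvalue -/

namespace WeightedGraph

variable {V : Type*} [Fintype V]

/-- The total weight of the edges from `v` to `U`. -/
def bdry (G : WeightedGraph V) (U : Finset V) (v : V) : ℝ := ∑ u ∈ U, G.w v u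

theorem bdry_nonneg (G : WeightedGraph V) (U : Finset V) (v : V) : 0 ≤ G.bdry U v :=
  sum_nonneg fun u _ => G.nonneg v u

variable [DecidableEq V]

/-- The weights of the graph induced on the complement of `U`. -/
def inside (G : WeightedGraph V) (U : Finset V) (u v : V) : ℝ :=
  if u ∈ U ∨ v ∈ U then 0 else G.w u v

variable (G : WeightedGraph V) (U : Finset V)

theorem inside_symm (u v : V) : G.inside U u v = G.inside U v u := by
  simp only [inside, or_comm, G.symm]

theorem inside_nonneg (u v : V) : 0 ≤ G.inside U u v := by
  unfold inside
  split_ifs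
  exacts [le_rfl, G.nonneg u v]

theorem inside_le (u v : V) : G.inside U u v ≤ G.w u v := by
  unfold inside
  split_ifs
  exacts [G.nonneg u v, le_rfl]

theorem sum_inside_le (u : V) : ∑ v, G.inside U u v ≤ G.deg u :=
  sum_le_sum fun v _ => G.inside_le U u v

theorem energy_eq_inside_add_bdry {τ : V → ℝ} (hτ : ∀ v ∈ U, τ v = 0) :
    energy G.w τ = energy (G.inside U) τ + ∑ v, G.bdry U v * τ v ^ 2 := by
  have h1 : ∀ u v, G.w u v * (τ u - τ v) ^ 2 = G.inside U u v * (τ u - τ v) ^ 2 +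
      ((if v ∈ U then G.w u v * τ u ^ 2 else 0) + if u ∈ U then G.w v u * τ v ^ 2 else 0) := by
    intro u v
    unfold inside
    by_cases hu : u ∈ U <;> by_cases hv : v ∈ U <;>
      simp [hu, hv, hτ, G.symm v u]
  have h2 : ∑ u, ∑ v, (if v ∈ U then G.w u v * τ u ^ 2 else 0) = ∑ v, G.bdry U v * τ v ^ 2 := by
    refine sum_congr rfl fun u _ => ?_
    rw [bdry, sum_mul, sum_ite_mem, univ_inter]
  have h3 : ∑ u, ∑ v, (if u ∈ U then G.w v u * τ v ^ 2 else 0) = ∑ v, G.bdry U v * τ v ^ 2 := by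
    rw [sum_comm, h2]
  unfold energy
  simp only [h1, sum_add_distrib, h2, h3]
  ring

variable {G U}

/-- If the superlevel sets of `τ` have at least as many edges to the rest of the complement of `U` as
to `U`, then `τ` has a small Rayleigh quotient in the whole graph as soon as it has one in the graph
induced on the complement of `U`. -/
theorem energy_sq_le_of_expansion {τ : V → ℝ} (hτ0 : ∀ v, 0 ≤ τ v) (hτU : ∀ v ∈ U, τ v = 0)
    (hexp : ∀ t : ℝ, 0 ≤ t → (univ.filter fun v => t < τ v).Nonempty →
      ∑ v ∈ univ.filter (fun v => t < τ v), G.bdry U v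
        ≤ kcut (G.inside U) (univ.filter fun v => t < τ v)) :
    energy G.w τ ^ 2 ≤ 8 * energy (G.inside U) τ * ∑ v, G.deg v * τ v ^ 2 := by
  have h1 : ∑ v, G.bdry U v * τ v ^ 2 ≤ variation (G.inside U) fun v => τ v ^ 2 := by
    refine sum_mul_le_variation (G.inside_symm U) _ _ (fun v => sq_nonneg _) fun t ht => ?_
    have : (univ.filter fun v => t < τ v ^ 2) = univ.filter fun v => √t < τ v := by
      ext v
      simp only [mem_filter, mem_univ, true_and]
      rw [← Real.sqrt_lt_sqrt_iff ht, Real.sqrt_sq (hτ0 v)]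
    rw [this]
    exact hexp _ (Real.sqrt_nonneg t)
  have h2 := variation_sq_le (G.inside_symm U) (G.inside_nonneg U) (G.sum_inside_le U) τ hτ0
  have h3 := energy_le_two_mul (G.inside_symm U) (G.inside_nonneg U) (G.sum_inside_le U) τ
  have h4 : 0 ≤ ∑ v, G.bdry U v * τ v ^ 2 :=
    sum_nonneg fun v _ => mul_nonneg (G.bdry_nonneg U v) (sq_nonneg _)
  have h5 := energy_nonneg (G.inside_nonneg U) τ
  rw [G.energy_eq_inside_add_bdry U hτU]
  set e := energy (G.inside U) τ
  set b := ∑ v, G.bdry U v * τ v ^ 2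
  have h6 : b ^ 2 ≤ e * (2 * ∑ v, G.deg v * τ v ^ 2) := (pow_le_pow_left₀ h4 h1 2).trans h2
  nlinarith [sq_nonneg (e - b)]

/-- The level sets of a function of small Rayleigh quotient `μ` on the complement of `U` cannot
expand better than `O(k μ / λ_k)`. Either the range of `g` splits into `2k` intervals whose tents
have mass `η`, and then `k` of the tents have Rayleigh quotients below `λ_k / 2`; or `g` is close to
a step function with at most `2k` steps, and then the integral of the distance to the steps, as a
function of `g`, has a small total variation. -/
theorem expansion_le (g : V → ℝ) (hg0 : ∀ v, 0 ≤ g v) (hgU : ∀ v ∈ U, g v = 0) {μ δ : ℝ}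
    (hμ : 0 < μ) (hpos : 0 < ∑ v, G.deg v * g v ^ 2)
    (hE : energy (G.inside U) g ≤ μ * ∑ v, G.deg v * g v ^ 2)
    (hexp : ∀ B : Finset V, B.Nonempty → (∀ v ∈ B, 0 < g v) →
      (∀ u ∈ B, ∀ w ∈ B, ∀ v, g u ≤ g v → g v ≤ g w → v ∈ B) →
      δ * G.vol B + ∑ v ∈ B, G.bdry U v ≤ kcut (G.inside U) B)
    (k : ℕ) (hk : 1 ≤ k) (hkn : k ≤ Fintype.card V) (hlam : 0 < G.lam k hk hkn) :
    δ ≤ 144 * k * μ / G.lam k hk hkn := by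
  set l := G.lam k hk hkn with hl
  set N := ∑ v, G.deg v * g v ^ 2 with hN
  have hk0 : (0 : ℝ) < k := by exact_mod_cast hk
  rcases le_or_gt δ 0 with hδ | hδ
  · exact hδ.trans (by positivity)
  have hbc : ∀ B : Finset V, ∑ v ∈ B, (δ * G.deg v + G.bdry U v)
      = δ * G.vol B + ∑ v ∈ B, G.bdry U v := fun B => by
    rw [sum_add_distrib, ← mul_sum, vol]
  have hvol : ∀ B : Finset V, 0 ≤ δ * G.vol B := fun B =>
    mul_nonneg hδ.le (sum_nonneg fun v _ => (G.deg_pos' v).le)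
  -- The common mass of the tents; `k` tents of this mass and of energy at most `μ N / k` would
  -- contradict the value of `λ_k`.
  set η := 64 * μ * N / (k * l ^ 2) with hη
  have hη0 : 0 < η := by positivity
  set M := ∑ v, g v with hM
  have hM0 : 0 ≤ M := sum_nonneg fun v _ => hg0 v
  have hgM : ∀ v, g v ≤ M := fun v => single_le_sum (fun u _ => hg0 u) (mem_univ v)
  obtain ⟨t, ht0, ht, htM, hmass, hmass'⟩ := exists_thresholds G.deg g hM0 hη0
  have htn : ∀ i, 0 ≤ t i := fun i => ht0 ▸ ht (Nat.zero_le i)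
  let τ : ℕ → V → ℝ := fun i v => tent (t i) (t (i + 1)) (g v)
  have hr : 0 < 2 * k := by omega
  have hrM : t (2 * k) = M := by
    by_contra hne
    have hlt : t (2 * k) < M := lt_of_le_of_ne (htM _) hne
    have hm : ∀ i ∈ range (2 * k), ∑ v, G.deg v * τ i v ^ 2 = η := fun i hi =>
      hmass' i ((ht (Nat.succ_le_of_lt (mem_range.1 hi))).trans_lt hlt)
    have hsum : ∑ i ∈ range (2 * k), energy (G.inside U) (τ i) ≤ energy (G.inside U) g := by
      unfold energy
      rw [← sum_div]
      gcongr ?_ / 2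
      rw [sum_comm]
      refine sum_le_sum fun u _ => ?_
      rw [sum_comm]
      refine sum_le_sum fun v _ => ?_
      rw [← mul_sum]
      exact mul_le_mul_of_nonneg_left
        (sum_tent_sub_sq_le ht _ (ht0 ▸ hg0 u) (ht0 ▸ hg0 v)) (G.inside_nonneg U u v)
    set bad := (range (2 * k)).filter fun i => μ * N / k < energy (G.inside U) (τ i) with hbad
    set good := (range (2 * k)).filter fun i => ¬ μ * N / k < energy (G.inside U) (τ i) with hgood
    have hcards : bad.card + good.card = 2 * k := by
      rw [hbad, hgood, card_filter_add_card_filter_not, card_range]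
    have hbadk : bad.card < k := by
      by_contra hcon
      have hcon := not_lt.1 hcon
      have hne : bad.Nonempty := card_pos.1 (by omega)
      have h1 : ∑ i ∈ bad, μ * N / k < ∑ i ∈ bad, energy (G.inside U) (τ i) :=
        sum_lt_sum_of_nonempty hne fun i hi => (mem_filter.1 hi).2
      have h2 : ∑ i ∈ bad, energy (G.inside U) (τ i)
          ≤ ∑ i ∈ range (2 * k), energy (G.inside U) (τ i) :=
        sum_le_sum_of_subset_of_nonneg (filter_subset _ _)
          fun i _ _ => energy_nonneg (G.inside_nonneg U) _
      rw [sum_const, nsmul_eq_mul] at h1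
      have h3 : μ * N ≤ bad.card * (μ * N / k) := by
        have : (k : ℝ) ≤ bad.card := by exact_mod_cast hcon
        calc μ * N = k * (μ * N / k) := by field_simp
          _ ≤ _ := mul_le_mul_of_nonneg_right this (by positivity)
      linarith
    have hlow : l ≤ 2 * (3 / 8 * l) := by
      refine G.lam_le_of_disjoint k hk hkn (ι := good) (by rw [Fintype.card_coe]; omega)
        (fun i => τ i) _ ?_ ?_ ?_
      · rintro v ⟨i, hi⟩ ⟨j, hj⟩ h1 h2
        have h1 := tent_pos_iff.1 (lt_of_le_of_ne (tent_nonneg _ _ _) (Ne.symm h1))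
        have h2 := tent_pos_iff.1 (lt_of_le_of_ne (tent_nonneg _ _ _) (Ne.symm h2))
        dsimp only at h1 h2
        by_contra hij
        have hij : i ≠ j := fun h => hij (Subtype.ext h)
        rcases lt_or_gt_of_ne hij with h | h
        · have := ht (Nat.succ_le_of_lt h)
          simp only [Nat.succ_eq_add_one] at this
          linarith
        · have := ht (Nat.succ_le_of_lt h)
          simp only [Nat.succ_eq_add_one] at this
          linarith
      · rintro ⟨i, hi⟩
        dsimp only
        rw [hm i (mem_filter.1 hi).1]
        exact hη0
      · rintro ⟨i, hi⟩
        have hi' := (mem_filter.1 hi)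
        dsimp only
        have h1 := energy_sq_le_of_expansion (G := G) (U := U) (τ := τ i)
          (fun v => tent_nonneg _ _ _) (fun v hv => by
            have : ¬ 0 < tent (t i) (t (i + 1)) (g v) := fun h => by
              have := (tent_pos_iff.1 h).1
              rw [hgU v hv] at this
              linarith [htn i]
            exact le_antisymm (not_lt.1 this) (tent_nonneg _ _ _))
          (fun s hs hne => by
            refine le_trans ?_ (hexp _ hne ?_ ?_)
            · linarith [hvol (univ.filter fun v => s < τ i v)]
            · intro v hv
              have : 0 < τ i v := lt_of_le_of_lt hs (mem_filter.1 hv).2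
              exact lt_of_le_of_lt (htn i) (tent_pos_iff.1 this).1
            · intro u hu w hw v huv hvw
              have hu := (mem_filter.1 hu).2
              have hw := (mem_filter.1 hw).2
              exact mem_filter.2 ⟨mem_univ _, lt_of_lt_of_le (lt_min hu hw)
                (min_tent_le huv hvw)⟩)
        rw [hm i hi'.1] at h1 ⊢
        have h2 : energy (G.inside U) (τ i) ≤ l ^ 2 * η / 64 := by
          refine (not_lt.1 hi'.2).trans (le_of_eq ?_)
          rw [hη]
          field_simp
        refine abs_le_of_sq_le_sq' (a := energy G.w (τ i)) ?_ (by positivity) |>.2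
        nlinarith
    linarith
  -- So `2k + 1` thresholds cover the range of `g`; use the integral of the distance to them.
  set T := t '' Set.Iic (2 * k) with hT
  set D : V → ℝ := fun v => Metric.infDist (g v) T with hD
  have herr : ∑ v, G.deg v * D v ^ 2 ≤ 2 * k * η := by
    calc _ ≤ ∑ v, G.deg v * ∑ i ∈ range (2 * k), τ i v ^ 2 := by
          refine sum_le_sum fun v _ => mul_le_mul_of_nonneg_left ?_ (G.deg_pos' v).le
          exact infDist_sq_le_sum_tent hr (ht0 ▸ hg0 v) (hrM ▸ hgM v)
      _ = ∑ i ∈ range (2 * k), ∑ v, G.deg v * τ i v ^ 2 := by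
          simp only [mul_sum]
          exact sum_comm
      _ ≤ ∑ i ∈ range (2 * k), η := sum_le_sum fun i _ => hmass i
      _ = 2 * k * η := by simp
  set H : ℝ → ℝ := fun y => ∫ x in 0..y, Metric.infDist x T with hH
  have hint : ∀ a b : ℝ, IntervalIntegrable (fun x => Metric.infDist x T)
      MeasureTheory.volume a b := fun a b =>
    (Metric.continuous_infDist_pt _).intervalIntegrable a b
  have hHsub : ∀ a b, H a - H b = ∫ x in b..a, Metric.infDist x T := fun a b =>
    intervalIntegral.integral_interval_sub_left (hint _ _) (hint _ _)
  have hHmono : Monotone H := fun a b hab => by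
    have : 0 ≤ H b - H a := by
      rw [hHsub]
      exact intervalIntegral.integral_nonneg hab fun x _ => Metric.infDist_nonneg
    linarith
  have hH0 : H 0 = 0 := by simp [hH]
  have hHnn : ∀ v, 0 ≤ H (g v) := fun v => hH0 ▸ hHmono (hg0 v)
  have hlow : ∀ v, g v ^ 2 ≤ 8 * k * H (g v) := fun v => by
    have := sq_div_le_integral_infDist (r := 2 * k) ht ht0 (hg0 v) (hrM ▸ hgM v)
    push_cast at this
    refine this.trans (le_of_eq ?_)
    rw [hH]
    ring
  have hcoarea : ∑ v, (δ * G.deg v + G.bdry U v) * H (g v)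
      ≤ variation (G.inside U) fun v => H (g v) := by
    refine sum_mul_le_variation (G.inside_symm U) _ _ hHnn fun s hs hne => ?_
    rw [hbc]
    refine hexp _ hne ?_ ?_
    · intro v hv
      have hv := (mem_filter.1 hv).2
      refine lt_of_le_of_ne (hg0 v) fun h => ?_
      rw [← h, hH0] at hv
      linarith
    · intro u hu w hw v huv hvw
      have hu := (mem_filter.1 hu).2
      exact mem_filter.2 ⟨mem_univ _, hu.trans_le (hHmono huv)⟩
  have hvar : variation (G.inside U) (fun v => H (g v)) ≤ energy (G.inside U) g +
      (∑ u, ∑ v, G.inside U u v * (|g u - g v| * (D u + D v))) / 2 := by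
    unfold variation energy
    rw [← add_div, ← sum_add_distrib]
    gcongr ?_ / 2
    refine sum_le_sum fun u _ => ?_
    rw [← sum_add_distrib]
    refine sum_le_sum fun v _ => ?_
    rw [← mul_add]
    refine mul_le_mul_of_nonneg_left ?_ (G.inside_nonneg U u v)
    rw [hHsub]
    refine (abs_integral_infDist_le T _ _).trans ?_
    have h1 : 0 ≤ D u := Metric.infDist_nonneg
    have h2 : 0 ≤ D v := Metric.infDist_nonneg
    change (D v + D u + |g v - g u|) / 2 * |g v - g u| ≤ _
    rw [abs_sub_comm (g v), ← sq_abs (g u - g v)]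
    nlinarith [abs_nonneg (g u - g v), mul_nonneg (abs_nonneg (g u - g v)) h1,
      mul_nonneg (abs_nonneg (g u - g v)) h2]
  have hcs := sum_abs_mul_le (G.inside_symm U) (G.inside_nonneg U) (G.sum_inside_le U) g D
  set Q := (∑ u, ∑ v, G.inside U u v * (|g u - g v| * (D u + D v))) / 2
  have hQ : Q ≤ 16 * μ * N / l := by
    refine abs_le_of_sq_le_sq' ?_ (by positivity) |>.2
    refine hcs.trans ?_
    calc energy (G.inside U) g * (2 * ∑ v, G.deg v * D v ^ 2) ≤ (μ * N) * (2 * (2 * k * η)) := by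
          gcongr
          exact mul_nonneg zero_le_two
            (sum_nonneg fun v _ => mul_nonneg (G.deg_pos' v).le (sq_nonneg _))
      _ = (16 * μ * N / l) ^ 2 := by
          rw [hη]
          field_simp
          norm_num
  have hl2 : l ≤ 2 := G.lam_le_two k hk hkn
  have hEl : μ * N ≤ 2 * μ * N / l := by
    rw [le_div_iff₀ hlam]
    nlinarith [mul_pos hμ hpos]
  have hfin : δ * N ≤ 8 * k * (18 * μ * N / l) := by
    calc δ * N ≤ 8 * k * ∑ v, (δ * G.deg v + G.bdry U v) * H (g v) := by
          rw [hN, mul_sum, mul_sum]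
          refine sum_le_sum fun v _ => ?_
          have h1 := mul_le_mul_of_nonneg_left (hlow v) (mul_pos hδ (G.deg_pos' v)).le
          have h2 := mul_nonneg hk0.le (mul_nonneg (G.bdry_nonneg U v) (hHnn v))
          nlinarith
      _ ≤ 8 * k * (18 * μ * N / l) := by
          refine mul_le_mul_of_nonneg_left ?_ (by positivity)
          have : 18 * μ * N / l = 2 * μ * N / l + 16 * μ * N / l := by ring
          linarith
  exact le_of_mul_le_mul_right (hfin.trans (le_of_eq (by ring) : _ ≤ 144 * k * μ / l * N)) hpos

end WeightedGraph

/-! ### Splitting a function at its median -/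

namespace WeightedGraph

variable {V : Type*} [Fintype V] (G : WeightedGraph V)

theorem vol_mono {S T : Finset V} (h : S ⊆ T) : G.vol S ≤ G.vol T :=
  sum_le_sum_of_subset_of_nonneg h fun v _ _ => (G.deg_pos' v).le

theorem vol_nonneg (S : Finset V) : 0 ≤ G.vol S := sum_nonneg fun v _ => (G.deg_pos' v).le

theorem vol_pos {S : Finset V} (h : S.Nonempty) : 0 < G.vol S :=
  sum_pos (fun v _ => G.deg_pos' v) h

theorem exists_median (f : V → ℝ) (W : Finset V) (hW : W.Nonempty) :
    ∃ m, 2 * G.vol (W.filter fun v => m < f v) ≤ G.vol W ∧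
      2 * G.vol (W.filter fun v => f v < m) ≤ G.vol W := by
  classical
  set A := W.filter fun v => G.vol W ≤ 2 * G.vol (W.filter fun u => f u ≤ f v) with hA
  obtain ⟨x, hxW, hx⟩ := exists_max_image W f hW
  have hAne : A.Nonempty := by
    refine ⟨x, mem_filter.2 ⟨hxW, ?_⟩⟩
    rw [filter_true_of_mem fun u hu => hx u hu]
    linarith [G.vol_nonneg W]
  obtain ⟨v, hvA, hv⟩ := exists_min_image A f hAne
  refine ⟨f v, ?_, ?_⟩
  · have h1 := (mem_filter.1 hvA).2
    have h2 : G.vol W = G.vol (W.filter fun u => f u ≤ f v) +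
        G.vol (W.filter fun u => f v < f u) := by
      unfold vol
      rw [← sum_filter_add_sum_filter_not W fun u => f u ≤ f v]
      simp only [not_le]
    linarith
  · by_cases hne : (W.filter fun u => f u < f v).Nonempty
    · obtain ⟨u, hu, hmax⟩ := exists_max_image _ f hne
      have huA : u ∉ A := fun h => absurd (hv u h) (not_le.2 (mem_filter.1 hu).2)
      have h1 : G.vol (W.filter fun x => f x < f v) ≤ G.vol (W.filter fun x => f x ≤ f u) :=
        G.vol_mono fun x hx => mem_filter.2 ⟨(mem_filter.1 hx).1, hmax x hx⟩
      have h2 : ¬ G.vol W ≤ 2 * G.vol (W.filter fun x => f x ≤ f u) := fun h =>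
        huA (mem_filter.2 ⟨(mem_filter.1 hu).1, h⟩)
      linarith
    · rw [not_nonempty_iff_eq_empty.1 hne]
      rw [vol, sum_empty, mul_zero]
      exact G.vol_nonneg W

variable [DecidableEq V] (U : Finset V)

/-- One of the two halves of `f - m`, for `m` a median of `f`, inherits the Rayleigh quotient of
`f`. The level sets of both halves are sets of values of `f` in an interval. -/
theorem exists_nonneg_of_rayleigh (f : V → ℝ) {c μ : ℝ}
    (hmean : ∑ v ∈ Uᶜ, G.deg v * (f v - c) = 0)
    (hpos : 0 < ∑ v ∈ Uᶜ, G.deg v * (f v - c) ^ 2)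
    (hE : energy (G.inside U) f ≤ μ * ∑ v ∈ Uᶜ, G.deg v * (f v - c) ^ 2) (hμ : 0 ≤ μ) :
    ∃ g : V → ℝ, (∀ v, 0 ≤ g v) ∧ (∀ v ∈ U, g v = 0) ∧ 0 < ∑ v, G.deg v * g v ^ 2 ∧
      energy (G.inside U) g ≤ μ * ∑ v, G.deg v * g v ^ 2 ∧
      ∀ B : Finset V, (∀ v ∈ B, 0 < g v) →
        (∀ u ∈ B, ∀ w ∈ B, ∀ v, g u ≤ g v → g v ≤ g w → v ∈ B) →
        B ⊆ Uᶜ ∧ 2 * G.vol B ≤ G.vol Uᶜ ∧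
          ∀ u ∈ B, ∀ w ∈ B, ∀ v ∈ Uᶜ, f u ≤ f v → f v ≤ f w → v ∈ B := by
  have hW : (Uᶜ).Nonempty := by
    by_contra h
    rw [not_nonempty_iff_eq_empty.1 h] at hpos
    simp at hpos
  obtain ⟨m, hm1, hm2⟩ := G.exists_median f Uᶜ hW
  let p : V → ℝ := fun v => if v ∈ U then 0 else max (f v - m) 0
  let q : V → ℝ := fun v => if v ∈ U then 0 else max (m - f v) 0
  have hnorm : ∑ v ∈ Uᶜ, G.deg v * (f v - c) ^ 2
      ≤ ∑ v, G.deg v * p v ^ 2 + ∑ v, G.deg v * q v ^ 2 := by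
    have h1 : ∑ v, G.deg v * p v ^ 2 + ∑ v, G.deg v * q v ^ 2
        = ∑ v ∈ Uᶜ, G.deg v * (f v - m) ^ 2 := by
      rw [← sum_add_distrib, ← sum_add_sum_compl U, sum_eq_zero, zero_add]
      · refine sum_congr rfl fun v hv => ?_
        have hv : v ∉ U := mem_compl.1 hv
        simp only [p, q, hv, if_false, max_def]
        split_ifs with h1 h2 h2
        · have : f v - m = 0 := by linarith
          rw [this]; ring
        · ring
        · ring
        · linarith
      · intro v hv
        simp [p, q, hv]
    have h2 : ∑ v ∈ Uᶜ, G.deg v * (f v - m) ^ 2 = ∑ v ∈ Uᶜ, G.deg v * (f v - c) ^ 2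
        + 2 * (c - m) * ∑ v ∈ Uᶜ, G.deg v * (f v - c) + (c - m) ^ 2 * G.vol Uᶜ := by
      rw [vol, mul_sum, mul_sum, ← sum_add_distrib, ← sum_add_distrib]
      exact sum_congr rfl fun v _ => by ring
    rw [h1, h2, hmean]
    have := mul_nonneg (sq_nonneg (c - m)) (G.vol_nonneg Uᶜ)
    linarith
  have henergy : energy (G.inside U) p + energy (G.inside U) q ≤ energy (G.inside U) f := by
    unfold energy
    rw [← add_div, ← sum_add_distrib]
    gcongr ?_ / 2
    refine sum_le_sum fun u _ => ?_
    rw [← sum_add_distrib]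
    refine sum_le_sum fun v _ => ?_
    by_cases h : u ∈ U ∨ v ∈ U
    · simp [inside, h]
    · rw [← mul_add]
      refine mul_le_mul_of_nonneg_left ?_ (G.inside_nonneg U u v)
      push Not at h
      simp only [p, q, h.1, h.2, if_false, max_def]
      split_ifs <;> nlinarith
  have hp : ∀ v ∈ Uᶜ, p v = max (f v - m) 0 := fun v hv => by simp [p, mem_compl.1 hv]
  have hq : ∀ v ∈ Uᶜ, q v = max (m - f v) 0 := fun v hv => by simp [q, mem_compl.1 hv]
  have hp0 : 0 ≤ ∑ v, G.deg v * p v ^ 2 :=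
    sum_nonneg fun v _ => mul_nonneg (G.deg_pos' v).le (sq_nonneg _)
  have hq0 : 0 ≤ ∑ v, G.deg v * q v ^ 2 :=
    sum_nonneg fun v _ => mul_nonneg (G.deg_pos' v).le (sq_nonneg _)
  have hchoice : (0 < ∑ v, G.deg v * p v ^ 2 ∧
        energy (G.inside U) p ≤ μ * ∑ v, G.deg v * p v ^ 2) ∨
      (0 < ∑ v, G.deg v * q v ^ 2 ∧ energy (G.inside U) q ≤ μ * ∑ v, G.deg v * q v ^ 2) := by
    by_contra hcon
    push Not at hcon
    obtain ⟨h1, h2⟩ := hcon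
    have h3 := energy_nonneg (G.inside_nonneg U) p
    have h4 := energy_nonneg (G.inside_nonneg U) q
    rcases hp0.eq_or_lt with h5 | h5 <;> rcases hq0.eq_or_lt with h6 | h6
    · linarith
    · have := h2 h6
      rw [← h5] at hnorm
      nlinarith
    · have := h1 h5
      rw [← h6] at hnorm
      nlinarith
    · have := h1 h5
      have := h2 h6
      nlinarith
  have hout : ∀ (g : V → ℝ) (B : Finset V), (∀ v ∈ U, g v = 0) → (∀ v ∈ B, 0 < g v) → B ⊆ Uᶜ :=
    fun g B hg hB v hv => mem_compl.2 fun h => by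
      have := hB v hv
      rw [hg v h] at this
      exact lt_irrefl _ this
  rcases hchoice with ⟨h1, h2⟩ | ⟨h1, h2⟩
  · refine ⟨p, fun v => ?_, fun v hv => by simp [p, hv], h1, h2, fun B hB hconv => ?_⟩
    · by_cases hv : v ∈ U <;> simp [p, hv]
    have hBU := hout p B (fun v hv => by simp [p, hv]) hB
    refine ⟨hBU, ?_, fun u hu w hw v hv huv hvw => hconv u hu w hw v ?_ ?_⟩
    · refine le_trans (mul_le_mul_of_nonneg_left (G.vol_mono fun v hv => ?_) zero_le_two) hm1
      have := hB v hv
      rw [hp v (hBU hv)] at this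
      refine mem_filter.2 ⟨hBU hv, ?_⟩
      simpa using this
    · rw [hp u (hBU hu), hp v hv]
      exact max_le_max (by linarith) le_rfl
    · rw [hp w (hBU hw), hp v hv]
      exact max_le_max (by linarith) le_rfl
  · refine ⟨q, fun v => ?_, fun v hv => by simp [q, hv], h1, h2, fun B hB hconv => ?_⟩
    · by_cases hv : v ∈ U <;> simp [q, hv]
    have hBU := hout q B (fun v hv => by simp [q, hv]) hB
    refine ⟨hBU, ?_, fun u hu w hw v hv huv hvw => hconv w hw u hu v ?_ ?_⟩
    · refine le_trans (mul_le_mul_of_nonneg_left (G.vol_mono fun v hv => ?_) zero_le_two) hm2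
      have := hB v hv
      rw [hq v (hBU hv)] at this
      refine mem_filter.2 ⟨hBU hv, ?_⟩
      simpa using this
    · rw [hq w (hBU hw), hq v hv]
      exact max_le_max (by linarith) le_rfl
    · rw [hq u (hBU hu), hq v hv]
      exact max_le_max (by linarith) le_rfl

end WeightedGraph

/-! ### Inverse power iteration -/

section power

variable {V : Type*} [Fintype V] {A M : Matrix V V ℝ} {d : V → ℝ}

theorem Matrix.dotProduct_mulVec_sq_le (hs : A.IsSymm) (h0 : ∀ x, 0 ≤ x ⬝ᵥ A *ᵥ x) (x y : V → ℝ) :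
    (x ⬝ᵥ A *ᵥ y) ^ 2 ≤ (x ⬝ᵥ A *ᵥ x) * (y ⬝ᵥ A *ᵥ y) := by
  have hxy : y ⬝ᵥ A *ᵥ x = x ⬝ᵥ A *ᵥ y := by
    rw [dotProduct_mulVec, ← mulVec_transpose, hs.eq, dotProduct_comm]
  have := discrim_le_zero (a := y ⬝ᵥ A *ᵥ y) (b := 2 * (x ⬝ᵥ A *ᵥ y)) (c := x ⬝ᵥ A *ᵥ x)
    fun t => by
      have := h0 (x + t • y)
      rw [mulVec_add, mulVec_smul, dotProduct_add, add_dotProduct, add_dotProduct,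
        dotProduct_smul, dotProduct_smul, smul_dotProduct, smul_dotProduct, hxy] at this
      simp only [smul_eq_mul] at this
      linarith
  unfold discrim at this
  linarith

theorem sum_weighted_mul_sq_le (hd : ∀ v, 0 ≤ d v) (x y : V → ℝ) :
    (∑ v, d v * x v * y v) ^ 2 ≤ (∑ v, d v * x v ^ 2) * ∑ v, d v * y v ^ 2 :=
  sum_sq_le_sum_mul_sum_of_sq_le_mul _ (fun v _ => mul_nonneg (hd v) (sq_nonneg _))
    (fun v _ => mul_nonneg (hd v) (sq_nonneg _)) fun v _ => le_of_eq (by ring)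

/-- For `M = A⁻¹ D`, a Rayleigh quotient `xᵀAx / xᵀDx` at most `θ` is preserved by `M`, and `M`
stretches such vectors by at least `θ⁻¹`. -/
theorem rayleigh_mulVec_le (hs : A.IsSymm) (h0 : ∀ x, 0 ≤ x ⬝ᵥ A *ᵥ x) (hd : ∀ v, 0 ≤ d v)
    (hM : ∀ x v, (A *ᵥ M *ᵥ x) v = d v * x v) {θ : ℝ} (hθ : 0 ≤ θ) {x : V → ℝ}
    (hx : x ⬝ᵥ A *ᵥ x ≤ θ * ∑ v, d v * x v ^ 2) :
    (M *ᵥ x) ⬝ᵥ A *ᵥ M *ᵥ x ≤ θ * ∑ v, d v * (M *ᵥ x) v ^ 2 ∧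
      ∑ v, d v * x v ^ 2 ≤ θ ^ 2 * ∑ v, d v * (M *ᵥ x) v ^ 2 := by
  set y := M *ᵥ x
  have hnn : ∀ z : V → ℝ, 0 ≤ ∑ v, d v * z v ^ 2 := fun z =>
    sum_nonneg fun v _ => mul_nonneg (hd v) (sq_nonneg _)
  have h1 : x ⬝ᵥ A *ᵥ y = ∑ v, d v * x v ^ 2 := by
    simp only [dotProduct, y, hM]
    exact sum_congr rfl fun v _ => by ring
  have h2 : y ⬝ᵥ A *ᵥ y = ∑ v, d v * x v * y v := by
    conv_lhs => rw [dotProduct]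
    refine sum_congr rfl fun v _ => ?_
    rw [show (A *ᵥ y) v = d v * x v from hM x v]
    ring
  have h3 := dotProduct_mulVec_sq_le hs h0 x y
  have h4 := sum_weighted_mul_sq_le hd x y
  rw [← h2] at h4
  rw [h1] at h3
  have hy0 := h0 y
  have hx1 := hnn x
  have hy1 := hnn y
  set Q := y ⬝ᵥ A *ᵥ y
  set a := ∑ v, d v * x v ^ 2
  set b := ∑ v, d v * y v ^ 2
  have h5 : a ≤ θ * Q := by
    rcases hx1.eq_or_lt with h | h
    · rw [← h]; positivity
    · have : a * a ≤ a * (θ * Q) := by nlinarith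
      exact le_of_mul_le_mul_left this h
  have h6 : Q ≤ θ * b := by
    rcases hy0.eq_or_lt with h | h
    · rw [← h]; positivity
    · have : Q * Q ≤ Q * (θ * b) := by nlinarith
      exact le_of_mul_le_mul_left this h
  refine ⟨h6, h5.trans ?_⟩
  nlinarith

/-- For `M = A⁻¹ D`, if `M x` has Rayleigh quotient at least `μ` then `M` stretches `x` by at most
`μ⁻¹`. -/
theorem sq_mul_norm_mulVec_le (hd : ∀ v, 0 ≤ d v)
    (hM : ∀ x v, (A *ᵥ M *ᵥ x) v = d v * x v) {μ : ℝ} (hμ : 0 ≤ μ) {x : V → ℝ}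
    (hx : μ * ∑ v, d v * (M *ᵥ x) v ^ 2 ≤ (M *ᵥ x) ⬝ᵥ A *ᵥ M *ᵥ x) :
    μ ^ 2 * ∑ v, d v * (M *ᵥ x) v ^ 2 ≤ ∑ v, d v * x v ^ 2 := by
  set y := M *ᵥ x
  have hnn : ∀ z : V → ℝ, 0 ≤ ∑ v, d v * z v ^ 2 := fun z =>
    sum_nonneg fun v _ => mul_nonneg (hd v) (sq_nonneg _)
  have h2 : y ⬝ᵥ A *ᵥ y = ∑ v, d v * x v * y v := by
    conv_lhs => rw [dotProduct]
    refine sum_congr rfl fun v _ => ?_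
    rw [show (A *ᵥ y) v = d v * x v from hM x v]
    ring
  have h4 := sum_weighted_mul_sq_le hd x y
  rw [← h2] at h4
  have hx1 := hnn x
  have hy1 := hnn y
  set Q := y ⬝ᵥ A *ᵥ y
  set a := ∑ v, d v * x v ^ 2
  set b := ∑ v, d v * y v ^ 2
  rcases hy1.eq_or_lt with h | h
  · rw [← h, mul_zero]; exact hx1
  · have h5 : (μ * b) ^ 2 ≤ Q ^ 2 := pow_le_pow_left₀ (by positivity) hx 2
    have : b * (μ ^ 2 * b) ≤ b * a := by nlinarith
    exact le_of_mul_le_mul_left this h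

variable [DecidableEq V]

/-- **Inverse power iteration.** If `z`, of Rayleigh quotient at most `θ`, is the combination of
vectors `p v` of norm at most `√(d v)` with coefficients `z v`, then after `|V|` steps one of the
`p v` has turned into a vector of Rayleigh quotient at most `2 θ`. -/
theorem exists_rayleigh_pow_le (hs : A.IsSymm) (h0 : ∀ x, 0 ≤ x ⬝ᵥ A *ᵥ x) (hd : ∀ v, 0 < d v)
    (hM : ∀ x v, (A *ᵥ M *ᵥ x) v = d v * x v) {θ : ℝ} (hθ : 0 < θ) {z : V → ℝ} (p : V → V → ℝ)
    (hz : z = ∑ v, z v • p v) (hp : ∀ v, ∑ u, d u * p v u ^ 2 ≤ d v)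
    (hz0 : 0 < ∑ v, d v * z v ^ 2) (hzθ : z ⬝ᵥ A *ᵥ z ≤ θ * ∑ v, d v * z v ^ 2) :
    ∃ v, 0 < ∑ u, d u * (M ^ Fintype.card V *ᵥ p v) u ^ 2 ∧
      (M ^ Fintype.card V *ᵥ p v) ⬝ᵥ A *ᵥ (M ^ Fintype.card V *ᵥ p v)
        ≤ 2 * θ * ∑ u, d u * (M ^ Fintype.card V *ᵥ p v) u ^ 2 := by
  set n := Fintype.card V with hn
  by_contra hcon
  push Not at hcon
  have hd' : ∀ v, 0 ≤ d v := fun v => (hd v).le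
  have hnn : ∀ z : V → ℝ, 0 ≤ ∑ v, d v * z v ^ 2 := fun z =>
    sum_nonneg fun v _ => mul_nonneg (hd' v) (sq_nonneg _)
  have hsucc : ∀ t (x : V → ℝ), M ^ (t + 1) *ᵥ x = M *ᵥ M ^ t *ᵥ x := fun t x => by
    rw [pow_succ', mulVec_mulVec]
  have hgrow : ∀ t, (M ^ t *ᵥ z) ⬝ᵥ A *ᵥ (M ^ t *ᵥ z) ≤ θ * ∑ v, d v * (M ^ t *ᵥ z) v ^ 2 ∧
      ∑ v, d v * z v ^ 2 ≤ (θ ^ 2) ^ t * ∑ v, d v * (M ^ t *ᵥ z) v ^ 2 := by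
    intro t
    induction t with
    | zero => simpa using hzθ
    | succ t ih =>
      have h := rayleigh_mulVec_le hs h0 hd' hM hθ.le ih.1
      rw [hsucc]
      refine ⟨h.1, ih.2.trans ?_⟩
      rw [pow_succ (θ ^ 2), mul_assoc]
      exact mul_le_mul_of_nonneg_left h.2 (by positivity)
  have hshrink : ∀ t (x : V → ℝ), 2 * θ * ∑ v, d v * (M ^ t *ᵥ x) v ^ 2
      < (M ^ t *ᵥ x) ⬝ᵥ A *ᵥ (M ^ t *ᵥ x) →
      ((2 * θ) ^ 2) ^ t * ∑ v, d v * (M ^ t *ᵥ x) v ^ 2 ≤ ∑ v, d v * x v ^ 2 := by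
    intro t x
    induction t with
    | zero => simp
    | succ t ih =>
      intro h
      rw [hsucc] at h ⊢
      have h1 := ih (by
        by_contra h'
        exact absurd (rayleigh_mulVec_le hs h0 hd' hM (by positivity) (not_lt.1 h')).1
          (not_le.2 h))
      have h2 := sq_mul_norm_mulVec_le hd' hM (by positivity) h.le
      refine le_trans ?_ h1
      rw [pow_succ ((2 * θ) ^ 2), mul_assoc]
      exact mul_le_mul_of_nonneg_left h2 (by positivity)
  have hy : ∀ v, ((2 * θ) ^ 2) ^ n * ∑ u, d u * (M ^ n *ᵥ p v) u ^ 2 ≤ d v := fun v => by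
    rcases (hnn (M ^ n *ᵥ p v)).eq_or_lt with h | h
    · rw [← h, mul_zero]; exact hd' v
    · exact (hshrink n (p v) (hcon v h)).trans (hp v)
  have hMz : M ^ n *ᵥ z = ∑ v, z v • (M ^ n *ᵥ p v) := by
    conv_lhs => rw [hz]
    rw [mulVec_sum]
    simp only [mulVec_smul]
  have hcs : ∑ u, d u * (M ^ n *ᵥ z) u ^ 2
      ≤ (∑ v, d v * z v ^ 2) * ∑ v, (d v)⁻¹ * ∑ u, d u * (M ^ n *ᵥ p v) u ^ 2 := by
    have h1 : ∀ u, (M ^ n *ᵥ z) u ^ 2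
        ≤ (∑ v, d v * z v ^ 2) * ∑ v, (d v)⁻¹ * (M ^ n *ᵥ p v) u ^ 2 := by
      intro u
      rw [hMz, Finset.sum_apply]
      refine sum_sq_le_sum_mul_sum_of_sq_le_mul _
        (fun v _ => mul_nonneg (hd' v) (sq_nonneg _))
        (fun v _ => mul_nonneg (inv_nonneg.2 (hd' v)) (sq_nonneg _)) fun v _ => le_of_eq ?_
      have := (hd v).ne'
      simp only [Pi.smul_apply, smul_eq_mul]
      field_simp
    calc _ ≤ ∑ u, d u * ((∑ v, d v * z v ^ 2) * ∑ v, (d v)⁻¹ * (M ^ n *ᵥ p v) u ^ 2) :=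
          sum_le_sum fun u _ => mul_le_mul_of_nonneg_left (h1 u) (hd' u)
      _ = _ := by
          simp only [mul_left_comm (d _), ← mul_sum]
          congr 1
          simp only [mul_sum]
          rw [sum_comm]
          exact sum_congr rfl fun v _ => sum_congr rfl fun u _ => by ring
  have hsum : ((2 * θ) ^ 2) ^ n * ∑ v, (d v)⁻¹ * ∑ u, d u * (M ^ n *ᵥ p v) u ^ 2 ≤ n := by
    rw [mul_sum]
    calc _ ≤ ∑ v : V, (1 : ℝ) := by
          refine sum_le_sum fun v _ => ?_
          rw [mul_left_comm, inv_mul_le_iff₀ (hd v), mul_one]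
          exact hy v
      _ = n := by simp [hn]
  -- Otherwise every `M ^ n p v` has been shrunk by `4 ^ n` more, in squared norm, than their
  -- combination `M ^ n z`, which is impossible since `n < 4 ^ n`.
  have h1 := (hgrow n).2
  have h4n : (n : ℝ) < 4 ^ n := by exact_mod_cast Nat.lt_pow_self (by norm_num)
  have h2 : ((2 * θ) ^ 2) ^ n = 4 ^ n * (θ ^ 2) ^ n := by rw [← mul_pow]; ring
  rw [h2] at hsum
  set a := ∑ v, d v * z v ^ 2
  set b := ∑ v, (d v)⁻¹ * ∑ u, d u * (M ^ n *ᵥ p v) u ^ 2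
  set q := (θ ^ 2) ^ n
  have hq : 0 < q := by positivity
  have h3 : a ≤ q * (a * b) := h1.trans (mul_le_mul_of_nonneg_left hcs hq.le)
  have h5 : (4 : ℝ) ^ n * a ≤ a * n := by
    calc (4 : ℝ) ^ n * a ≤ 4 ^ n * (q * (a * b)) := mul_le_mul_of_nonneg_left h3 (by positivity)
      _ = a * (4 ^ n * q * b) := by ring
      _ ≤ a * n := mul_le_mul_of_nonneg_left hsum hz0.le
  nlinarith

end power

/-! ### Enlarging a set of small volume -/

namespace WeightedGraph

variable {V : Type*} [Fintype V] [DecidableEq V] (G : WeightedGraph V) (U : Finset V)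

/-- The vertices outside `U` at which the value of `f` lies in the closed interval
`[f a, f b]`. -/
noncomputable def interval (f : V → ℝ) (a b : V) : Finset V :=
  Uᶜ.filter fun v => f a ≤ f v ∧ f v ≤ f b

/-- The change of the cut when the set `B`, disjoint from `U`, is added to `U`. -/
noncomputable def marginal (B : Finset V) : ℝ := kcut (G.inside U) B - ∑ v ∈ B, G.bdry U v

theorem kcut_inside {B : Finset V} (hB : B ⊆ Uᶜ) :
    kcut (G.inside U) B = ∑ u ∈ B, ∑ v ∈ (U ∪ B)ᶜ, G.w u v := by
  unfold kcut
  refine sum_congr rfl fun u hu => ?_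
  have hu' : u ∉ U := mem_compl.1 (hB hu)
  rw [show (U ∪ B)ᶜ = Bᶜ.filter fun v => v ∉ U by
    ext v; simp [and_comm], sum_filter]
  exact sum_congr rfl fun v _ => by simp [inside, hu']

theorem cut_union {B : Finset V} (hB : B ⊆ Uᶜ) :
    G.cut (U ∪ B) = G.cut U + G.marginal U B := by
  have hdisj : Disjoint U B := by
    rw [disjoint_left]
    exact fun v hv hv' => mem_compl.1 (hB hv') hv
  have h1 : ∀ u, ∑ v ∈ Uᶜ, G.w u v = ∑ v ∈ (U ∪ B)ᶜ, G.w u v + ∑ v ∈ B, G.w u v := by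
    intro u
    rw [← sum_union]
    · refine sum_congr ?_ fun _ _ => rfl
      ext v
      have := @hB v
      simp only [mem_compl, mem_union, not_or] at this ⊢
      tauto
    · rw [disjoint_left]
      intro v hv hv'
      simp only [mem_compl, mem_union, not_or] at hv
      exact hv.2 hv'
  have h2 : ∑ v ∈ B, G.bdry U v = ∑ u ∈ U, ∑ v ∈ B, G.w u v := by
    unfold bdry
    rw [sum_comm]
    exact sum_congr rfl fun u _ => sum_congr rfl fun v _ => G.symm _ _
  rw [marginal, G.kcut_inside U hB, cut, cut, sum_union hdisj, h2]
  simp only [h1, sum_add_distrib]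
  ring

theorem kcut_inside_le_cut (T : Finset V) : kcut (G.inside U) T ≤ G.cut T :=
  sum_le_sum fun u _ => sum_le_sum fun v _ => G.inside_le U u v

theorem energy_indicator (β : V → V → ℝ) (hs : ∀ u v, β u v = β v u) (T : Finset V) :
    energy β (fun v => if v ∈ T then 1 else 0) = kcut β T := by
  have h1 : ∀ u v, β u v * ((if u ∈ T then (1 : ℝ) else 0) - if v ∈ T then 1 else 0) ^ 2
      = β u v * (if u ∈ T ∧ v ∈ Tᶜ then 1 else 0) + β v u * if v ∈ T ∧ u ∈ Tᶜ then 1 else 0 := by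
    intro u v
    by_cases hu : u ∈ T <;> by_cases hv : v ∈ T <;> simp [hu, hv, hs u v]
  have h2 := sum_mul_ite_eq_kcut β T
  have h3 : ∑ u, ∑ v, β v u * (if v ∈ T ∧ u ∈ Tᶜ then (1 : ℝ) else 0) = kcut β T := by
    rw [sum_comm, h2]
  unfold energy
  simp only [h1, sum_add_distrib, h2, h3]
  ring

/-- The Laplacian of the graph induced on the complement of `U`, regularized by `s D`, as an
operator. -/
def IsRegLaplacian (s : ℝ) (A : Matrix V V ℝ) : Prop :=
  ∀ x u, (A *ᵥ x) u = s * G.deg u * x u + ∑ v, G.inside U u v * (x u - x v)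

variable {G U} {s : ℝ} {A : Matrix V V ℝ}

theorem IsRegLaplacian.quadratic (hA : G.IsRegLaplacian U s A) (x : V → ℝ) :
    x ⬝ᵥ A *ᵥ x = energy (G.inside U) x + s * ∑ v, G.deg v * x v ^ 2 := by
  have h1 : ∑ u, ∑ v, G.inside U u v * (x u * (x u - x v))
      = ∑ u, ∑ v, G.inside U u v * (x v * (x v - x u)) := by
    rw [sum_comm]
    exact sum_congr rfl fun u _ => sum_congr rfl fun v _ => by rw [G.inside_symm U]
  have h2 : ∑ u, ∑ v, G.inside U u v * (x u - x v) ^ 2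
      = ∑ u, ∑ v, G.inside U u v * (x u * (x u - x v))
        + ∑ u, ∑ v, G.inside U u v * (x v * (x v - x u)) := by
    simp only [← sum_add_distrib]
    exact sum_congr rfl fun u _ => sum_congr rfl fun v _ => by ring
  have h3 : x ⬝ᵥ A *ᵥ x = s * ∑ v, G.deg v * x v ^ 2
      + ∑ u, ∑ v, G.inside U u v * (x u * (x u - x v)) := by
    rw [dotProduct, mul_sum, ← sum_add_distrib]
    refine sum_congr rfl fun u _ => ?_
    rw [hA x u, mul_add, mul_sum]
    congr 1
    · ring
    · exact sum_congr rfl fun v _ => by ring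
  rw [h3, energy, h2, ← h1]
  ring

theorem IsRegLaplacian.isSymm (hA : G.IsRegLaplacian U s A) : A.IsSymm := by
  have hentry : ∀ u v, A u v = s * G.deg u * (if u = v then 1 else 0) +
      ((if u = v then ∑ w, G.inside U u w else 0) - G.inside U u v) := by
    intro u v
    have := hA (Pi.single v 1) u
    rw [mulVec_single_one, col_apply] at this
    rw [this]
    simp only [Pi.single_apply, mul_sub, sum_sub_distrib, mul_ite, mul_one, mul_zero,
      sum_ite_eq', mem_univ, if_true]
    split_ifs <;> simp
  ext u v
  rw [transpose_apply, hentry, hentry, G.inside_symm U v u]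
  by_cases h : u = v
  · subst h; rfl
  · simp [h, Ne.symm h]

/-- If `G` has a bisection of small cut and `U` has at most a fifth of the volume, then inverse
power iteration for the regularized Laplacian finds a function on the complement of `U` with a
small Rayleigh quotient. -/
theorem exists_good_column (hs : 0 < s) (hA : G.IsRegLaplacian U s A) {B : Matrix V V ℝ}
    (hAB : A * B = 1) {T : Finset V} (hT : G.IsBisection T) (hU : 5 * G.vol U < G.vol univ)
    {θ : ℝ} (hθ : G.cut T ≤ (θ - s) * (3 / 20 * G.vol univ)) (hθ0 : s ≤ θ) :
    ∃ v, ∃ g : V → ℝ, (∀ i, 0 ≤ g i) ∧ (∀ i ∈ U, g i = 0) ∧ 0 < ∑ i, G.deg i * g i ^ 2 ∧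
      energy (G.inside U) g ≤ (2 * θ - s) * ∑ i, G.deg i * g i ^ 2 ∧
      ∀ X : Finset V, X.Nonempty → (∀ i ∈ X, 0 < g i) →
        (∀ u ∈ X, ∀ w ∈ X, ∀ i, g u ≤ g i → g i ≤ g w → i ∈ X) →
        2 * G.vol X ≤ G.vol Uᶜ ∧ ∃ a b, X = interval U
          (fun i => ((B * diagonal G.deg) ^ Fintype.card V) i v) a b := by
  set n := Fintype.card V with hn
  set M := B * diagonal G.deg with hMdef
  have hM : ∀ x v, (A *ᵥ M *ᵥ x) v = G.deg v * x v := fun x v => by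
    rw [hMdef, mulVec_mulVec, ← mul_assoc, hAB, one_mul, mulVec_diagonal]
  have hBA : B * A = 1 := mul_eq_one_comm.1 hAB
  have hinj : ∀ x y : V → ℝ, A *ᵥ x = A *ᵥ y → x = y := fun x y h => by
    have := congrArg (B *ᵥ ·) h
    simpa [mulVec_mulVec, hBA] using this
  have hd : ∀ v, 0 < G.deg v := G.deg_pos'
  set W := Uᶜ with hW
  have hvolW : G.vol U + G.vol W = G.vol univ := sum_add_sum_compl U G.deg
  have hvU := G.vol_nonneg U
  have hWpos : 0 < G.vol W := by linarith
  -- `M` acts as multiplication by `1 / s` on functions that are constant on `W` and zero on `U`,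
  -- and preserves the functions of mean zero on `W`.
  let oneW : V → ℝ := fun v => if v ∈ U then 0 else 1
  have hMone : M *ᵥ oneW = s⁻¹ • oneW := by
    apply hinj
    ext v
    rw [hM, hA]
    have : ∑ u, G.inside U v u * ((s⁻¹ • oneW) v - (s⁻¹ • oneW) u) = 0 := by
      refine sum_eq_zero fun u _ => ?_
      by_cases h : v ∈ U ∨ u ∈ U
      · simp [inside, h]
      · push Not at h
        simp [oneW, h.1, h.2]
    rw [this, Pi.smul_apply, smul_eq_mul]
    field_simp
    ring
  have hMn_one : ∀ t, M ^ t *ᵥ oneW = (s⁻¹) ^ t • oneW := by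
    intro t
    induction t with
    | zero => simp
    | succ t ih =>
      rw [pow_succ', ← mulVec_mulVec, ih, mulVec_smul, hMone, smul_smul, pow_succ]
  have hsplit : ∀ f : V → ℝ, (∀ v ∈ U, f v = 0) → ∑ v, f v = ∑ v ∈ W, f v := fun f hf => by
    rw [← sum_add_sum_compl U, sum_eq_zero hf, zero_add]
  have hsumA : ∀ x, ∑ u ∈ W, (A *ᵥ x) u = s * ∑ u ∈ W, G.deg u * x u := by
    intro x
    have h1 : ∑ u ∈ W, ∑ v, G.inside U u v * (x u - x v) = 0 := by
      have h2 : ∑ u ∈ W, ∑ v, G.inside U u v * (x u - x v)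
          = ∑ u, ∑ v, G.inside U u v * (x u - x v) := by
        exact (hsplit _ fun u hu => sum_eq_zero fun v _ => by simp [inside, hu]).symm
      have h3 : ∑ u, ∑ v, G.inside U u v * (x u - x v)
          = - ∑ u, ∑ v, G.inside U u v * (x u - x v) := by
        conv_lhs => rw [sum_comm]
        rw [← sum_neg_distrib]
        refine sum_congr rfl fun u _ => ?_
        rw [← sum_neg_distrib]
        refine sum_congr rfl fun v _ => ?_
        rw [G.inside_symm U v u]
        ring
      rw [h2]
      linarith
    simp only [hA x, sum_add_distrib, h1, add_zero, mul_sum]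
    exact sum_congr rfl fun u _ => by ring
  have hMU : ∀ x : V → ℝ, (∀ v ∈ U, x v = 0) → ∀ v ∈ U, (M *ᵥ x) v = 0 := by
    intro x hx v hv
    have h1 := hM x v
    rw [hA, hx v hv, mul_zero, sum_eq_zero fun u _ => by simp [inside, hv], add_zero] at h1
    exact (mul_eq_zero.1 h1).resolve_left (mul_pos hs (hd v)).ne'
  have hMmean : ∀ x : V → ℝ, ∑ v ∈ W, G.deg v * x v = 0 →
      ∑ v ∈ W, G.deg v * (M *ᵥ x) v = 0 := by
    intro x hx
    have h1 := hsumA (M *ᵥ x)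
    rw [sum_congr rfl fun u _ => hM x u, hx] at h1
    exact (mul_eq_zero.1 h1.symm).resolve_left hs.ne'
  have hMn : ∀ t (x : V → ℝ), (∀ v ∈ U, x v = 0) → ∑ v ∈ W, G.deg v * x v = 0 →
      (∀ v ∈ U, (M ^ t *ᵥ x) v = 0) ∧ ∑ v ∈ W, G.deg v * (M ^ t *ᵥ x) v = 0 := by
    intro t x h1 h2
    induction t with
    | zero => simpa using ⟨h1, h2⟩
    | succ t ih =>
      rw [pow_succ', ← mulVec_mulVec]
      exact ⟨hMU _ ih.1, hMmean _ ih.2⟩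
  -- the centred coordinate vectors
  let p : V → V → ℝ := fun v =>
    if v ∈ U then 0 else Pi.single v 1 - (G.deg v / G.vol W) • oneW
  have honeW : ∀ v ∈ W, oneW v = 1 := fun v hv => by simp [oneW, mem_compl.1 hv]
  have honeU : ∀ v ∈ U, oneW v = 0 := fun v hv => by simp [oneW, hv]
  have hpW : ∀ v ∉ U, (∀ u ∈ U, p v u = 0) ∧ ∀ u ∈ W, p v u
      = (if u = v then 1 else 0) - G.deg v / G.vol W := by
    intro v hv
    refine ⟨fun u hu => ?_, fun u hu => ?_⟩
    · have : u ≠ v := fun h => hv (h ▸ hu)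
      simp [p, hv, honeU u hu, this]
    · simp [p, hv, honeW u hu, Pi.single_apply]
  have hsumW : ∀ v ∉ U, ∀ f : V → ℝ, ∑ u ∈ W, f u * (if u = v then (1 : ℝ) else 0) = f v := by
    intro v hv f
    simp [hW, hv]
  have hp_mean : ∀ v ∉ U, ∑ u ∈ W, G.deg u * p v u = 0 := by
    intro v hv
    rw [sum_congr rfl fun u hu => by rw [(hpW v hv).2 u hu, mul_sub], sum_sub_distrib,
      hsumW v hv, ← sum_mul]
    change G.deg v - G.vol W * _ = 0
    field_simp
    ring
  have hp_norm : ∀ v, ∑ u, G.deg u * p v u ^ 2 ≤ G.deg v := by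
    intro v
    by_cases hv : v ∈ U
    · simp [p, hv, (hd v).le]
    · rw [hsplit _ fun u hu => by rw [(hpW v hv).1 u hu]; ring]
      have h1 : ∀ u ∈ W, G.deg u * p v u ^ 2 = G.deg u * p v u * (if u = v then 1 else 0)
          - G.deg v / G.vol W * (G.deg u * p v u) := fun u hu => by
        rw [sq, ← mul_assoc]
        conv_lhs => rw [(hpW v hv).2 u hu]
        rw [(hpW v hv).2 u hu]
        ring
      rw [sum_congr rfl h1, sum_sub_distrib, hsumW v hv fun u => G.deg u * p v u, ← mul_sum,
        hp_mean v hv, mul_zero, sub_zero, (hpW v hv).2 v (mem_compl.2 hv)]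
      have := div_pos (hd v) hWpos
      simp only [if_true]
      nlinarith [hd v]
  -- the centred indicator of the bisection
  set c := G.vol (T \ U) / G.vol W with hc
  let z : V → ℝ := fun v => if v ∈ U then 0 else (if v ∈ T then 1 else 0) - c
  have hzU : ∀ v ∈ U, z v = 0 := fun v hv => by simp [z, hv]
  have hzW : ∀ v ∈ W, z v = (if v ∈ T then 1 else 0) - c := fun v hv => by
    simp [z, mem_compl.1 hv]
  have hTU : ∑ v ∈ W, G.deg v * (if v ∈ T then (1 : ℝ) else 0) = G.vol (T \ U) := by
    simp only [mul_ite, mul_one, mul_zero]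
    rw [← sum_filter, vol]
    refine sum_congr ?_ fun _ _ => rfl
    ext v
    simp [hW, and_comm]
  have hzmean : ∑ v ∈ W, G.deg v * z v = 0 := by
    rw [sum_congr rfl fun u hu => by rw [hzW u hu, mul_sub], sum_sub_distrib, hTU, ← sum_mul]
    change _ - G.vol W * c = 0
    rw [hc]
    field_simp
    ring
  have hz : z = ∑ v, z v • p v := by
    ext u
    rw [Finset.sum_apply]
    simp only [Pi.smul_apply, smul_eq_mul]
    rw [hsplit _ fun v hv => by rw [hzU v hv, zero_mul]]
    by_cases hu : u ∈ U
    · rw [hzU u hu]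
      refine (sum_eq_zero fun v hv => ?_).symm
      rw [(hpW v (mem_compl.1 hv)).1 u hu, mul_zero]
    · rw [sum_congr rfl fun v hv => show z v * p v u
          = z v * (if v = u then 1 else 0) - z v * (G.deg v / G.vol W) by
        rw [(hpW v (mem_compl.1 hv)).2 u (mem_compl.2 hu), mul_sub]
        simp only [@eq_comm _ u v], sum_sub_distrib, hsumW u hu z,
        sum_congr rfl fun v _ => show z v * (G.deg v / G.vol W) = G.deg v * z v * (G.vol W)⁻¹ by rw [div_eq_mul_inv]; ring, ← sum_mul, hzmean]
      ring
  have hTuniv : G.vol T = G.vol univ / 2 := hT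
  have hTsplit : G.vol T ≤ G.vol (T \ U) + G.vol U := by
    have h1 : G.vol T ≤ G.vol (T \ U ∪ U) := G.vol_mono fun v hv => by
      by_cases h : v ∈ U <;> simp [h, hv]
    have h2 : G.vol (T \ U ∪ U) = G.vol (T \ U) + G.vol U := sum_union sdiff_disjoint
    linarith
  have hTUle : G.vol (T \ U) ≤ G.vol T := G.vol_mono sdiff_subset
  have hWT : G.vol (T \ U) + G.vol (W \ T) = G.vol W := by
    rw [vol, vol, vol, ← sum_filter_add_sum_filter_not W (· ∈ T)]
    congr 1
    · refine sum_congr ?_ fun _ _ => rfl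
      ext v
      simp [hW, and_comm]
    · refine sum_congr ?_ fun _ _ => rfl
      ext v
      simp
  have hznorm : 3 / 20 * G.vol univ ≤ ∑ v, G.deg v * z v ^ 2 := by
    have h1 : ∑ v, G.deg v * z v ^ 2
        = G.vol (T \ U) * (1 - c) ^ 2 + G.vol (W \ T) * c ^ 2 := by
      rw [hsplit _ fun v hv => by rw [hzU v hv]; ring, vol, vol,
        ← sum_filter_add_sum_filter_not W (· ∈ T), sum_mul, sum_mul]
      congr 1
      · refine sum_congr ?_ fun v hv => ?_
        · ext v
          simp [hW, and_comm]
        · have hv : v ∈ T ∧ v ∉ U := by simpa using hv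
          rw [hzW v (mem_compl.2 hv.2)]
          simp [hv.1]
      · refine sum_congr ?_ fun v hv => ?_
        · ext v
          simp
        · have hv : v ∈ W ∧ v ∉ T := by simpa using hv
          rw [hzW v hv.1]
          simp [hv.2]
    rw [h1]
    -- `U` takes at most a fifth of the volume away from the halves `T` and `Tᶜ`.
    have h2 : 3 / 10 * G.vol univ ≤ G.vol (T \ U) := by linarith
    have h3 : 3 / 10 * G.vol univ ≤ G.vol (W \ T) := by linarith
    nlinarith [mul_le_mul_of_nonneg_right h2 (sq_nonneg (1 - c)),
      mul_le_mul_of_nonneg_right h3 (sq_nonneg c),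
      mul_nonneg (G.vol_nonneg univ) (sq_nonneg (1 - 2 * c))]
  have hvV : 0 < G.vol univ := by linarith
  have hzpos : 0 < ∑ v, G.deg v * z v ^ 2 := lt_of_lt_of_le (by positivity) hznorm
  have henergy_congr : ∀ (f h : V → ℝ) (e : ℝ), (∀ v ∈ W, f v = h v - e) →
      energy (G.inside U) f = energy (G.inside U) h := by
    intro f h e hfh
    unfold energy
    congr 1
    refine sum_congr rfl fun u _ => sum_congr rfl fun v _ => ?_
    by_cases huv : u ∈ U ∨ v ∈ U
    · simp [inside, huv]
    · push Not at huv
      rw [hfh u (mem_compl.2 huv.1), hfh v (mem_compl.2 huv.2)]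
      ring
  have hzE : z ⬝ᵥ A *ᵥ z ≤ θ * ∑ v, G.deg v * z v ^ 2 := by
    rw [hA.quadratic, henergy_congr z _ c hzW, energy_indicator _ (G.inside_symm U)]
    have h1 := G.kcut_inside_le_cut U T
    have h2 := mul_le_mul_of_nonneg_left hznorm (sub_nonneg.2 hθ0)
    linarith
  have hA0 : ∀ x, 0 ≤ x ⬝ᵥ A *ᵥ x := fun x => by
    rw [hA.quadratic]
    have h1 := energy_nonneg (G.inside_nonneg U) x
    have h2 : 0 ≤ ∑ v, G.deg v * x v ^ 2 :=
      sum_nonneg fun v _ => mul_nonneg (hd v).le (sq_nonneg _)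
    positivity
  obtain ⟨v, hv1, hv2⟩ := exists_rayleigh_pow_le hA.isSymm hA0 hd hM (hs.trans_le hθ0) p hz hp_norm
    hzpos hzE
  rw [← hn] at hv1 hv2
  have hvU : v ∉ U := fun h => by simp [p, h] at hv1
  set y := M ^ n *ᵥ p v with hy
  obtain ⟨hyU, hymean⟩ : (∀ i ∈ U, y i = 0) ∧ ∑ i ∈ W, G.deg i * y i = 0 :=
    hMn n (p v) (hpW v hvU).1 (hp_mean v hvU)
  set f : V → ℝ := fun i => (M ^ n) i v with hf
  set e := G.deg v / G.vol W * s⁻¹ ^ n with he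
  have hyf : ∀ i ∈ W, y i = f i - e := fun i hi => by
    have : p v = Pi.single v 1 - (G.deg v / G.vol W) • oneW := by simp [p, hvU]
    rw [hy, this, mulVec_sub, mulVec_smul, hMn_one, mulVec_single_one]
    simp [hf, he, honeW i hi]
  have hynorm : ∑ i, G.deg i * y i ^ 2 = ∑ i ∈ W, G.deg i * (f i - e) ^ 2 := by
    rw [hsplit _ fun i hi => by rw [hyU i hi]; ring]
    exact sum_congr rfl fun i hi => by rw [hyf i hi]
  rw [hA.quadratic, henergy_congr y f e hyf, hynorm] at hv2
  rw [hynorm] at hv1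
  obtain ⟨g, hg0, hgU, hgpos, hgE, hgX⟩ := G.exists_nonneg_of_rayleigh U f (c := e)
    (μ := 2 * θ - s) (by
      rw [← hymean]
      exact sum_congr rfl fun i hi => by rw [hyf i hi]) hv1 (by linarith) (by linarith)
  refine ⟨v, g, hg0, hgU, hgpos, hgE, fun X hX hXpos hXconv => ?_⟩
  obtain ⟨hXW, hXvol, hXf⟩ := hgX X hXpos hXconv
  refine ⟨hXvol, ?_⟩
  obtain ⟨a, ha, hamin⟩ := exists_min_image X f hX
  obtain ⟨b, hb, hbmax⟩ := exists_max_image X f hX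
  refine ⟨a, b, ?_⟩
  ext i
  simp only [interval, mem_filter]
  exact ⟨fun hi => ⟨hXW hi, hamin i hi, hbmax i hi⟩,
    fun hi => hXf a ha b hb i hi.1 hi.2.1 hi.2.2⟩

end WeightedGraph

/-! ### Greedy rounds -/

namespace WeightedGraph

theorem w_le_vol {V : Type*} [Fintype V] (G : WeightedGraph V) (u v : V) : G.w u v ≤ G.vol univ :=
  (single_le_sum (f := fun v => G.w u v) (fun v _ => G.nonneg u v) (mem_univ v)).trans
    (single_le_sum (f := fun u => G.deg u) (fun u _ => (G.deg_pos' u).le) (mem_univ u))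

variable {V : Type*} [Fintype V] [DecidableEq V] {G : WeightedGraph V} {U : Finset V}

theorem exists_le_kcut {β : V → V → ℝ} (h0 : ∀ u v, 0 ≤ β u v) {X : Finset V} :
    0 < kcut β X → ∃ u v, 0 < β u v ∧ β u v ≤ kcut β X := by
  intro h
  obtain ⟨u, hu, h1⟩ := exists_lt_of_sum_lt (s := X) (f := fun _ => (0 : ℝ))
    (g := fun u => ∑ v ∈ Xᶜ, β u v) (by simpa [kcut] using h)
  obtain ⟨v, hv, h2⟩ := exists_lt_of_sum_lt (s := Xᶜ) (f := fun _ => (0 : ℝ))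
    (g := fun v => β u v) (by simpa using h1)
  refine ⟨u, v, h2, (single_le_sum (f := fun v => β u v) (fun v _ => h0 u v) hv).trans ?_⟩
  exact single_le_sum (f := fun u => ∑ v ∈ Xᶜ, β u v)
    (fun u _ => sum_nonneg fun v _ => h0 u v) hu

theorem exists_bisection_eq_min (hT : ∃ T, G.IsBisection T) :
    ∃ T, G.IsBisection T ∧ G.cut T = G.minBisectionConductance * (G.vol univ / 2) := by
  obtain ⟨T, hT⟩ := hT
  have hfin : (G.conductance '' {S | G.IsBisection S}).Finite := (Set.toFinite _).image _
  obtain ⟨T', hT', h⟩ := Set.Nonempty.csInf_mem ⟨_, Set.mem_image_of_mem G.conductance hT⟩ hfin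
  refine ⟨T', hT', ?_⟩
  have h1 : G.vol T' = G.vol univ / 2 := hT'
  have h2 : G.vol T' + G.vol T'ᶜ = G.vol univ := sum_add_sum_compl T' G.deg
  have h3 : G.vol T'ᶜ = G.vol univ / 2 := by linarith
  rw [minBisectionConductance, ← h, conductance, h1, h3, min_self]
  rcases (G.vol_nonneg univ).eq_or_lt with h0 | h0
  · -- a graph of volume zero has no vertices
    have hV : (univ : Finset V) = ∅ := by
      by_contra hne
      exact (G.vol_pos (nonempty_iff_ne_empty.2 hne)).ne h0
    have : T' = ∅ := subset_empty.1 (hV ▸ subset_univ T')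
    simp [this, cut, ← h0]
  · field_simp

variable {s : ℝ} {A B : Matrix V V ℝ}

/-- The sets among which a round chooses: the vertices outside `U` at which the value of column `v`
of `F` lies between those at `a` and at `b`. -/
noncomputable def candidate (U : Finset V) (F : Matrix V V ℝ) (v a b : V) : Finset V :=
  interval U (fun i => F i v) a b

theorem candidate_subset (U : Finset V) (F : Matrix V V ℝ) (v a b : V) : candidate U F v a b ⊆ Uᶜ :=
  filter_subset _ _

theorem exists_candidate (hs : 0 < s) (hA : G.IsRegLaplacian U s A) (hAB : A * B = 1)
    (hT : ∃ T, G.IsBisection T) (hU : 5 * G.vol U < G.vol univ) :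
    ∃ v a b, (candidate U ((B * diagonal G.deg) ^ Fintype.card V) v a b).Nonempty ∧
      2 * G.vol (candidate U ((B * diagonal G.deg) ^ Fintype.card V) v a b) ≤ G.vol Uᶜ := by
  obtain ⟨T, hT⟩ := hT
  have hvol : 0 < G.vol univ := by linarith [G.vol_nonneg U]
  have hcut : 0 ≤ G.cut T := sum_nonneg fun u _ => sum_nonneg fun v _ => G.nonneg u v
  obtain ⟨v, g, hg0, -, hgpos, -, hX⟩ := exists_good_column hs hA hAB hT hU
    (θ := s + G.cut T / (3 / 20 * G.vol univ)) (by
      rw [add_sub_cancel_left, div_mul_cancel₀]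
      positivity) (by
      have : 0 ≤ G.cut T / (3 / 20 * G.vol univ) := by positivity
      linarith)
  obtain ⟨i, -, hi⟩ : ∃ i ∈ univ, 0 < G.deg i * g i ^ 2 := by
    by_contra hcon
    push Not at hcon
    exact absurd hgpos (not_lt.2 (sum_nonpos hcon))
  have hgi : 0 < g i := lt_of_le_of_ne (hg0 i) fun h => by simp [← h] at hi
  obtain ⟨h1, a, b, hab⟩ := hX (univ.filter fun i => 0 < g i) ⟨i, by simpa using hgi⟩
    (fun i hi => (mem_filter.1 hi).2) fun u hu w _ i hui _ =>
      mem_filter.2 ⟨mem_univ _, (mem_filter.1 hu).2.trans_le hui⟩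
  refine ⟨v, a, b, ?_, ?_⟩
  · rw [candidate, ← hab]
    exact ⟨i, by simpa using hgi⟩
  · rw [candidate, ← hab]
    exact h1

/-- If adding any candidate `X` increases the cut by at least `r vol(X)`, then `r` is at most a
constant times `k ε / λ_k`. -/
theorem le_of_forall_candidate (hs : 0 < s) (hA : G.IsRegLaplacian U s A) (hAB : A * B = 1)
    (hT : ∃ T, G.IsBisection T) (hU : 5 * G.vol U < G.vol univ)
    (hsw : ∀ u v, 0 < G.w u v → 8 * s * G.vol univ ^ 2 ≤ G.w u v ^ 2) {r : ℝ}
    (hr : ∀ v a b, (candidate U ((B * diagonal G.deg) ^ Fintype.card V) v a b).Nonempty →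
      2 * G.vol (candidate U ((B * diagonal G.deg) ^ Fintype.card V) v a b) ≤ G.vol Uᶜ →
      r * G.vol (candidate U ((B * diagonal G.deg) ^ Fintype.card V) v a b)
        ≤ G.marginal U (candidate U ((B * diagonal G.deg) ^ Fintype.card V) v a b))
    (k : ℕ) (hk : 1 ≤ k) (hkn : k ≤ Fintype.card V) (hlam : 0 < G.lam k hk hkn) :
    r ≤ 1008 * (k * G.minBisectionConductance / G.lam k hk hkn) := by
  obtain ⟨T, hT, hcutT⟩ := exists_bisection_eq_min hT
  set ε := G.minBisectionConductance with hε
  have hvol : 0 < G.vol univ := by linarith [G.vol_nonneg U]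
  have hcut : 0 ≤ G.cut T := sum_nonneg fun u _ => sum_nonneg fun v _ => G.nonneg u v
  have hε0 : 0 ≤ ε := by
    by_contra h
    nlinarith [not_le.1 h]
  obtain ⟨v, g, hg0, hgU, hgpos, hgE, hX⟩ := exists_good_column hs hA hAB hT hU
    (θ := s + 10 / 3 * ε) (by rw [hcutT]; nlinarith) (by linarith)
  have hmarg : ∀ X : Finset V, X.Nonempty → (∀ i ∈ X, 0 < g i) →
      (∀ u ∈ X, ∀ w ∈ X, ∀ i, g u ≤ g i → g i ≤ g w → i ∈ X) →
      r * G.vol X ≤ G.marginal U X := by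
    intro X h1 h2 h3
    obtain ⟨h4, a, b, rfl⟩ := hX X h1 h2 h3
    exact hr v a b h1 h4
  rcases hε0.eq_or_lt with h0 | hεpos
  · -- If the bisection cuts no edge, then all candidates with a positive boundary have a boundary
    -- so heavy, compared with `s`, that Cheeger's inequality fails.
    rw [← h0, mul_zero, zero_div, mul_zero]
    rw [← h0] at hgE
    by_contra hr0
    have hr0 := not_le.1 hr0
    have hkc : ∀ X : Finset V, X.Nonempty → (∀ i ∈ X, 0 < g i) →
        (∀ u ∈ X, ∀ w ∈ X, ∀ i, g u ≤ g i → g i ≤ g w → i ∈ X) →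
        √(8 * s) * G.vol X ≤ kcut (G.inside U) X := by
      intro X h1 h2 h3
      have h4 : 0 < kcut (G.inside U) X := by
        have h5 := hmarg X h1 h2 h3
        have h6 := mul_pos hr0 (G.vol_pos h1)
        have h7 : 0 ≤ ∑ v ∈ X, G.bdry U v := sum_nonneg fun v _ => G.bdry_nonneg U v
        unfold marginal at h5
        linarith
      obtain ⟨u, w, h5, h6⟩ := exists_le_kcut (G.inside_nonneg U) h4
      have h7 : G.inside U u w = G.w u w := by
        unfold inside at h5 ⊢
        split_ifs at h5 ⊢
        · exact absurd h5 (lt_irrefl _)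
        · rfl
      rw [h7] at h5 h6
      have h8 : √(8 * s) * G.vol univ ≤ G.w u w := by
        rw [← abs_of_pos h5, ← Real.sqrt_sq_eq_abs, ← abs_of_pos hvol, ← Real.sqrt_sq_eq_abs,
          ← Real.sqrt_mul (by positivity)]
        exact Real.sqrt_le_sqrt (hsw u w h5)
      have h9 := mul_le_mul_of_nonneg_left (G.vol_mono (subset_univ X)) (Real.sqrt_nonneg (8 * s))
      linarith
    have h1 : ∑ i, √(8 * s) * G.deg i * g i ^ 2 ≤ variation (G.inside U) fun i => g i ^ 2 := by
      refine sum_mul_le_variation (G.inside_symm U) _ _ (fun i => sq_nonneg _) fun t ht hne => ?_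
      rw [← mul_sum]
      refine hkc _ hne ?_ ?_
      · intro i hi
        have := ht.trans_lt (mem_filter.1 hi).2
        exact lt_of_le_of_ne (hg0 i) fun h => by simp [← h] at this
      · intro u hu w _ i hui _
        exact mem_filter.2 ⟨mem_univ _, (mem_filter.1 hu).2.trans_le
          (pow_le_pow_left₀ (hg0 u) hui 2)⟩
    have h2 := variation_sq_le (G.inside_symm U) (G.inside_nonneg U) (G.sum_inside_le U) g hg0
    simp only [mul_assoc] at h1
    rw [← mul_sum] at h1
    set N := ∑ i, G.deg i * g i ^ 2
    have h3 := (pow_le_pow_left₀ (by positivity) h1 2).trans h2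
    rw [mul_pow, Real.sq_sqrt (by positivity)] at h3
    nlinarith [mul_pos hs (pow_pos hgpos 2)]
  · have hcutpos : 0 < G.cut T := by rw [hcutT]; positivity
    obtain ⟨u, w, h5, h6⟩ := exists_le_kcut G.nonneg (X := T) hcutpos
    have h6 : G.w u w ≤ G.cut T := h6
    have h7 := hsw u w h5
    have hsε : s ≤ ε / 16 := by
      have h8 : 8 * s * G.vol univ ^ 2 ≤ ε / 2 * G.vol univ ^ 2 := by
        nlinarith [G.w_le_vol u w]
      have := le_of_mul_le_mul_right h8 (by positivity)
      linarith
    have h8 := expansion_le g hg0 hgU (μ := 7 * ε) (δ := r) (by linarith) hgpos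
      (hgE.trans (mul_le_mul_of_nonneg_right (by linarith) hgpos.le))
      (fun X h1 h2 h3 => by
        have := hmarg X h1 h2 h3
        unfold marginal at this
        linarith) k hk hkn hlam
    refine h8.trans (le_of_eq ?_)
    ring

/-- What one round of the algorithm does to the current set `U`: while `U` has less than a fifth of
the volume, add to it a candidate `X` for which the ratio of the increase of the cut and `vol(X)` is
least. -/
def IsRound (G : WeightedGraph V) (U U' : Finset V) : Prop :=
  (G.vol univ ≤ 5 * G.vol U → U' = U) ∧
  (5 * G.vol U < G.vol univ → ∃ (s : ℝ) (A B : Matrix V V ℝ), 0 < s ∧ G.IsRegLaplacian U s A ∧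
    A * B = 1 ∧ (∀ u v, 0 < G.w u v → 8 * s * G.vol univ ^ 2 ≤ G.w u v ^ 2) ∧
    ((∀ v a b, (candidate U ((B * diagonal G.deg) ^ Fintype.card V) v a b).Nonempty →
        ¬ 2 * G.vol (candidate U ((B * diagonal G.deg) ^ Fintype.card V) v a b) ≤ G.vol Uᶜ) ∨
      ∃ X : Finset V, X ⊆ Uᶜ ∧ X.Nonempty ∧ 2 * G.vol X ≤ G.vol Uᶜ ∧ U' = U ∪ X ∧
        ∀ v a b, (candidate U ((B * diagonal G.deg) ^ Fintype.card V) v a b).Nonempty →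
          2 * G.vol (candidate U ((B * diagonal G.deg) ^ Fintype.card V) v a b) ≤ G.vol Uᶜ →
          G.marginal U X * G.vol (candidate U ((B * diagonal G.deg) ^ Fintype.card V) v a b)
            ≤ G.marginal U (candidate U ((B * diagonal G.deg) ^ Fintype.card V) v a b)
              * G.vol X))

/-- The invariant of the algorithm after `r` rounds. A set of less than a fifth of the volume grows by
at most half of the rest, hence to at most three fifths; and it grows in each round until it has a
fifth of the volume. -/
structure RoundInvariant (G : WeightedGraph V) (r : ℕ) (U : Finset V) : Prop where
  vol_le : G.vol U ≤ 3 / 5 * G.vol univ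
  cut_le : ∀ (k : ℕ) (hk : 1 ≤ k) (hkn : k ≤ Fintype.card V), 0 < G.lam k hk hkn →
    G.cut U ≤ 1008 * (k * G.minBisectionConductance / G.lam k hk hkn) * G.vol U
  progress : r ≤ U.card ∨ G.vol univ ≤ 5 * G.vol U

theorem RoundInvariant.empty (G : WeightedGraph V) : G.RoundInvariant 0 ∅ :=
  ⟨by simpa [vol] using mul_nonneg (by norm_num : (0 : ℝ) ≤ 3 / 5) (G.vol_nonneg univ),
    fun k hk hkn _ => by simp [cut, vol], Or.inl (Nat.zero_le _)⟩

theorem RoundInvariant.succ {r : ℕ} {U' : Finset V} (h : G.RoundInvariant r U)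
    (hT : ∃ T, G.IsBisection T) (hround : G.IsRound U U') : G.RoundInvariant (r + 1) U' := by
  rcases le_or_gt (G.vol univ) (5 * G.vol U) with hU | hU
  · rw [hround.1 hU]
    exact ⟨h.vol_le, h.cut_le, Or.inr hU⟩
  obtain ⟨s, A, B, hs, hA, hAB, hsw, hX⟩ := hround.2 hU
  rcases hX with hno | ⟨X, hXU, hXne, hXvol, rfl, hmin⟩
  · obtain ⟨v, a, b, h1, h2⟩ := exists_candidate hs hA hAB hT hU
    exact absurd h2 (hno v a b h1)
  have hdisj : Disjoint U X := by
    rw [disjoint_left]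
    exact fun v hv hv' => mem_compl.1 (hXU hv') hv
  have hvolX : G.vol (U ∪ X) = G.vol U + G.vol X := sum_union hdisj
  have hX0 : 0 < G.vol X := G.vol_pos hXne
  have hcompl : G.vol U + G.vol Uᶜ = G.vol univ := sum_add_sum_compl U G.deg
  refine ⟨by rw [hvolX]; linarith, fun k hk hkn hlam => ?_, ?_⟩
  · have h1 := le_of_forall_candidate hs hA hAB hT hU hsw (r := G.marginal U X / G.vol X)
      (fun v a b h1 h2 => by
        rw [div_mul_eq_mul_div, div_le_iff₀ hX0]
        exact hmin v a b h1 h2) k hk hkn hlam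
    rw [div_le_iff₀ hX0] at h1
    rw [G.cut_union U hXU, hvolX, mul_add]
    exact add_le_add (h.cut_le k hk hkn hlam) h1
  · rcases h.progress with h1 | h1
    · left
      rw [card_union_of_disjoint hdisj]
      have := card_pos.2 hXne
      omega
    · linarith

/-- After `|V|` rounds the current set is a balanced separator. -/
theorem RoundInvariant.balanced (h : G.RoundInvariant (Fintype.card V) U) :
    G.vol univ / 5 ≤ G.vol U ∧ G.vol U ≤ 4 / 5 * G.vol univ ∧
    ∀ (k : ℕ) (hk : 2 ≤ k) (hkn : k ≤ Fintype.card V),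
      0 < G.lam k (one_le_two.trans hk) hkn →
        G.conductance U ≤
          1512 * (k * G.minBisectionConductance / G.lam k (one_le_two.trans hk) hkn) := by
  have hv := G.vol_nonneg univ
  have hU : G.vol univ ≤ 5 * G.vol U := by
    rcases h.progress with h1 | h1
    · rw [eq_univ_of_card U (le_antisymm (card_le_univ U) h1)]
      linarith
    · exact h1
  have hle := h.vol_le
  refine ⟨by linarith, by linarith, fun k hk hkn hlam => ?_⟩
  have hne : (univ : Finset V).Nonempty := by
    rw [← card_pos, card_univ]
    omega
  have hpos := G.vol_pos hne
  have hcompl : G.vol U + G.vol Uᶜ = G.vol univ := sum_add_sum_compl U G.deg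
  have hU0 : 0 < G.vol U := by linarith
  have hmin : 2 / 3 * G.vol U ≤ min (G.vol U) (G.vol Uᶜ) := le_min (by linarith) (by linarith)
  have hcut := h.cut_le k (one_le_two.trans hk) hkn hlam
  have hcut0 : 0 ≤ G.cut U := sum_nonneg fun u _ => sum_nonneg fun v _ => G.nonneg u v
  calc G.conductance U ≤ G.cut U / (2 / 3 * G.vol U) :=
        div_le_div_of_nonneg_left hcut0 (by positivity) hmin
    _ ≤ _ := by
        rw [div_le_iff₀ (by positivity)]
        refine hcut.trans (le_of_eq ?_)
        ring

end WeightedGraph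

/-! ### Heights of scalars -/

namespace RAM

/-- If `rat` holds, then `x` is a fraction whose numerator and denominator are at most `2 ^ h`.
With `rat` false this says nothing; in this way one analysis of the program serves both cost
measures. -/
def Height (rat : Prop) (h : ℕ) (x : ℝ) : Prop :=
  rat → ∃ (a : ℤ) (b : ℕ), 0 < b ∧ a.natAbs ≤ 2 ^ h ∧ b ≤ 2 ^ h ∧ x = a / b

namespace Height

variable {rat : Prop} {h h' : ℕ} {x y : ℝ}

theorem mono (hx : Height rat h x) (hh : h ≤ h') : Height rat h' x := fun hr => by
  obtain ⟨a, b, hb, h1, h2, h3⟩ := hx hr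
  have := Nat.pow_le_pow_right (n := 2) (by norm_num) hh
  exact ⟨a, b, hb, h1.trans this, h2.trans this, h3⟩

theorem of_natAbs_le {c : ℤ} (hc : c.natAbs ≤ 2 ^ h) : Height rat h (c : ℝ) := fun _ =>
  ⟨c, 1, Nat.one_pos, hc, Nat.one_le_two_pow, by simp⟩

theorem intCast (c : ℤ) : Height rat c.natAbs (c : ℝ) := of_natAbs_le Nat.lt_two_pow_self.le

theorem zero (h : ℕ) : Height rat h 0 := by
  have := (intCast (rat := rat) 0).mono (Nat.zero_le h)
  simpa using this

theorem one (h : ℕ) : Height rat h 1 := fun _ =>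
  ⟨1, 1, Nat.one_pos, Nat.one_le_two_pow, Nat.one_le_two_pow, by simp⟩

theorem neg (hx : Height rat h x) : Height rat h (-x) := fun hr => by
  obtain ⟨a, b, hb, h1, h2, rfl⟩ := hx hr
  exact ⟨-a, b, hb, by simpa using h1, h2, by push_cast; ring⟩

theorem add (hx : Height rat h x) (hy : Height rat h' y) : Height rat (h + h' + 1) (x + y) :=
  fun hr => by
  obtain ⟨a, b, hb, h1, h2, rfl⟩ := hx hr
  obtain ⟨c, d, hd, h3, h4, rfl⟩ := hy hr
  refine ⟨a * d + b * c, b * d, Nat.mul_pos hb hd, ?_, ?_, ?_⟩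
  · calc (a * d + b * c : ℤ).natAbs ≤ (a * d : ℤ).natAbs + (b * c : ℤ).natAbs :=
        Int.natAbs_add_le _ _
      _ = a.natAbs * d + b * c.natAbs := by simp [Int.natAbs_mul]
      _ ≤ 2 ^ h * 2 ^ h' + 2 ^ h * 2 ^ h' := by gcongr
      _ = 2 ^ (h + h' + 1) := by ring
  · calc b * d ≤ 2 ^ h * 2 ^ h' := by gcongr
      _ ≤ 2 ^ (h + h' + 1) := by
        rw [← pow_add]
        exact Nat.pow_le_pow_right (by norm_num) (Nat.le_succ _)
  · have : (b : ℝ) ≠ 0 := by exact_mod_cast hb.ne'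
    have : (d : ℝ) ≠ 0 := by exact_mod_cast hd.ne'
    push_cast
    field_simp

theorem sub (hx : Height rat h x) (hy : Height rat h' y) : Height rat (h + h' + 1) (x - y) := by
  rw [sub_eq_add_neg]
  exact hx.add hy.neg

theorem mul (hx : Height rat h x) (hy : Height rat h' y) : Height rat (h + h') (x * y) :=
  fun hr => by
  obtain ⟨a, b, hb, h1, h2, rfl⟩ := hx hr
  obtain ⟨c, d, hd, h3, h4, rfl⟩ := hy hr
  refine ⟨a * c, b * d, Nat.mul_pos hb hd, ?_, ?_, ?_⟩
  · rw [Int.natAbs_mul, pow_add]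
    gcongr
  · rw [pow_add]
    gcongr
  · push_cast
    rw [div_mul_div_comm]

theorem inv (hx : Height rat h x) : Height rat h x⁻¹ := fun hr => by
  obtain ⟨a, b, hb, h1, h2, rfl⟩ := hx hr
  rcases eq_or_ne a 0 with rfl | ha
  · exact ⟨0, 1, Nat.one_pos, by simp, Nat.one_le_two_pow, by simp⟩
  rcases Int.natAbs_eq a with h | h
  · refine ⟨b, a.natAbs, Int.natAbs_pos.2 ha, by simpa using h2, h1, ?_⟩
    conv_lhs => rw [h]
    simp
  · refine ⟨-b, a.natAbs, Int.natAbs_pos.2 ha, by simpa using h2, h1, ?_⟩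
    conv_lhs => rw [h]
    simp [neg_div]

theorem div (hx : Height rat h x) (hy : Height rat h' y) : Height rat (h + h') (x / y) := by
  rw [div_eq_mul_inv]
  exact hx.mul hy.inv

/-- Finitely many fractions of bounded height have a common denominator of bounded height. -/
theorem exists_common_denominator {ι : Type*} [Fintype ι] {f : ι → ℝ} (hr : rat)
    (hf : ∀ i, Height rat h (f i)) :
    ∃ (a : ι → ℤ) (b : ℕ), 0 < b ∧ b ≤ 2 ^ (Fintype.card ι * h) ∧
      (∀ i, (a i).natAbs ≤ 2 ^ ((Fintype.card ι + 1) * h)) ∧ ∀ i, f i = a i / b := by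
  classical
  choose a b hb h1 h2 h3 using fun i => hf i hr
  have hprod : ∏ i, b i ≤ 2 ^ (Fintype.card ι * h) := by
    calc ∏ i, b i ≤ ∏ _i : ι, 2 ^ h := prod_le_prod' fun i _ => h2 i
      _ = _ := by rw [prod_const, card_univ, ← pow_mul, mul_comm]
  have hpos : ∀ s : Finset ι, 0 < ∏ i ∈ s, b i := fun s => prod_pos fun i _ => hb i
  refine ⟨fun i => a i * ∏ j ∈ univ.erase i, b j, ∏ i, b i, hpos _, hprod, fun i => ?_,
    fun i => ?_⟩
  · rw [Int.natAbs_mul, add_mul, one_mul, pow_add, mul_comm]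
    refine Nat.mul_le_mul ?_ (h1 i)
    refine le_trans ?_ hprod
    rw [Int.natAbs_natCast, ← mul_prod_erase univ b (mem_univ i)]
    exact Nat.le_mul_of_pos_left _ (hb i)
  · rw [h3 i, ← mul_prod_erase univ b (mem_univ i)]
    have e1 : (b i : ℝ) ≠ 0 := by exact_mod_cast (hb i).ne'
    have e2 : (∏ j ∈ univ.erase i, (b j : ℝ)) ≠ 0 := by exact_mod_cast (hpos _).ne'
    push_cast
    field_simp

/-- The entries of powers of a matrix have heights growing linearly in the exponent, thanks to a
common denominator of all entries. -/
theorem matrix_pow {n : ℕ} {A : Matrix (Fin n) (Fin n) ℝ} (hA : ∀ i j, Height rat h (A i j))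
    (t : ℕ) (i j : Fin n) : Height rat (t * ((n * n + 1) * h + n)) ((A ^ t) i j) := fun hr => by
  obtain ⟨a, b, hb, h1, h2, h3⟩ :=
    exists_common_denominator (f := fun p : Fin n × Fin n => A p.1 p.2) hr fun p => hA p.1 p.2
  simp only [Fintype.card_prod, Fintype.card_fin] at h1 h2
  set H := (n * n + 1) * h + n
  let N : Matrix (Fin n) (Fin n) ℤ := Matrix.of fun i j => a (i, j)
  have hb' : (b : ℝ) ≠ 0 := by exact_mod_cast hb.ne'
  have hAN : A = (b : ℝ)⁻¹ • N.map (Int.cast : ℤ → ℝ) := by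
    ext i j
    have := h3 (i, j)
    simp only at this
    simp [this, N, div_eq_inv_mul]
  have hNt : ∀ t i j, ((N ^ t) i j).natAbs ≤ 2 ^ (t * H) := by
    intro t
    induction t with
    | zero =>
      intro i j
      rw [pow_zero, Matrix.one_apply]
      split_ifs <;> simp
    | succ t ih =>
      intro i j
      rw [pow_succ, Matrix.mul_apply]
      calc (∑ k, (N ^ t) i k * N k j).natAbs ≤ ∑ k, ((N ^ t) i k * N k j).natAbs :=
            Int.natAbs_sum_le _ _
        _ ≤ ∑ _k : Fin n, 2 ^ (t * H) * 2 ^ ((n * n + 1) * h) := by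
            gcongr with k _
            rw [Int.natAbs_mul]
            exact Nat.mul_le_mul (ih i k) (h2 (k, j))
        _ = n * (2 ^ (t * H) * 2 ^ ((n * n + 1) * h)) := by simp
        _ ≤ 2 ^ n * (2 ^ (t * H) * 2 ^ ((n * n + 1) * h)) :=
            Nat.mul_le_mul_right _ Nat.lt_two_pow_self.le
        _ = 2 ^ ((t + 1) * H) := by
            rw [← pow_add, ← pow_add]
            congr 1
            simp only [H]
            ring
  refine ⟨(N ^ t) i j, b ^ t, pow_pos hb t, hNt t i j, ?_, ?_⟩
  · rw [mul_comm, pow_mul]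
    refine Nat.pow_le_pow_left (h1.trans (Nat.pow_le_pow_right (by norm_num) ?_)) t
    simp only [H]
    nlinarith
  · have h4 : (N.map (Int.cast : ℤ → ℝ)) ^ t = (N ^ t).map (Int.cast : ℤ → ℝ) := by
      have := map_pow (Int.castRingHom ℝ).mapMatrix N t
      simpa using this.symm
    rw [hAN, smul_pow, h4]
    simp [div_eq_inv_mul]

/-- **Cramer's rule** bounds the heights of the entries of an inverse matrix. -/
theorem matrix_inv {n : ℕ} {A : Matrix (Fin n) (Fin n) ℝ} (hA : ∀ i j, Height rat h (A i j))
    (hdet : A.det ≠ 0) (i j : Fin n) :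
    Height rat (n * n * h + 2 * (n * n + n * ((n * n + 1) * h))) (A⁻¹ i j) := fun hr => by
  obtain ⟨a, b, hb, h1, h2, h3⟩ :=
    exists_common_denominator (f := fun p : Fin n × Fin n => A p.1 p.2) hr fun p => hA p.1 p.2
  simp only [Fintype.card_prod, Fintype.card_fin] at h1 h2
  let N : Matrix (Fin n) (Fin n) ℤ := Matrix.of fun i j => a (i, j)
  have hb' : (b : ℝ) ≠ 0 := by exact_mod_cast hb.ne'
  set D := 2 ^ ((n * n + 1) * h) with hD
  have hD1 : 1 ≤ D := Nat.one_le_two_pow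
  have hdetle : ∀ K : Matrix (Fin n) (Fin n) ℤ, (∀ i j, (K i j).natAbs ≤ D) →
      K.det.natAbs ≤ 2 ^ (n * n + n * ((n * n + 1) * h)) := by
    intro K hK
    have h4 : |K.det| ≤ Nat.factorial (Fintype.card (Fin n)) • (D : ℤ) ^ Fintype.card (Fin n) :=
      Matrix.det_le (abv := AbsoluteValue.abs) fun i j => by
        have := hK i j
        change |K i j| ≤ D
        rw [Int.abs_eq_natAbs]
        exact_mod_cast this
    rw [Fintype.card_fin, nsmul_eq_mul] at h4
    have h5 : K.det.natAbs ≤ n.factorial * D ^ n := by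
      change |K.det| ≤ _ at h4
      rw [Int.abs_eq_natAbs] at h4
      exact_mod_cast h4
    refine h5.trans ?_
    rw [pow_add]
    refine Nat.mul_le_mul ?_ ?_
    · calc n.factorial ≤ n ^ n := Nat.factorial_le_pow n
        _ ≤ (2 ^ n) ^ n := Nat.pow_le_pow_left Nat.lt_two_pow_self.le n
        _ = 2 ^ (n * n) := by rw [← pow_mul]
    · rw [hD, ← pow_mul, mul_comm]
  have hNA : N.map (Int.cast : ℤ → ℝ) = (b : ℝ) • A := by
    ext i j
    have := h3 (i, j)
    simp only at this
    simp only [Matrix.map_apply, Matrix.of_apply, Matrix.smul_apply, smul_eq_mul, this, N]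
    field_simp
  have hdetN : (N.det : ℝ) = (b : ℝ) ^ n * A.det := by
    have := (Int.castRingHom ℝ).map_det N
    simp only [eq_intCast, RingHom.mapMatrix_apply] at this
    rw [this]
    change (N.map (Int.cast : ℤ → ℝ)).det = _
    rw [hNA, Matrix.det_smul, Fintype.card_fin]
  have hdetN0 : (N.det : ℝ) ≠ 0 := by
    rw [hdetN]
    exact mul_ne_zero (pow_ne_zero _ hb') hdet
  have hadj : (N.adjugate i j : ℝ) = ((b : ℝ) • A).adjugate i j := by
    rw [← hNA]
    have := congrFun (congrFun ((Int.castRingHom ℝ).map_adjugate N) i) j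
    simpa using this
  have hinv : A⁻¹ i j = b * (N.adjugate i j / N.det) := by
    have h4 : ((b : ℝ) • A)⁻¹ = (b : ℝ)⁻¹ • A⁻¹ := by
      have := Matrix.inv_smul' A (Units.mk0 (b : ℝ) hb') (isUnit_iff_ne_zero.2 hdet)
      simpa [Units.smul_def] using this
    have h5 : A⁻¹ i j = b * ((b : ℝ) • A)⁻¹ i j := by
      rw [h4, Matrix.smul_apply, smul_eq_mul]
      field_simp
    have h6 : ((b : ℝ) • A).det = N.det := by
      rw [Matrix.det_smul, Fintype.card_fin, hdetN]
    rw [h5, Matrix.inv_def, Matrix.smul_apply, ← hadj, h6, Ring.inverse_eq_inv', smul_eq_mul]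
    ring
  rw [hinv]
  have hadjle : (N.adjugate i j).natAbs ≤ 2 ^ (n * n + n * ((n * n + 1) * h)) := by
    rw [Matrix.adjugate_apply]
    refine hdetle _ fun k l => ?_
    rw [Matrix.updateRow_apply]
    split_ifs with hk
    · rw [Pi.single_apply]
      split_ifs
      · simpa using hD1
      · simp
    · exact h2 (k, l)
  have e1 : Height rat (n * n * h) (((b : ℤ) : ℝ)) := of_natAbs_le (by simpa using h1)
  rw [Int.cast_natCast] at e1
  exact (e1.mul ((of_natAbs_le hadjle).div (of_natAbs_le (hdetle N fun i j => h2 (i, j))))).mono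
    (by omega) hr

end Height

end RAM

/-! ### A weakest precondition calculus with built-in cost bounds -/

namespace RAM

/-- The resources available to a program: `natBound` bounds all natural numbers in memory,
`loopBound` the number of iterations of every loop, and `height a` the heights of the entries of the
scalar array `a` (which matter only if `rat` holds). -/
structure Resources where
  natBound : ℕ
  loopBound : ℕ
  height : ℕ → ℕ
  rat : Prop

/-- The memory `s` respects the resources. -/
structure Resources.Ok (E : Resources) (s : State) : Prop where
  var : ∀ x, s.var x ≤ E.natBound
  int : ∀ a i, s.int a i ≤ E.natBound
  scal : ∀ a i, Height E.rat (E.height a) (s.scal a i)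

/-- An upper bound for the value of an expression if all numbers in memory are at most `M`. -/
def IExpr.valueBound (M : ℕ) : IExpr → ℕ
  | .const c => c
  | .var _ => M
  | .get _ _ => M
  | .add e f => e.valueBound M + f.valueBound M
  | .sub e _ => e.valueBound M
  | .mul e f => e.valueBound M * f.valueBound M
  | .div e _ => e.valueBound M

/-- An upper bound for the cost of an expression if all numbers in memory are at most `M`. -/
def IExpr.costBound (M : ℕ) : IExpr → ℕ
  | .const c => c + 1
  | .var _ => M + 1
  | .get _ i => i.costBound M + (M + 1)
  | .add e f => e.costBound M + f.costBound M + (e.valueBound M + f.valueBound M + 1)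
  | .sub e f => e.costBound M + f.costBound M + (e.valueBound M + 1)
  | .mul e f => e.costBound M + f.costBound M + (e.valueBound M * f.valueBound M + 1)
  | .div e f => e.costBound M + f.costBound M + (e.valueBound M + 1)

/-- An upper bound for the height of the value of an expression. -/
def SExpr.heightBound (η : ℕ → ℕ) : SExpr → ℕ
  | .const c => c.natAbs
  | .get a _ => η a
  | .add e f => e.heightBound η + f.heightBound η + 1
  | .sub e f => e.heightBound η + f.heightBound η + 1
  | .mul e f => e.heightBound η + f.heightBound η
  | .div e f => e.heightBound η + f.heightBound η

/-- An upper bound for the cost of a scalar expression; a scalar of height `h` has size at most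
`2 h + 4`. -/
def SExpr.costBound (M : ℕ) (η : ℕ → ℕ) : SExpr → ℕ
  | .const c => 2 * c.natAbs + 4
  | .get a i => i.costBound M + (2 * η a + 4)
  | .add e f => e.costBound M η + f.costBound M η + (2 * (SExpr.add e f).heightBound η + 4)
  | .sub e f => e.costBound M η + f.costBound M η + (2 * (SExpr.sub e f).heightBound η + 4)
  | .mul e f => e.costBound M η + f.costBound M η + (2 * (SExpr.mul e f).heightBound η + 4)
  | .div e f => e.costBound M η + f.costBound M η + (2 * (SExpr.div e f).heightBound η + 4)

/-- An upper bound for the cost of a test. -/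
def BExpr.costBound (M : ℕ) (η : ℕ → ℕ) : BExpr → ℕ
  | .ilt e f => e.costBound M + f.costBound M + 1
  | .slt e f => e.costBound M η + f.costBound M η + 1
  | .not b => b.costBound M η + 1
  | .and b c => b.costBound M η + c.costBound M η + 1

/-- An upper bound for the cost of a program whose loops have at most `R` iterations. -/
def Cmd.costBound (M R : ℕ) (η : ℕ → ℕ) : Cmd → ℕ
  | .skip => 1
  | .setVar _ e => e.costBound M + 1
  | .setInt _ i e => i.costBound M + e.costBound M + 1
  | .setScal _ i e => i.costBound M + e.costBound M η + 1
  | .seq c d => c.costBound M R η + d.costBound M R η + 1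
  | .ite b c d => b.costBound M η + (c.costBound M R η + d.costBound M R η) + 1
  | .while b c => (R + 1) * (b.costBound M η + c.costBound M R η + 1)

/-- Weakest preconditions. Running the command from the given memory, which respects the resources,
keeps to the resources and ends in a memory satisfying `Q`. For loops, an invariant is asked for. -/
def wp (E : Resources) : Cmd → (State → Prop) → State → Prop
  | .skip, Q, s => Q s
  | .setVar x e, Q, s =>
      e.eval s ≤ E.natBound ∧ Q { s with var := Function.update s.var x (e.eval s) }
  | .setInt a i e, Q, s => e.eval s ≤ E.natBound ∧
      Q { s with
        int := Function.update s.int a (Function.update (s.int a) (i.eval s) (e.eval s)) }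
  | .setScal a i e, Q, s => E.Ok s → Height E.rat (E.height a) (e.eval s) ∧
      Q { s with
        scal := Function.update s.scal a (Function.update (s.scal a) (i.eval s) (e.eval s)) }
  | .seq c d, Q, s => wp E c (wp E d Q) s
  | .ite b c d, Q, s => (b.eval s → wp E c Q s) ∧ (¬ b.eval s → wp E d Q s)
  | .while b c, Q, s => ∃ (J : ℕ → State → Prop) (m : ℕ), m ≤ E.loopBound ∧ J 0 s ∧
      (∀ i < m, ∀ s', E.Ok s' → J i s' → b.eval s' ∧ wp E c (J (i + 1)) s') ∧
      ∀ s', J m s' → ¬ b.eval s' ∧ Q s'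

variable {E : Resources} {s : State}

theorem intSize_le (m : ℕ) : intSize m ≤ m + 1 := by
  unfold intSize
  have : Nat.size m ≤ m := Nat.size_le.2 Nat.lt_two_pow_self
  omega

theorem intSize_le_of_le {m k : ℕ} (h : m ≤ k) : intSize m ≤ k + 1 :=
  (intSize_le m).trans (Nat.succ_le_succ h)

theorem IExpr.eval_le (hs : E.Ok s) (e : IExpr) : e.eval s ≤ e.valueBound E.natBound := by
  induction e with
  | const c => exact le_rfl
  | var x => exact hs.var x
  | get a i _ => exact hs.int a _
  | add e f he hf => exact Nat.add_le_add he hf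
  | sub e f he _ => exact (Nat.sub_le _ _).trans he
  | mul e f he hf => exact Nat.mul_le_mul he hf
  | div e f he _ => exact (Nat.div_le_self _ _).trans he

theorem IExpr.cost_le (hs : E.Ok s) (e : IExpr) : e.cost s ≤ e.costBound E.natBound := by
  induction e with
  | const c => exact intSize_le c
  | var x => exact intSize_le_of_le (hs.var x)
  | get a i hi => exact Nat.add_le_add hi (intSize_le_of_le (hs.int a _))
  | add e f he hf =>
    exact Nat.add_le_add (Nat.add_le_add he hf) (intSize_le_of_le ((IExpr.add e f).eval_le hs))
  | sub e f he hf =>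
    exact Nat.add_le_add (Nat.add_le_add he hf) (intSize_le_of_le ((IExpr.sub e f).eval_le hs))
  | mul e f he hf =>
    exact Nat.add_le_add (Nat.add_le_add he hf) (intSize_le_of_le ((IExpr.mul e f).eval_le hs))
  | div e f he hf =>
    exact Nat.add_le_add (Nat.add_le_add he hf) (intSize_le_of_le ((IExpr.div e f).eval_le hs))

theorem SExpr.height_eval (hs : E.Ok s) (e : SExpr) :
    Height E.rat (e.heightBound E.height) (e.eval s) := by
  induction e with
  | const c => exact Height.intCast c
  | get a i => exact hs.scal a _
  | add e f he hf => exact he.add hf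
  | sub e f he hf => exact he.sub hf
  | mul e f he hf => exact he.mul hf
  | div e f he hf => exact he.div hf

variable {size : ℝ → ℕ}

theorem SExpr.cost_le (hsize : ∀ h x, Height E.rat h x → size x ≤ 2 * h + 4) (hs : E.Ok s)
    (e : SExpr) : e.cost size s ≤ e.costBound E.natBound E.height := by
  induction e with
  | const c => exact hsize _ _ (Height.intCast c)
  | get a i => exact Nat.add_le_add (i.cost_le hs) (hsize _ _ (hs.scal a _))
  | add e f he hf =>
    exact Nat.add_le_add (Nat.add_le_add he hf) (hsize _ _ ((SExpr.add e f).height_eval hs))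
  | sub e f he hf =>
    exact Nat.add_le_add (Nat.add_le_add he hf) (hsize _ _ ((SExpr.sub e f).height_eval hs))
  | mul e f he hf =>
    exact Nat.add_le_add (Nat.add_le_add he hf) (hsize _ _ ((SExpr.mul e f).height_eval hs))
  | div e f he hf =>
    exact Nat.add_le_add (Nat.add_le_add he hf) (hsize _ _ ((SExpr.div e f).height_eval hs))

theorem BExpr.cost_le (hsize : ∀ h x, Height E.rat h x → size x ≤ 2 * h + 4) (hs : E.Ok s)
    (b : BExpr) : b.cost size s ≤ b.costBound E.natBound E.height := by
  induction b with
  | ilt e f => exact Nat.succ_le_succ (Nat.add_le_add (e.cost_le hs) (f.cost_le hs))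
  | slt e f => exact Nat.succ_le_succ (Nat.add_le_add (e.cost_le hsize hs) (f.cost_le hsize hs))
  | not b hb => exact Nat.succ_le_succ hb
  | and b c hb hc => exact Nat.succ_le_succ (Nat.add_le_add hb hc)

theorem Resources.Ok.setVar (hs : E.Ok s) {x m : ℕ} (hm : m ≤ E.natBound) :
    E.Ok { s with var := Function.update s.var x m } :=
  ⟨fun y => by
    by_cases h : y = x
    · subst h; simpa using hm
    · simpa [h] using hs.var y, hs.int, hs.scal⟩

theorem Resources.Ok.setInt (hs : E.Ok s) {a i m : ℕ} (hm : m ≤ E.natBound) :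
    E.Ok { s with int := Function.update s.int a (Function.update (s.int a) i m) } :=
  ⟨hs.var, fun b j => by
    by_cases h : b = a
    · subst h
      by_cases h' : j = i
      · subst h'; simpa using hm
      · simpa [h'] using hs.int b j
    · simpa [h] using hs.int b j, hs.scal⟩

theorem Resources.Ok.setScal (hs : E.Ok s) {a i : ℕ} {x : ℝ}
    (hx : Height E.rat (E.height a) x) :
    E.Ok { s with scal := Function.update s.scal a (Function.update (s.scal a) i x) } :=
  ⟨hs.var, hs.int, fun b j => by
    by_cases h : b = a
    · subst h
      by_cases h' : j = i
      · subst h'; simpa using hx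
      · simpa [h'] using hs.scal b j
    · simpa [h] using hs.scal b j⟩

/-- **Soundness.** A weakest precondition yields an execution, of cost at most `costBound`. -/
theorem exec_of_wp (hsize : ∀ h x, Height E.rat h x → size x ≤ 2 * h + 4) (c : Cmd)
    {Q : State → Prop} (hs : E.Ok s) (h : wp E c Q s) :
    ∃ s' t, Exec size c s s' t ∧ Q s' ∧ E.Ok s' ∧
      t ≤ c.costBound E.natBound E.loopBound E.height := by
  induction c generalizing s Q with
  | skip => exact ⟨s, 1, .skip s, h, hs, le_rfl⟩
  | setVar x e =>
    exact ⟨_, _, .setVar s x e, h.2, hs.setVar h.1, Nat.succ_le_succ (e.cost_le hs)⟩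
  | setInt a i e =>
    exact ⟨_, _, .setInt s a i e, h.2, hs.setInt h.1,
      Nat.succ_le_succ (Nat.add_le_add (i.cost_le hs) (e.cost_le hs))⟩
  | setScal a i e =>
    exact ⟨_, _, .setScal s a i e, (h hs).2, hs.setScal (h hs).1,
      Nat.succ_le_succ (Nat.add_le_add (i.cost_le hs) (e.cost_le hsize hs))⟩
  | seq c d hc hd =>
    obtain ⟨s', t, h1, h2, h3, h4⟩ := hc hs h
    obtain ⟨s'', t', h5, h6, h7, h8⟩ := hd h3 h2
    exact ⟨s'', _, .seq h1 h5, h6, h7, Nat.succ_le_succ (Nat.add_le_add h4 h8)⟩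
  | ite b c d hc hd =>
    have hb := b.cost_le hsize hs
    by_cases hbs : b.eval s
    · obtain ⟨s', t, h1, h2, h3, h4⟩ := hc hs (h.1 hbs)
      refine ⟨s', _, .iteTrue hbs h1, h2, h3, ?_⟩
      simp only [Cmd.costBound]
      omega
    · obtain ⟨s', t, h1, h2, h3, h4⟩ := hd hs (h.2 hbs)
      refine ⟨s', _, .iteFalse hbs h1, h2, h3, ?_⟩
      simp only [Cmd.costBound]
      omega
  | _ =>
    rename_i b c hc
    obtain ⟨J, m, hm, h0, hstep, hend⟩ := h
    -- the remaining `m - i` iterations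
    have key : ∀ k ≤ m, ∀ s, E.Ok s → J (m - k) s → ∃ s' t, Exec size (.while b c) s s' t ∧ Q s' ∧
        E.Ok s' ∧ t ≤ (k + 1) * (b.costBound E.natBound E.height +
          c.costBound E.natBound E.loopBound E.height + 1) := by
      intro k
      induction k with
      | zero =>
        intro _ s hs hJ
        obtain ⟨h1, h2⟩ := hend s hJ
        refine ⟨s, _, .whileFalse h1, h2, hs, ?_⟩
        have := b.cost_le hsize hs
        omega
      | succ k ih =>
        intro hk s hs hJ
        obtain ⟨h1, h2⟩ := hstep (m - (k + 1)) (by omega) s hs hJ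
        obtain ⟨s', t, h3, h4, h5, h6⟩ := hc hs h2
        rw [show m - (k + 1) + 1 = m - k by omega] at h4
        obtain ⟨s'', t', h7, h8, h9, h10⟩ := ih (by omega) s' h5 h4
        refine ⟨s'', _, .whileTrue h1 h3 h7, h8, h9, ?_⟩
        have := b.cost_le hsize hs
        rw [add_mul (k + 1) 1]
        omega
    obtain ⟨s', t, h1, h2, h3, h4⟩ := key m le_rfl s hs (by simpa using h0)
    exact ⟨s', t, h1, h2, h3, h4.trans (Nat.mul_le_mul_right _ (by omega))⟩

/-- The final memory does not depend on the cost measure. -/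
theorem Exec.deterministic {size' : ℝ → ℕ} {c : Cmd} {s₁ s₂ : State} {t₁ t₂ : ℕ}
    (h₁ : Exec size c s s₁ t₁) (h₂ : Exec size' c s s₂ t₂) : s₁ = s₂ := by
  induction h₁ generalizing s₂ t₂ with
  | skip => cases h₂; rfl
  | setVar => cases h₂; rfl
  | setInt => cases h₂; rfl
  | setScal => cases h₂; rfl
  | seq _ _ ih1 ih2 =>
    cases h₂ with
    | seq h3 h4 =>
      cases ih1 h3
      exact ih2 h4
  | iteTrue hb _ ih =>
    cases h₂ with
    | iteTrue _ h3 => exact ih h3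
    | iteFalse hb' _ => exact absurd hb hb'
  | iteFalse hb _ ih =>
    cases h₂ with
    | iteTrue hb' _ => exact absurd hb' hb
    | iteFalse _ h3 => exact ih h3
  | whileTrue hb _ _ ih1 ih2 =>
    cases h₂ with
    | whileTrue _ h3 h4 =>
      cases ih1 h3
      exact ih2 h4
    | whileFalse hb' => exact absurd hb hb'
  | whileFalse hb =>
    cases h₂ with
    | whileTrue hb' _ _ => exact absurd hb' hb
    | whileFalse _ => rfl

theorem wp_mono {c : Cmd} {Q Q' : State → Prop} (hQ : ∀ s, Q s → Q' s) (h : wp E c Q s) :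
    wp E c Q' s := by
  induction c generalizing s Q Q' with
  | skip => exact hQ _ h
  | setVar x e => exact ⟨h.1, hQ _ h.2⟩
  | setInt a i e => exact ⟨h.1, hQ _ h.2⟩
  | setScal a i e => exact fun hs => ⟨(h hs).1, hQ _ (h hs).2⟩
  | seq c d hc hd => exact hc (fun s hs => hd hQ hs) h
  | ite b c d hc hd => exact ⟨fun hb => hc hQ (h.1 hb), fun hb => hd hQ (h.2 hb)⟩
  | _ =>
    obtain ⟨J, m, hm, h0, hstep, hend⟩ := h
    exact ⟨J, m, hm, h0, hstep, fun s' hs' => ⟨(hend s' hs').1, hQ _ (hend s' hs').2⟩⟩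

/-! ### Frames -/

/-- Does the command contain an assignment to the register `x`? -/
def Cmd.writesVar (x : ℕ) : Cmd → Bool
  | .setVar y _ => x == y
  | .seq c d => c.writesVar x || d.writesVar x
  | .ite _ c d => c.writesVar x || d.writesVar x
  | .while _ c => c.writesVar x
  | _ => false

/-- Does the command contain an assignment to an entry of the integer array `a`? -/
def Cmd.writesInt (a : ℕ) : Cmd → Bool
  | .setInt b _ _ => a == b
  | .seq c d => c.writesInt a || d.writesInt a
  | .ite _ c d => c.writesInt a || d.writesInt a
  | .while _ c => c.writesInt a
  | _ => false

/-- Does the command contain an assignment to an entry of the scalar array `a`? -/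
def Cmd.writesScal (a : ℕ) : Cmd → Bool
  | .setScal b _ _ => a == b
  | .seq c d => c.writesScal a || d.writesScal a
  | .ite _ c d => c.writesScal a || d.writesScal a
  | .while _ c => c.writesScal a
  | _ => false

/-- The memories `s` and `s'` agree on everything that `c` does not write to. -/
structure Frame (c : Cmd) (s s' : State) : Prop where
  var : ∀ x, c.writesVar x = false → s'.var x = s.var x
  int : ∀ a, c.writesInt a = false → s'.int a = s.int a
  scal : ∀ a, c.writesScal a = false → s'.scal a = s.scal a

theorem Frame.refl (c : Cmd) (s : State) : Frame c s s :=
  ⟨fun _ _ => rfl, fun _ _ => rfl, fun _ _ => rfl⟩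

theorem Frame.trans {c : Cmd} {s s' s'' : State} (h : Frame c s s') (h' : Frame c s' s'') :
    Frame c s s'' :=
  ⟨fun x hx => (h'.var x hx).trans (h.var x hx), fun x hx => (h'.int x hx).trans (h.int x hx),
    fun x hx => (h'.scal x hx).trans (h.scal x hx)⟩

theorem Frame.weaken {c d : Cmd} {s s' : State} (h : Frame c s s')
    (h1 : ∀ x, d.writesVar x = false → c.writesVar x = false)
    (h2 : ∀ x, d.writesInt x = false → c.writesInt x = false)
    (h3 : ∀ x, d.writesScal x = false → c.writesScal x = false) : Frame d s s' :=
  ⟨fun x hx => h.var x (h1 x hx), fun x hx => h.int x (h2 x hx), fun x hx => h.scal x (h3 x hx)⟩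

theorem Frame.seq_left {c d : Cmd} {s s' : State} (h : Frame c s s') : Frame (.seq c d) s s' :=
  h.weaken (fun _ hx => (Bool.or_eq_false_iff.1 hx).1) (fun _ hx => (Bool.or_eq_false_iff.1 hx).1)
    fun _ hx => (Bool.or_eq_false_iff.1 hx).1

theorem Frame.seq_right {c d : Cmd} {s s' : State} (h : Frame d s s') : Frame (.seq c d) s s' :=
  h.weaken (fun _ hx => (Bool.or_eq_false_iff.1 hx).2) (fun _ hx => (Bool.or_eq_false_iff.1 hx).2)
    fun _ hx => (Bool.or_eq_false_iff.1 hx).2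

/-- The frame rule. -/
theorem wp_frame {c : Cmd} {Q : State → Prop} (h : wp E c Q s) :
    wp E c (fun s' => Q s' ∧ Frame c s s') s := by
  induction c generalizing s Q with
  | skip => exact ⟨h, Frame.refl _ _⟩
  | setVar x e =>
    refine ⟨h.1, h.2, fun y hy => ?_, fun _ _ => rfl, fun _ _ => rfl⟩
    have : y ≠ x := by simpa [Cmd.writesVar] using hy
    simp [this]
  | setInt a i e =>
    refine ⟨h.1, h.2, fun _ _ => rfl, fun y hy => ?_, fun _ _ => rfl⟩
    have : y ≠ a := by simpa [Cmd.writesInt] using hy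
    simp [this]
  | setScal a i e =>
    refine fun hs => ⟨(h hs).1, (h hs).2, fun _ _ => rfl, fun _ _ => rfl, fun y hy => ?_⟩
    have : y ≠ a := by simpa [Cmd.writesScal] using hy
    simp [this]
  | seq c d hc hd =>
    change wp E c (wp E d _) s
    refine wp_mono (fun s' hs' => ?_) (hc h)
    exact wp_mono (fun s'' hs'' => ⟨hs''.1, hs'.2.seq_left.trans hs''.2.seq_right⟩) (hd hs'.1)
  | ite b c d hc hd =>
    refine ⟨fun hb => wp_mono (fun s' hs' => ⟨hs'.1, ?_⟩) (hc (h.1 hb)),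
      fun hb => wp_mono (fun s' hs' => ⟨hs'.1, ?_⟩) (hd (h.2 hb))⟩
    · exact (hs'.2.seq_left (d := d)).weaken (fun _ h => h) (fun _ h => h) fun _ h => h
    · exact (hs'.2.seq_right (c := c)).weaken (fun _ h => h) (fun _ h => h) fun _ h => h
  | _ =>
    rename_i b c hc
    obtain ⟨J, m, hm, h0, hstep, hend⟩ := h
    refine ⟨fun i s' => J i s' ∧ Frame (.while b c) s s', m, hm, ⟨h0, Frame.refl _ _⟩,
      fun i hi s' hok hs' => ⟨(hstep i hi s' hok hs'.1).1, ?_⟩,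
      fun s' hs' => ⟨(hend s' hs'.1).1, (hend s' hs'.1).2, hs'.2⟩⟩
    refine wp_mono (fun s'' hs'' => ⟨hs''.1, hs'.2.trans ?_⟩) (hc (hstep i hi s' hok hs'.1).2)
    exact hs''.2.weaken (fun _ h => h) (fun _ h => h) fun _ h => h

/-- The rule of consequence, combined with the frame rule. -/
theorem wp_conseq {c : Cmd} {Q Q' : State → Prop} (h : wp E c Q s)
    (hQ : ∀ s', Frame c s s' → Q s' → Q' s') : wp E c Q' s :=
  wp_mono (fun s' hs' => hQ s' hs'.2 hs'.1) (wp_frame h)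

/-- `for x < b do c`. -/
def forTo (x : ℕ) (b : IExpr) (c : Cmd) : Cmd :=
  .seq (.setVar x (.const 0))
    (.while (.ilt (.var x) b) (.seq c (.setVar x (.add (.var x) (.const 1)))))

/-- The rule for `for` loops. The invariant speaks about the arrays only; everything the loop does
not write to is known to be unchanged. -/
theorem wp_forTo {x : ℕ} {b : IExpr} {c : Cmd} {Q : State → Prop} (m : ℕ)
    (hm : m ≤ E.natBound) (hm' : m ≤ E.loopBound) (hx : c.writesVar x = false)
    (hb : ∀ s', Frame (forTo x b c) s s' → b.eval s' = m)
    (J : ℕ → (ℕ → ℕ → ℕ) → (ℕ → ℕ → ℝ) → Prop) (h0 : J 0 s.int s.scal)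
    (hstep : ∀ i < m, ∀ s', E.Ok s' → Frame (forTo x b c) s s' → s'.var x = i → J i s'.int s'.scal →
      wp E c (fun s'' => J (i + 1) s''.int s''.scal) s')
    (hend : ∀ s', Frame (forTo x b c) s s' → J m s'.int s'.scal → Q s') :
    wp E (forTo x b c) Q s := by
  have hself : ∀ s : State, ∀ v, Frame (forTo x b c) s
      { s with var := Function.update s.var x v } := fun s v => by
    refine ⟨fun y hy => ?_, fun _ _ => rfl, fun _ _ => rfl⟩
    have : y ≠ x := by
      rintro rfl
      simp [forTo, Cmd.writesVar] at hy
    simp [this]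
  refine ⟨Nat.zero_le _, fun i s' => J i s'.int s'.scal ∧ s'.var x = i ∧
    Frame (forTo x b c) s s', m, hm', ⟨h0, by simp [IExpr.eval], hself _ _⟩, ?_, ?_⟩
  · rintro i hi s' hok ⟨h1, h2, h3⟩
    refine ⟨?_, ?_⟩
    · simp only [BExpr.eval, IExpr.eval]
      rw [hb s' h3, h2]
      exact hi
    · change wp E c (wp E (.setVar x (.add (.var x) (.const 1))) _) s'
      refine wp_conseq (hstep i hi s' hok h3 h2 h1) fun s'' hf hJ => ?_
      have h4 : s''.var x = i := (hf.var x hx).trans h2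
      refine ⟨?_, hJ, ?_, ?_⟩
      · simp only [IExpr.eval]
        omega
      · simp [IExpr.eval, h4]
      · refine (h3.trans ?_).trans (hself s'' _)
        refine hf.weaken (fun y hy => ?_) (fun y hy => ?_) fun y hy => ?_
        all_goals
          simp only [forTo, Cmd.writesVar, Cmd.writesInt, Cmd.writesScal,
            Bool.or_eq_false_iff] at hy
          exact hy.2.1
  · rintro s' ⟨h1, h2, h3⟩
    refine ⟨?_, hend s' h3 h1⟩
    simp only [BExpr.eval, IExpr.eval]
    rw [hb s' h3, h2]
    exact lt_irrefl _

/-- Set cell `0` of the scalar array `a` to the sum of `e` over `x < b`. -/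
def sumTo (a x : ℕ) (b : IExpr) (e : SExpr) : Cmd :=
  .seq (.setScal a (.const 0) (.const 0))
    (forTo x b (.setScal a (.const 0) (.add (.get a (.const 0)) e)))

theorem wp_sumTo {a x : ℕ} {b : IExpr} {e : SExpr} {Q : State → Prop} (m : ℕ) (val : ℕ → ℝ)
    (hm : m ≤ E.natBound) (hm' : m ≤ E.loopBound)
    (hh : m * (e.heightBound E.height + 1) ≤ E.height a)
    (hb : ∀ s', Frame (sumTo a x b e) s s' → b.eval s' = m)
    (heval : ∀ i < m, ∀ s', Frame (sumTo a x b e) s s' → s'.var x = i → e.eval s' = val i)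
    (hend : ∀ s', Frame (sumTo a x b e) s s' → s'.scal a 0 = ∑ i ∈ range m, val i →
      Height E.rat (m * (e.heightBound E.height + 1)) (s'.scal a 0) → Q s') :
    wp E (sumTo a x b e) Q s := by
  refine fun _ => ⟨by simpa [SExpr.eval] using Height.zero _, ?_⟩
  set s₁ : State := { s with
    scal := Function.update s.scal a
      (Function.update (s.scal a) ((IExpr.const 0).eval s) ((SExpr.const 0).eval s)) } with hs₁
  have hframe : ∀ s', Frame (forTo x b (.setScal a (.const 0) (.add (.get a (.const 0)) e))) s₁ s' →
      Frame (sumTo a x b e) s s' := fun s' hf => by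
    refine Frame.trans (s' := s₁) ⟨fun _ _ => rfl, fun _ _ => rfl, fun y hy => ?_⟩ hf.seq_right
    have : y ≠ a := by
      rintro rfl
      simp [sumTo, Cmd.writesScal] at hy
    simp [hs₁, this]
  refine wp_forTo m hm hm' rfl (fun s' hf => hb s' (hframe s' hf))
    (fun i _ σ => σ a 0 = ∑ j ∈ range i, val j ∧
      Height E.rat (i * (e.heightBound E.height + 1)) (σ a 0)) ?_ ?_
    fun s' hf hJ => hend s' (hframe s' hf) hJ.1 hJ.2
  · simp [hs₁, IExpr.eval, SExpr.eval, Height.zero]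
  · rintro i hi s' hok hf hxi ⟨h1, h2⟩ -
    have h3 := heval i hi s' (hframe s' hf) hxi
    have h4 := (h2.add (SExpr.height_eval hok e)).mono
      (show i * (e.heightBound E.height + 1) + e.heightBound E.height + 1
        ≤ (i + 1) * (e.heightBound E.height + 1) by ring_nf; omega)
    refine ⟨h4.mono (le_trans (Nat.mul_le_mul_right _ hi) hh), ?_, ?_⟩
    · simp [IExpr.eval, SExpr.eval, h1, h3, sum_range_succ]
    · simpa [IExpr.eval, SExpr.eval] using h4

/-! ### Polynomial bounds -/

/-- `f` is bounded by a polynomial. -/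
def PolyBounded (f : ℕ → ℕ) : Prop := ∃ p : Polynomial ℕ, ∀ N, f N ≤ p.eval N

namespace PolyBounded

variable {f g : ℕ → ℕ}

theorem const (c : ℕ) : PolyBounded fun _ => c := ⟨Polynomial.C c, fun N => by simp⟩

theorem id : PolyBounded fun N => N := ⟨Polynomial.X, fun N => by simp⟩

theorem add (hf : PolyBounded f) (hg : PolyBounded g) : PolyBounded fun N => f N + g N := by
  obtain ⟨p, hp⟩ := hf
  obtain ⟨q, hq⟩ := hg
  exact ⟨p + q, fun N => by
    rw [Polynomial.eval_add]
    exact Nat.add_le_add (hp N) (hq N)⟩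

theorem mul (hf : PolyBounded f) (hg : PolyBounded g) : PolyBounded fun N => f N * g N := by
  obtain ⟨p, hp⟩ := hf
  obtain ⟨q, hq⟩ := hg
  exact ⟨p * q, fun N => by
    rw [Polynomial.eval_mul]
    exact Nat.mul_le_mul (hp N) (hq N)⟩

variable {M R : ℕ → ℕ} {η : ℕ → ℕ → ℕ}

theorem iexpr_valueBound (hM : PolyBounded M) (e : IExpr) :
    PolyBounded fun N => e.valueBound (M N) := by
  induction e with
  | const c => exact const c
  | var _ => exact hM
  | get _ _ _ => exact hM
  | add e f he hf => exact he.add hf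
  | sub e f he _ => exact he
  | mul e f he hf => exact he.mul hf
  | div e f he _ => exact he

theorem iexpr_costBound (hM : PolyBounded M) (e : IExpr) :
    PolyBounded fun N => e.costBound (M N) := by
  induction e with
  | const c => exact const _
  | var _ => exact hM.add (const 1)
  | get _ i hi => exact hi.add (hM.add (const 1))
  | add e f he hf => exact (he.add hf).add ((iexpr_valueBound hM (.add e f)).add (const 1))
  | sub e f he hf => exact (he.add hf).add ((iexpr_valueBound hM (.sub e f)).add (const 1))
  | mul e f he hf => exact (he.add hf).add ((iexpr_valueBound hM (.mul e f)).add (const 1))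
  | div e f he hf => exact (he.add hf).add ((iexpr_valueBound hM (.div e f)).add (const 1))

theorem sexpr_heightBound (hη : ∀ a, PolyBounded fun N => η N a) (e : SExpr) :
    PolyBounded fun N => e.heightBound (η N) := by
  induction e with
  | const c => exact const _
  | get a _ => exact hη a
  | add e f he hf => exact (he.add hf).add (const 1)
  | sub e f he hf => exact (he.add hf).add (const 1)
  | mul e f he hf => exact he.add hf
  | div e f he hf => exact he.add hf

theorem sexpr_costBound (hM : PolyBounded M) (hη : ∀ a, PolyBounded fun N => η N a) (e : SExpr) :
    PolyBounded fun N => e.costBound (M N) (η N) := by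
  have h : ∀ e : SExpr, PolyBounded fun N => 2 * e.heightBound (η N) + 4 := fun e =>
    ((const 2).mul (sexpr_heightBound hη e)).add (const 4)
  induction e with
  | const c => exact const _
  | get a i => exact (iexpr_costBound hM i).add (((const 2).mul (hη a)).add (const 4))
  | add e f he hf => exact (he.add hf).add (h (.add e f))
  | sub e f he hf => exact (he.add hf).add (h (.sub e f))
  | mul e f he hf => exact (he.add hf).add (h (.mul e f))
  | div e f he hf => exact (he.add hf).add (h (.div e f))

theorem bexpr_costBound (hM : PolyBounded M) (hη : ∀ a, PolyBounded fun N => η N a) (b : BExpr) :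
    PolyBounded fun N => b.costBound (M N) (η N) := by
  induction b with
  | ilt e f => exact ((iexpr_costBound hM e).add (iexpr_costBound hM f)).add (const 1)
  | slt e f => exact ((sexpr_costBound hM hη e).add (sexpr_costBound hM hη f)).add (const 1)
  | not b hb => exact hb.add (const 1)
  | and b c hb hc => exact (hb.add hc).add (const 1)

/-- The cost bound of a fixed program is polynomial if the resources are. -/
theorem cmd_costBound (hM : PolyBounded M) (hR : PolyBounded R)
    (hη : ∀ a, PolyBounded fun N => η N a) (c : Cmd) :
    PolyBounded fun N => c.costBound (M N) (R N) (η N) := by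
  induction c with
  | skip => exact const 1
  | setVar _ e => exact (iexpr_costBound hM e).add (const 1)
  | setInt _ i e => exact ((iexpr_costBound hM i).add (iexpr_costBound hM e)).add (const 1)
  | setScal _ i e => exact ((iexpr_costBound hM i).add (sexpr_costBound hM hη e)).add (const 1)
  | seq c d hc hd => exact (hc.add hd).add (const 1)
  | ite b c d hc hd => exact ((bexpr_costBound hM hη b).add (hc.add hd)).add (const 1)
  | _ =>
    rename_i b c hc
    exact (hR.add (const 1)).mul (((bexpr_costBound hM hη b).add hc).add (const 1))

end PolyBounded

end RAM

/-! ### Loops over vectors, matrices and triples -/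

namespace RAM

/-- The enumeration of a finite type `ι` by the numbers below the value of the expression `b`, for
programs that keep the number `n` in register `0`. -/
structure Enumeration (n : ℕ) (ι : Type) (b : IExpr) where
  size : ℕ
  equiv : ι ≃ Fin size
  eval : ∀ s : State, s.var 0 = n → b.eval s = size
  size_le : size ≤ n + n * n + n * n * n

/-- The indices of a vector. -/
def vectorIndex (n : ℕ) : Enumeration n (Fin n) (.var 0) :=
  ⟨n, Equiv.refl _, fun _ h => h, by omega⟩

/-- The indices of a matrix, row by row. -/
def matrixIndex (n : ℕ) : Enumeration n (Fin n × Fin n) (.mul (.var 0) (.var 0)) :=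
  ⟨n * n, finProdFinEquiv, fun s h => by simp [IExpr.eval, h], by omega⟩

/-- Triples of indices. -/
def tripleIndex (n : ℕ) :
    Enumeration n ((Fin n × Fin n) × Fin n) (.mul (.mul (.var 0) (.var 0)) (.var 0)) :=
  ⟨n * n * n, (finProdFinEquiv.prodCongr (Equiv.refl _)).trans finProdFinEquiv,
    fun s h => by simp [IExpr.eval, h], by omega⟩

/-- The row of a matrix index. -/
def rowOf (e : IExpr) : IExpr := .div e (.var 0)

/-- The column of a matrix index. -/
def colOf (e : IExpr) : IExpr := .sub e (.mul (.var 0) (rowOf e))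

/-- The entry of a matrix. -/
def entry (a : ℕ) (i j : IExpr) : SExpr := .get a (.add j (.mul (.var 0) i))

/-- The first cell of an array. -/
def cell (a : ℕ) : SExpr := .get a (.const 0)

section Eval

variable {n : ℕ} {s : State}

theorem rowOf_eval (h0 : s.var 0 = n) {e : IExpr} {i : ℕ} {j : Fin n}
    (he : e.eval s = j + n * i) : (rowOf e).eval s = i := by
  simp only [rowOf, IExpr.eval, he, h0]
  rw [Nat.add_mul_div_left _ _ j.pos, Nat.div_eq_of_lt j.isLt, zero_add]

theorem colOf_eval (h0 : s.var 0 = n) {e : IExpr} {i : ℕ} {j : Fin n}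
    (he : e.eval s = j + n * i) : (colOf e).eval s = j := by
  have := rowOf_eval h0 he
  simp only [colOf, IExpr.eval, he, h0, this]
  omega

theorem entry_eval (h0 : s.var 0 = n) {a : ℕ} {e f : IExpr} {A : Matrix (Fin n) (Fin n) ℝ}
    (hA : ∀ p, s.scal a ((matrixIndex n).equiv p) = A p.1 p.2) {i j : Fin n}
    (he : e.eval s = i) (hf : f.eval s = j) : (entry a e f).eval s = A i j := by
  rw [← hA (i, j)]
  simp only [entry, SExpr.eval, IExpr.eval, he, hf, h0]
  rfl

theorem get_eval {a : ℕ} {e : IExpr} {x : Fin n → ℝ}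
    (hx : ∀ i, s.scal a ((vectorIndex n).equiv i) = x i) {i : Fin n}
    (he : e.eval s = i) : (SExpr.get a e).eval s = x i := by
  rw [← hx i]
  simp only [SExpr.eval, he]
  rfl

end Eval

/-- The resources suffice for loops over vectors, matrices and triples. -/
structure Resources.Fits (E : Resources) (n : ℕ) : Prop where
  natBound : n + n * n + n * n * n ≤ E.natBound
  loopBound : n + n * n + n * n * n ≤ E.loopBound

section Loops

variable {E : Resources} {n : ℕ} {s : State} {ι : Type} {b : IExpr} {x : ℕ} {c : Cmd}
  {Q : State → Prop}

theorem wp_seq {d : Cmd} {R : State → Prop} (hc : wp E c R s)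
    (hd : ∀ s', Frame c s s' → R s' → wp E d Q s') : wp E (.seq c d) Q s := by
  change wp E c (wp E d Q) s
  exact wp_conseq hc hd

theorem wp_store {a k : ℕ} {e : SExpr} {v : ℝ} (hx : s.var x = k) (he : e.eval s = v)
    (hh : E.Ok s → Height E.rat (E.height a) v) :
    wp E (.setScal a (.var x) e) (fun s' => s'.scal a = Function.update (s.scal a) k v) s := by
  refine fun hok => ⟨by rw [he]; exact hh hok, ?_⟩
  simp [IExpr.eval, hx, he]

/-- The rule for loops that run through a finite type. The invariant speaks about the set of the
elements that have been dealt with. -/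
theorem wp_forEach [Fintype ι] [DecidableEq ι] (R : Enumeration n ι b) (hE : E.Fits n)
    (h0 : s.var 0 = n) (hx0 : (forTo x b c).writesVar 0 = false) (hx : c.writesVar x = false)
    (J : Finset ι → (ℕ → ℕ → ℕ) → (ℕ → ℕ → ℝ) → Prop) (hJ : J ∅ s.int s.scal)
    (hstep : ∀ S, ∀ i ∉ S, ∀ s', E.Ok s' → Frame (forTo x b c) s s' → s'.var 0 = n →
      s'.var x = R.equiv i → J S s'.int s'.scal →
      wp E c (fun s'' => J (insert i S) s''.int s''.scal) s')
    (hend : ∀ s', Frame (forTo x b c) s s' → J univ s'.int s'.scal → Q s') :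
    wp E (forTo x b c) Q s := by
  refine wp_forTo R.size (R.size_le.trans hE.natBound) (R.size_le.trans hE.loopBound) hx
    (fun s' hf => R.eval s' ((hf.var 0 hx0).trans h0))
    (fun k => J (univ.filter fun i => (R.equiv i : ℕ) < k)) (by simpa using hJ) ?_ fun s' hf h => ?_
  · intro k hk s' hok hf hxk h
    obtain ⟨i, hi⟩ := R.equiv.surjective ⟨k, hk⟩
    have hi' : (R.equiv i : ℕ) = k := by rw [hi]
    have hins : (univ.filter fun j => (R.equiv j : ℕ) < k + 1)
        = insert i (univ.filter fun j => (R.equiv j : ℕ) < k) := by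
      ext j
      rw [mem_insert, mem_filter, mem_filter, ← R.equiv.injective.eq_iff, Fin.ext_iff, hi']
      simp only [mem_univ, true_and]
      omega
    rw [hins]
    exact hstep _ i (by simp [hi']) s' hok hf ((hf.var 0 hx0).trans h0) (hxk.trans hi'.symm) h
  · refine hend s' hf ?_
    have : (univ.filter fun i => (R.equiv i : ℕ) < R.size) = univ :=
      filter_true_of_mem fun i _ => (R.equiv i).isLt
    rwa [this] at h

/-- The rule for loops that fill an array. -/
theorem wp_fillEach [Fintype ι] [DecidableEq ι] (R : Enumeration n ι b) (hE : E.Fits n)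
    (h0 : s.var 0 = n) (hx0 : (forTo x b c).writesVar 0 = false) (hx : c.writesVar x = false)
    (a : ℕ) (val : ι → ℝ)
    (hstep : ∀ i, ∀ s', E.Ok s' → Frame (forTo x b c) s s' → s'.var 0 = n →
      s'.var x = R.equiv i → s'.scal a (R.equiv i) = s.scal a (R.equiv i) →
      wp E c (fun s'' => s''.scal a = Function.update (s'.scal a) (R.equiv i) (val i)) s')
    (hend : ∀ s', Frame (forTo x b c) s s' → (∀ i, s'.scal a (R.equiv i) = val i) → Q s') :
    wp E (forTo x b c) Q s := by
  refine wp_forEach R hE h0 hx0 hx (fun S _ σ => (∀ i ∈ S, σ a (R.equiv i) = val i) ∧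
    ∀ i ∉ S, σ a (R.equiv i) = s.scal a (R.equiv i)) ⟨by simp, fun _ _ => rfl⟩ ?_
    fun s' hf h => hend s' hf fun i => h.1 i (mem_univ i)
  rintro S i hi s' hok hf h1 h2 ⟨h3, h4⟩
  refine wp_mono (fun s'' hs'' => ?_) (hstep i s' hok hf h1 h2 (h4 i hi))
  have hne : ∀ j, j ≠ i → (R.equiv j : ℕ) ≠ R.equiv i := fun j hj h =>
    hj (R.equiv.injective (Fin.ext h))
  refine ⟨fun j hj => ?_, fun j hj => ?_⟩
  · rw [hs'']
    rcases eq_or_ne j i with rfl | hji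
    · rw [Function.update_self]
    · rw [Function.update_of_ne (hne j hji)]
      exact h3 j ((mem_insert.1 hj).resolve_left hji)
  · rw [mem_insert, not_or] at hj
    rw [hs'', Function.update_of_ne (hne j hj.1)]
    exact h4 j hj.2

/-- The rule for summation loops. -/
theorem wp_sumEach [Fintype ι] {a : ℕ} {e : SExpr} (R : Enumeration n ι b)
    (hE : E.Fits n) (h0 : s.var 0 = n) (hx0 : (sumTo a x b e).writesVar 0 = false) (val : ι → ℝ)
    (hh : R.size * (e.heightBound E.height + 1) ≤ E.height a)
    (heval : ∀ i, ∀ s', Frame (sumTo a x b e) s s' → s'.var 0 = n → s'.var x = R.equiv i →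
      e.eval s' = val i)
    (hend : ∀ s', Frame (sumTo a x b e) s s' → s'.scal a 0 = ∑ i, val i → Q s') :
    wp E (sumTo a x b e) Q s := by
  refine wp_sumTo R.size (fun k => if h : k < R.size then val (R.equiv.symm ⟨k, h⟩) else 0)
    (R.size_le.trans hE.natBound) (R.size_le.trans hE.loopBound) hh
    (fun s' hf => R.eval s' ((hf.var 0 hx0).trans h0)) (fun k hk s' hf hxk => ?_)
    fun s' hf h _ => hend s' hf ?_
  · rw [dif_pos hk]
    exact heval _ s' hf ((hf.var 0 hx0).trans h0) (by simp [hxk])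
  · rw [h, sum_range, ← R.equiv.symm.sum_comp val]
    exact sum_congr rfl fun k _ => by rw [dif_pos k.isLt]

end Loops

theorem Height.finset_sum {rat : Prop} {h : ℕ} {ι : Type*} {S : Finset ι} {f : ι → ℝ}
    (hf : ∀ i ∈ S, Height rat h (f i)) : Height rat (S.card * (h + 1)) (∑ i ∈ S, f i) := by
  classical
  induction S using Finset.induction_on with
  | empty => simpa using Height.zero 0
  | insert i S hi ih =>
    rw [sum_insert hi, card_insert_of_notMem hi]
    exact ((hf i (mem_insert_self i S)).add (ih fun j hj => hf j (mem_insert_of_mem hj))).mono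
      (by ring_nf; omega)

end RAM

/-! ### The program: preparations -/

namespace RAM

/-! Bounds for the heights of the numbers that occur, for a graph with at most `N` vertices and edge
weights of height at most `N`. -/

def degHeight (N : ℕ) : ℕ := N * (N + 1)

def volHeight (N : ℕ) : ℕ := N * (degHeight N + 1)

def minHeight (N : ℕ) : ℕ := N + volHeight N

def regHeight (N : ℕ) : ℕ := 2 * minHeight N + 2 * volHeight N + 8

def laplacianHeight (N : ℕ) : ℕ := regHeight N + degHeight N + N * N * (N + 5) + 1

def inverseHeight (N : ℕ) : ℕ :=
  N * N * laplacianHeight N + 2 * (N * N + N * ((N * N + 1) * laplacianHeight N))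

def powerHeight (N : ℕ) : ℕ := N * ((N * N + 1) * (inverseHeight N + degHeight N) + N)

/-- The heights of the entries of the scalar arrays. The program uses the arrays as follows:
`0` the weights; `1` the degrees; `2` the volume of the graph; `3` the smallest weight; `4` the
regularization parameter; `5` the volume of the current set; `6` the current set; `7` the inverse of
the regularized Laplacian; `8` and `9` the vector and the coefficient of a rank-one update of it;
`10` and `11` the power of the walk operator and its successor; `12`, `13` and `14` the candidate,
its volume and its marginal cut; `15`, `16` and `17` volume, marginal cut and elements of the best
candidate so far; `18` and `19` accumulators. -/
def arrayHeight (N : ℕ) : ℕ → ℕ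
  | 0 => N
  | 1 => degHeight N
  | 2 => volHeight N
  | 3 => minHeight N
  | 4 => regHeight N
  | 5 => volHeight N
  | 6 => 0
  | 7 => inverseHeight N
  | 8 => 2 * inverseHeight N + 1
  | 9 => 2 * N + 4 * inverseHeight N + 17
  | 10 => powerHeight N
  | 11 => powerHeight N
  | 12 => 2
  | 13 => N * (degHeight N + 3)
  | 14 => N * N * (N + 11)
  | 15 => N * (degHeight N + 3)
  | 16 => N * N * (N + 11)
  | 17 => 2
  | 18 => degHeight N
  | 19 => N * (inverseHeight N + degHeight N + powerHeight N + 1)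
  | _ => 0

/-- The resources for a graph with at most `N` vertices and weights of height at most `N`. -/
def resources (rat : Prop) (N : ℕ) : Resources where
  natBound := N + N * N + N * N * N + 1
  loopBound := N + N * N + N * N * N
  height := arrayHeight N
  rat := rat

theorem resources_fits {rat : Prop} {n N : ℕ} (h : n ≤ N) : (resources rat N).Fits n := by
  have : n + n * n + n * n * n ≤ N + N * N + N * N * N := by gcongr
  exact ⟨this.trans (Nat.le_succ _), this⟩

/-- The degrees of the vertices. -/
def degrees : Cmd :=
  forTo 2 (.var 0) (.seq (sumTo 18 3 (.var 0) (entry 0 (.var 2) (.var 3)))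
    (.setScal 1 (.var 2) (cell 18)))

/-- The volume of the graph. -/
def totalVol : Cmd := sumTo 2 2 (.var 0) (.get 1 (.var 2))

/-- The smallest positive weight, or the volume if there is none. -/
def minWeight : Cmd :=
  .seq (.setScal 3 (.const 0) (cell 2))
    (forTo 2 (.mul (.var 0) (.var 0))
      (.ite (.and (.slt (.const 0) (.get 0 (.var 2))) (.slt (.get 0 (.var 2)) (cell 3)))
        (.setScal 3 (.const 0) (.get 0 (.var 2))) .skip))

/-- The regularization parameter, an eighth of the square of the smallest weight relative to the
volume. -/
def regParameter : Cmd :=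
  .setScal 4 (.const 0)
    (.div (.mul (cell 3) (cell 3)) (.mul (.const 8) (.mul (cell 2) (cell 2))))

/-- The data of the graph that are computed once. -/
def prepare : Cmd := .seq degrees (.seq totalVol (.seq minWeight regParameter))

/-- The memory holds the data computed by `prepare`. -/
structure Prepared {n : ℕ} (G : WeightedGraph (Fin n)) (s : State) : Prop where
  size : s.var 0 = n
  weights : ∀ p, s.scal 0 ((matrixIndex n).equiv p) = G.w p.1 p.2
  deg : ∀ i, s.scal 1 ((vectorIndex n).equiv i) = G.deg i
  vol : s.scal 2 0 = G.vol univ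
  reg : 0 < G.vol univ → 0 < s.scal 4 0 ∧
    ∀ u v, 0 < G.w u v → 8 * s.scal 4 0 * G.vol univ ^ 2 ≤ G.w u v ^ 2

theorem Prepared.of_frame {n : ℕ} {G : WeightedGraph (Fin n)} {s s' : State} {c : Cmd}
    (h : Prepared G s) (hf : Frame c s s') (hv : c.writesVar 0 = false)
    (h0 : c.writesScal 0 = false) (h1 : c.writesScal 1 = false) (h2 : c.writesScal 2 = false)
    (h4 : c.writesScal 4 = false) : Prepared G s' := by
  refine ⟨(hf.var 0 hv).trans h.size, ?_, ?_, ?_, ?_⟩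
  · rw [hf.scal 0 h0]; exact h.weights
  · rw [hf.scal 1 h1]; exact h.deg
  · rw [hf.scal 2 h2]; exact h.vol
  · rw [hf.scal 4 h4]; exact h.reg

variable {n N : ℕ} {rat : Prop} {G : WeightedGraph (Fin n)} {s : State} {Q : State → Prop}

theorem wp_degrees (hn : n ≤ N) (h0 : s.var 0 = n)
    (hw : ∀ p, s.scal 0 ((matrixIndex n).equiv p) = G.w p.1 p.2)
    (hQ : ∀ s', Frame degrees s s' → (∀ i, s'.scal 1 ((vectorIndex n).equiv i) = G.deg i) → Q s') :
    wp (resources rat N) degrees Q s := by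
  refine wp_fillEach (vectorIndex n) (resources_fits hn) h0 rfl rfl 1 G.deg ?_ hQ
  intro i s1 _ hf1 h1 hi _
  refine wp_seq (R := fun s' => s'.scal 18 0 = G.deg i) ?_ fun s2 hf2 h2 => ?_
  · refine wp_sumEach (vectorIndex n) (resources_fits hn) h1 rfl (fun j => G.w i j) ?_ ?_
      fun s' _ h => h
    · exact Nat.mul_le_mul hn le_rfl
    · intro j s2 hf2 h2 hj
      refine entry_eval (A := G.w) h2 ?_ ((hf2.var 2 rfl).trans hi) hj
      rw [hf2.scal 0 rfl, hf1.scal 0 rfl]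
      exact hw
  · rw [← hf2.scal 1 rfl]
    refine wp_store ((hf2.var 2 rfl).trans hi) h2 fun hok => ?_
    rw [← h2]
    exact hok.scal 18 0

theorem wp_minWeight (hn : n ≤ N) (h0 : s.var 0 = n)
    (hw : ∀ p, s.scal 0 ((matrixIndex n).equiv p) = G.w p.1 p.2) (hvol : s.scal 2 0 = G.vol univ)
    (hQ : ∀ s', Frame minWeight s s' → (0 < G.vol univ → 0 < s'.scal 3 0) →
      (∀ u v, 0 < G.w u v → s'.scal 3 0 ≤ G.w u v) → Q s') :
    wp (resources rat N) minWeight Q s := by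
  suffices h : wp (resources rat N) minWeight (fun s' => (0 < G.vol univ → 0 < s'.scal 3 0) ∧
      ∀ u v, 0 < G.w u v → s'.scal 3 0 ≤ G.w u v) s from
    wp_conseq h fun s' hf h' => hQ s' hf h'.1 h'.2
  refine wp_seq (R := fun s' => s'.scal 3 0 = G.vol univ) (fun hok => ⟨?_, ?_⟩) fun s1 hf1 h1 => ?_
  · exact (SExpr.height_eval hok (cell 2)).mono (Nat.le_add_left _ _)
  · simpa [cell, SExpr.eval, IExpr.eval] using hvol
  · have hs1 : s1.var 0 = n := (hf1.var 0 rfl).trans h0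
    refine wp_forEach (matrixIndex n) (resources_fits hn) hs1 rfl rfl
      (fun S _ σ => (0 < G.vol univ → 0 < σ 3 0) ∧
        ∀ p ∈ S, 0 < G.w p.1 p.2 → σ 3 0 ≤ G.w p.1 p.2) (by simp [h1]) ?_
      fun s' _ h => ⟨h.1, fun u v => h.2 (u, v) (mem_univ _)⟩
    rintro S p hp s2 hok hf2 h2 hpx ⟨h3, h4⟩
    have hwp : s2.scal 0 (s2.var 2) = G.w p.1 p.2 := by
      rw [hpx]
      rw [hf2.scal 0 rfl, hf1.scal 0 rfl, hw]
    have hc : SExpr.eval s2 (cell 3) = s2.scal 3 0 := rfl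
    refine ⟨fun hb => fun _ => ⟨?_, ?_⟩, fun hb => ⟨h3, ?_⟩⟩
    · exact (hok.scal 0 _).mono (Nat.le_add_right _ _)
    · simp only [BExpr.eval, hc, SExpr.eval, IExpr.eval, hwp, Int.cast_zero] at hb
      simp only [SExpr.eval, IExpr.eval, hwp, Function.update_self]
      refine ⟨fun _ => hb.1, fun q hq hq' => ?_⟩
      rcases mem_insert.1 hq with rfl | hq
      · exact le_rfl
      · exact hb.2.le.trans (h4 q hq hq')
    · simp only [BExpr.eval, hc, SExpr.eval, IExpr.eval, hwp, Int.cast_zero] at hb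
      intro q hq hq'
      rcases mem_insert.1 hq with rfl | hq
      · exact not_lt.1 fun h => hb ⟨hq', h⟩
      · exact h4 q hq hq'

theorem wp_prepare (hn : n ≤ N) (h0 : s.var 0 = n)
    (hw : ∀ p, s.scal 0 ((matrixIndex n).equiv p) = G.w p.1 p.2)
    (hQ : ∀ s', Frame prepare s s' → Prepared G s' → Q s') :
    wp (resources rat N) prepare Q s := by
  suffices h : wp (resources rat N) prepare (Prepared G) s from wp_conseq h hQ
  refine wp_seq (wp_degrees hn h0 hw fun s1 _ h => h) fun s1 hf1 h1 => ?_
  have hs1 : s1.var 0 = n := (hf1.var 0 rfl).trans h0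
  refine wp_seq (R := fun s' => s'.scal 2 0 = G.vol univ) ?_ fun s2 hf2 h2 => ?_
  · refine wp_sumEach (vectorIndex n) (resources_fits hn) hs1 rfl G.deg
      (Nat.mul_le_mul hn le_rfl) (fun i s' hf h hi => ?_) fun s' _ h => h
    refine get_eval ?_ hi
    rw [hf.scal 1 rfl]
    exact h1
  have hs2 : s2.var 0 = n := (hf2.var 0 rfl).trans hs1
  have hw2 : ∀ p, s2.scal 0 ((matrixIndex n).equiv p) = G.w p.1 p.2 := by
    rw [hf2.scal 0 rfl, hf1.scal 0 rfl]
    exact hw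
  refine wp_seq (wp_minWeight hn hs2 hw2 h2 fun s3 _ h h' => And.intro h h') fun s3 hf3 h3 hok => ?_
  refine ⟨(SExpr.height_eval hok _).mono ?_, ?_⟩
  · change minHeight N + minHeight N + (8 + (volHeight N + volHeight N)) ≤ regHeight N
    unfold regHeight
    omega
  · have hvol : s3.scal 2 0 = G.vol univ := by rw [hf3.scal 2 rfl, h2]
    refine ⟨(hf3.var 0 rfl).trans hs2, ?_, ?_, ?_, fun hpos => ?_⟩
    · simp only [ne_eq, OfNat.zero_ne_ofNat, not_false_eq_true, Function.update_of_ne]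
      rw [hf3.scal 0 rfl]
      exact hw2
    · simp only [ne_eq, OfNat.one_ne_ofNat, not_false_eq_true, Function.update_of_ne]
      rw [hf3.scal 1 rfl, hf2.scal 1 rfl]
      exact h1
    · simpa using hvol
    · simp only [IExpr.eval, Function.update_self, SExpr.eval, cell, hvol]
      have h4 := h3.1 hpos
      refine ⟨by positivity, fun u v huv => ?_⟩
      have h5 := h3.2 u v huv
      calc 8 * (s3.scal 3 0 * s3.scal 3 0 / ((8 : ℤ) * (G.vol univ * G.vol univ))) * G.vol univ ^ 2
          = s3.scal 3 0 ^ 2 := by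
            push_cast
            field_simp
        _ ≤ G.w u v ^ 2 := by gcongr

end RAM

/-! ### The regularized Laplacian as a sum of rank-one matrices -/

namespace WeightedGraph

variable {V : Type*} [Fintype V] [DecidableEq V]

/-- The difference of two unit vectors. -/
def edgeVec (p : V × V) : V → ℝ := Pi.single p.1 1 - Pi.single p.2 1

/-- The regularized Laplacian of the subgraph induced on the complement of `U`, restricted to the
ordered pairs in `S`; every edge is split evenly between its two orientations. -/
noncomputable def partialLaplacian (G : WeightedGraph V) (U : Finset V) (t : ℝ)
    (S : Finset (V × V)) : Matrix V V ℝ :=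
  diagonal (fun v => t * G.deg v) +
    ∑ p ∈ S, (G.inside U p.1 p.2 / 2) • vecMulVec (edgeVec p) (edgeVec p)

variable {G : WeightedGraph V} {U : Finset V} {t : ℝ} {S : Finset (V × V)}

theorem partialLaplacian_insert {p : V × V} (hp : p ∉ S) :
    G.partialLaplacian U t (insert p S) = G.partialLaplacian U t S +
      (G.inside U p.1 p.2 / 2) • vecMulVec (edgeVec p) (edgeVec p) := by
  rw [partialLaplacian, sum_insert hp, partialLaplacian]
  abel

theorem partialLaplacian_posDef (ht : 0 < t) : (G.partialLaplacian U t S).PosDef := by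
  refine (posDef_diagonal_iff.2 fun v => mul_pos ht (G.deg_pos' v)).add_posSemidef ?_
  refine posSemidef_sum S fun p _ => ?_
  have h := posSemidef_vecMulVec_self_star (edgeVec p)
  rw [star_trivial] at h
  exact h.smul (div_nonneg (G.inside_nonneg U _ _) zero_le_two)

theorem partialLaplacian_det_ne_zero (ht : 0 < t) : (G.partialLaplacian U t S).det ≠ 0 :=
  (partialLaplacian_posDef ht).det_pos.ne'

theorem partialLaplacian_univ : G.IsRegLaplacian U t (G.partialLaplacian U t univ) := by
  intro x u
  have hdot : ∀ p : V × V, edgeVec p ⬝ᵥ x = x p.1 - x p.2 := fun p => by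
    simp [edgeVec, sub_dotProduct]
  have hterm : ∀ p : V × V,
      (((G.inside U p.1 p.2 / 2) • vecMulVec (edgeVec p) (edgeVec p)) *ᵥ x) u =
        (if u = p.1 then G.inside U p.1 p.2 / 2 * (x p.1 - x p.2) else 0)
        - if u = p.2 then G.inside U p.1 p.2 / 2 * (x p.1 - x p.2) else 0 := fun p => by
    rw [smul_mulVec, vecMulVec_mulVec, hdot]
    simp only [edgeVec, Pi.smul_apply, Pi.sub_apply, Pi.single_apply, smul_eq_mul,
      MulOpposite.smul_eq_mul_unop, MulOpposite.unop_op]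
    split_ifs <;> ring
  rw [partialLaplacian, add_mulVec, Pi.add_apply, mulVec_diagonal, sum_mulVec, Finset.sum_apply]
  simp only [hterm]
  rw [sum_sub_distrib, Fintype.sum_prod_type, Fintype.sum_prod_type_right]
  simp only [sum_ite_irrel, sum_const_zero, sum_ite_eq, mem_univ, if_true]
  rw [← sum_sub_distrib]
  congr 1
  refine sum_congr rfl fun v _ => ?_
  rw [G.inside_symm U v u]
  ring

/-- The **Sherman–Morrison formula** for a symmetric rank-one update of a symmetric matrix. -/
theorem inv_add_smul_vecMulVec {A : Matrix V V ℝ} (hA : A.IsSymm) (hdet : A.det ≠ 0) {β : ℝ}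
    {b : V → ℝ} (hβ : 1 + β * (b ⬝ᵥ A⁻¹ *ᵥ b) ≠ 0) :
    (A + β • vecMulVec b b)⁻¹ = A⁻¹ - (β / (1 + β * (b ⬝ᵥ A⁻¹ *ᵥ b))) •
      vecMulVec (A⁻¹ *ᵥ b) (A⁻¹ *ᵥ b) := by
  set c := A⁻¹ *ᵥ b with hc
  set γ := β / (1 + β * (b ⬝ᵥ c)) with hγ
  have hAA : A * A⁻¹ = 1 := mul_nonsing_inv A (isUnit_iff_ne_zero.2 hdet)
  have hAc : A *ᵥ c = b := by rw [hc, mulVec_mulVec, hAA, one_mulVec]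
  have hbc : b ᵥ* A⁻¹ = c := by
    rw [hc, ← mulVec_transpose, transpose_nonsing_inv, hA.eq]
  refine inv_eq_right_inv ?_
  rw [add_mul, mul_sub, mul_sub, hAA, Matrix.mul_smul, mul_vecMulVec, hAc, Matrix.smul_mul, vecMulVec_mul,
    hbc, Matrix.smul_mul, Matrix.mul_smul, vecMulVec_mul_vecMulVec, vecMulVec_smul]
  have hcoef : β - γ - β * γ * (b ⬝ᵥ c) = 0 := by
    rw [hγ]
    field_simp
    ring
  have : (1 - γ • vecMulVec b c + (β • vecMulVec b c - β • γ • (b ⬝ᵥ c) • vecMulVec b c) :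
      Matrix V V ℝ) = 1 + (β - γ - β * γ * (b ⬝ᵥ c)) • vecMulVec b c := by
    module
  rw [this, hcoef, zero_smul, add_zero]

/-- The inverse of the partial Laplacian after one more ordered pair has been taken into account. -/
theorem inv_partialLaplacian_insert (ht : 0 < t) {p : V × V} (hp : p ∉ S) (i j : V) :
    (G.partialLaplacian U t (insert p S))⁻¹ i j =
      (G.partialLaplacian U t S)⁻¹ i j -
        G.inside U p.1 p.2 / 2 / (1 + G.inside U p.1 p.2 / 2 *
          (((G.partialLaplacian U t S)⁻¹ p.1 p.1 - (G.partialLaplacian U t S)⁻¹ p.1 p.2) -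
            ((G.partialLaplacian U t S)⁻¹ p.2 p.1 - (G.partialLaplacian U t S)⁻¹ p.2 p.2))) *
        ((G.partialLaplacian U t S)⁻¹ i p.1 - (G.partialLaplacian U t S)⁻¹ i p.2) *
        ((G.partialLaplacian U t S)⁻¹ j p.1 - (G.partialLaplacian U t S)⁻¹ j p.2) := by
  set A := G.partialLaplacian U t S with hA
  have hpos : A.PosDef := partialLaplacian_posDef ht
  have hsymm : A.IsSymm := by
    have h := hpos.isHermitian
    rwa [IsHermitian, conjTranspose_eq_transpose_of_trivial] at h
  have hmul : ∀ i, (A⁻¹ *ᵥ edgeVec p) i = A⁻¹ i p.1 - A⁻¹ i p.2 := fun i => by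
    simp [edgeVec, mulVec_sub]
  have hdot : edgeVec p ⬝ᵥ A⁻¹ *ᵥ edgeVec p
      = (A⁻¹ p.1 p.1 - A⁻¹ p.1 p.2) - (A⁻¹ p.2 p.1 - A⁻¹ p.2 p.2) := by
    rw [← hmul, ← hmul]
    simp [edgeVec, sub_dotProduct]
  have hnonneg : 0 ≤ edgeVec p ⬝ᵥ A⁻¹ *ᵥ edgeVec p := by
    have := hpos.inv.posSemidef.dotProduct_mulVec_nonneg (edgeVec p)
    rwa [star_trivial] at this
  have hβ : 0 ≤ G.inside U p.1 p.2 / 2 := div_nonneg (G.inside_nonneg U _ _) zero_le_two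
  rw [partialLaplacian_insert hp, ← hA, inv_add_smul_vecMulVec hsymm
    (partialLaplacian_det_ne_zero ht) (by positivity), ← hdot, ← hmul, ← hmul]
  simp [vecMulVec_apply, mul_assoc]

theorem inv_partialLaplacian_empty (ht : 0 < t) (i j : V) :
    (G.partialLaplacian U t ∅)⁻¹ i j = if i = j then 1 / (t * G.deg i) else 0 := by
  have h : (G.partialLaplacian U t ∅)⁻¹ = diagonal fun v => 1 / (t * G.deg v) := by
    refine inv_eq_right_inv ?_
    rw [partialLaplacian, sum_empty, add_zero, diagonal_mul_diagonal, ← diagonal_one]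
    congr 1
    funext v
    exact mul_one_div_cancel (mul_pos ht (G.deg_pos' v)).ne'
  rw [h, diagonal_apply]

end WeightedGraph

/-! ### The program: the inverse of the regularized Laplacian -/

namespace RAM

/-- Is the matrix index on the diagonal? -/
def onDiagonal (e : IExpr) : BExpr :=
  .and (.not (.ilt (rowOf e) (colOf e))) (.not (.ilt (colOf e) (rowOf e)))

/-- Half the weight that the pair in register `2` has in the graph induced on the complement of the
current set. -/
def pairWeight : SExpr :=
  .div (.mul (.mul (.get 0 (.var 2)) (.sub (.const 1) (.get 6 (rowOf (.var 2)))))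
    (.sub (.const 1) (.get 6 (colOf (.var 2))))) (.const 2)

/-- The inverse of the diagonal matrix of the scaled degrees. -/
def initInverse : Cmd :=
  forTo 2 (.mul (.var 0) (.var 0)) (.ite (onDiagonal (.var 2))
    (.setScal 7 (.var 2) (.div (.const 1) (.mul (cell 4) (.get 1 (rowOf (.var 2))))))
    (.setScal 7 (.var 2) (.const 0)))

/-- The difference of the two columns that belong to the pair in register `2`. -/
def columnDiff : Cmd :=
  forTo 3 (.var 0) (.setScal 8 (.var 3)
    (.sub (entry 7 (.var 3) (rowOf (.var 2))) (entry 7 (.var 3) (colOf (.var 2)))))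

/-- The coefficient of the rank-one update in the Sherman–Morrison formula. -/
def updateCoeff : Cmd :=
  .setScal 9 (.const 0) (.div pairWeight (.add (.const 1) (.mul pairWeight
    (.sub (.get 8 (rowOf (.var 2))) (.get 8 (colOf (.var 2)))))))

/-- The rank-one update. -/
def rankOneUpdate : Cmd :=
  forTo 3 (.mul (.var 0) (.var 0)) (.setScal 7 (.var 3)
    (.sub (.get 7 (.var 3))
      (.mul (.mul (cell 9) (.get 8 (rowOf (.var 3)))) (.get 8 (colOf (.var 3))))))

/-- The inverse of the regularized Laplacian, by rank-one updates. -/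
def inverse : Cmd :=
  .seq initInverse (forTo 2 (.mul (.var 0) (.var 0))
    (.seq columnDiff (.seq updateCoeff rankOneUpdate)))

variable {n N : ℕ} {rat : Prop} {G : WeightedGraph (Fin n)} {s : State} {Q : State → Prop}
  {U : Finset (Fin n)} {t : ℝ}

theorem onDiagonal_eval (h0 : s.var 0 = n) {e : IExpr} {p : Fin n × Fin n}
    (he : e.eval s = (matrixIndex n).equiv p) : (onDiagonal e).eval s ↔ p.1 = p.2 := by
  simp only [onDiagonal, BExpr.eval, rowOf_eval h0 he, colOf_eval h0 he, Fin.ext_iff]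
  omega

theorem pairWeight_eval (hP : Prepared G s)
    (hU : ∀ i, s.scal 6 ((vectorIndex n).equiv i) = if i ∈ U then 1 else 0) {p : Fin n × Fin n}
    (he : s.var 2 = (matrixIndex n).equiv p) : pairWeight.eval s = G.inside U p.1 p.2 / 2 := by
  have h1 := get_eval (n := n) hU (rowOf_eval (e := .var 2) hP.size he)
  have h2 := get_eval (n := n) hU (colOf_eval (e := .var 2) hP.size he)
  have h3 : (SExpr.get 0 (.var 2)).eval s = G.w p.1 p.2 := by
    rw [← hP.weights p, ← he]
    rfl
  have : pairWeight.eval s = (SExpr.get 0 (.var 2)).eval s *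
      (((1 : ℤ) : ℝ) - (SExpr.get 6 (rowOf (.var 2))).eval s) *
      (((1 : ℤ) : ℝ) - (SExpr.get 6 (colOf (.var 2))).eval s) / ((2 : ℤ) : ℝ) := rfl
  rw [this, h1, h2, h3, WeightedGraph.inside]
  by_cases hu : p.1 ∈ U <;> by_cases hv : p.2 ∈ U <;> simp [hu, hv]

theorem height_partialLaplacian (hn : n ≤ N) (hok : (resources rat N).Ok s) (hP : Prepared G s)
    (ht : s.scal 4 0 = t) (S : Finset (Fin n × Fin n)) (i j : Fin n) :
    Height rat (laplacianHeight N) (G.partialLaplacian U t S i j) := by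
  have hreg : Height rat (regHeight N) t := ht ▸ hok.scal 4 0
  have hdeg : Height rat (degHeight N) (G.deg i) := hP.deg i ▸ hok.scal 1 _
  have hvec : ∀ (p : Fin n × Fin n) i, Height rat 1 (WeightedGraph.edgeVec p i) := fun p i => by
    simp only [WeightedGraph.edgeVec, Pi.sub_apply, Pi.single_apply]
    refine Height.sub (h := 0) (h' := 0) ?_ ?_
    all_goals
      split_ifs
      exacts [Height.one 0, Height.zero 0]
  have hw : ∀ u v, Height rat N (G.inside U u v) := fun u v => by
    unfold WeightedGraph.inside
    split_ifs
    · exact Height.zero N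
    · exact hP.weights (u, v) ▸ hok.scal 0 _
  have h2 : Height rat 2 (2 : ℝ) := by simpa using Height.intCast (rat := rat) 2
  have hsum := Height.finset_sum (S := S) fun p _ =>
    ((hw p.1 p.2).div h2).mul ((hvec p i).mul (hvec p j))
  have hcard : S.card ≤ N * N := by
    refine (card_le_univ S).trans ?_
    rw [Fintype.card_prod, Fintype.card_fin]
    gcongr
  have hdiag : Height rat (regHeight N + degHeight N)
      (diagonal (fun v => t * G.deg v) i j) := by
    rw [diagonal_apply]
    split_ifs
    exacts [hreg.mul hdeg, Height.zero _]
  have heq : G.partialLaplacian U t S i j = diagonal (fun v => t * G.deg v) i j +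
      ∑ p ∈ S, G.inside U p.1 p.2 / 2 *
        (WeightedGraph.edgeVec p i * WeightedGraph.edgeVec p j) := by
    simp [WeightedGraph.partialLaplacian, Matrix.sum_apply, vecMulVec_apply]
  rw [heq]
  refine (hdiag.add hsum).mono ?_
  unfold laplacianHeight
  have : S.card * (N + 2 + (1 + 1) + 1) ≤ N * N * (N + 5) := Nat.mul_le_mul hcard (by omega)
  omega

theorem height_inv_partialLaplacian (hn : n ≤ N) (hok : (resources rat N).Ok s)
    (hP : Prepared G s) (ht : s.scal 4 0 = t) (ht0 : 0 < t) (S : Finset (Fin n × Fin n))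
    (i j : Fin n) : Height rat (inverseHeight N) ((G.partialLaplacian U t S)⁻¹ i j) := by
  refine (Height.matrix_inv (fun i j => height_partialLaplacian hn hok hP ht S i j)
    (WeightedGraph.partialLaplacian_det_ne_zero ht0) i j).mono ?_
  unfold inverseHeight
  gcongr

theorem wp_initInverse (hn : n ≤ N) (hP : Prepared G s) (ht : s.scal 4 0 = t) (ht0 : 0 < t)
    (hQ : ∀ s', Frame initInverse s s' → (∀ p, s'.scal 7 ((matrixIndex n).equiv p) =
      (G.partialLaplacian U t ∅)⁻¹ p.1 p.2) → Q s') :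
    wp (resources rat N) initInverse Q s := by
  refine wp_fillEach (matrixIndex n) (resources_fits hn) hP.size rfl rfl 7 _ ?_ hQ
  intro p s1 hok hf h0 hp _
  have hP1 : Prepared G s1 := hP.of_frame hf rfl rfl rfl rfl rfl
  have ht1 : s1.scal 4 0 = t := by rw [hf.scal 4 rfl, ht]
  have hh := height_inv_partialLaplacian (U := U) hn hok hP1 ht1 ht0 ∅ p.1 p.2
  have hdiag := onDiagonal_eval (e := .var 2) h0 hp
  refine ⟨fun hb => wp_store hp ?_ fun _ => hh, fun hb => wp_store hp ?_ fun _ => hh⟩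
  · rw [WeightedGraph.inv_partialLaplacian_empty ht0, if_pos (hdiag.1 hb), ← ht1,
      ← get_eval (n := n) hP1.deg (rowOf_eval (e := .var 2) h0 hp)]
    simp [SExpr.eval, cell, IExpr.eval]
  · rw [WeightedGraph.inv_partialLaplacian_empty ht0, if_neg fun h => hb (hdiag.2 h)]
    simp [SExpr.eval]

theorem wp_inverse (hn : n ≤ N) (hP : Prepared G s) (ht : s.scal 4 0 = t) (ht0 : 0 < t)
    (hU : ∀ i, s.scal 6 ((vectorIndex n).equiv i) = if i ∈ U then 1 else 0)
    (hQ : ∀ s', Frame inverse s s' → (∀ p, s'.scal 7 ((matrixIndex n).equiv p) =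
      (G.partialLaplacian U t univ)⁻¹ p.1 p.2) → Q s') :
    wp (resources rat N) inverse Q s := by
  suffices h : wp (resources rat N) inverse (fun s' => ∀ p,
      s'.scal 7 ((matrixIndex n).equiv p) = (G.partialLaplacian U t univ)⁻¹ p.1 p.2) s from
    wp_conseq h hQ
  refine wp_seq (wp_initInverse (U := U) hn hP ht ht0 fun s1 _ h => h) fun s1 hf1 h1 => ?_
  have hs1 : s1.var 0 = n := (hf1.var 0 rfl).trans hP.size
  refine wp_forEach (matrixIndex n) (resources_fits hn) hs1 rfl rfl (fun S _ σ => ∀ p,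
    σ 7 ((matrixIndex n).equiv p) = (G.partialLaplacian U t S)⁻¹ p.1 p.2) h1 ?_ fun s' _ h => h
  rintro S p hp s2 - hf2 h2 hpx hB
  have hP2 : Prepared G s2 :=
    (hP.of_frame hf1 rfl rfl rfl rfl rfl).of_frame hf2 rfl rfl rfl rfl rfl
  have ht2 : s2.scal 4 0 = t := by rw [hf2.scal 4 rfl, hf1.scal 4 rfl, ht]
  have hU2 : ∀ i, s2.scal 6 ((vectorIndex n).equiv i) = if i ∈ U then 1 else 0 := by
    rw [hf2.scal 6 rfl, hf1.scal 6 rfl]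
    exact hU
  set B := (G.partialLaplacian U t S)⁻¹ with hBdef
  refine wp_seq (R := fun s' => ∀ i, s'.scal 8 ((vectorIndex n).equiv i) = B i p.1 - B i p.2)
    ?_ fun s3 hf3 h3 => ?_
  · refine wp_fillEach (vectorIndex n) (resources_fits hn) h2 rfl rfl 8
      (fun i => B i p.1 - B i p.2) ?_ fun s' _ h => h
    intro i s3 hok hf3 h3 hi _
    have hpx3 : s3.var 2 = (matrixIndex n).equiv p := (hf3.var 2 rfl).trans hpx
    have hB3 : ∀ p, s3.scal 7 ((matrixIndex n).equiv p) = B p.1 p.2 := by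
      rw [hf3.scal 7 rfl]
      exact hB
    refine wp_store hi ?_ fun _ => ?_
    · exact congr_arg₂ (· - ·)
        (entry_eval h3 hB3 hi (rowOf_eval (e := .var 2) h3 hpx3))
        (entry_eval h3 hB3 hi (colOf_eval (e := .var 2) h3 hpx3))
    · refine ((hB3 (i, p.1) ▸ hok.scal 7 _ : Height rat _ _).sub
        (hB3 (i, p.2) ▸ hok.scal 7 _ : Height rat _ _)).mono ?_
      change inverseHeight N + inverseHeight N + 1 ≤ 2 * inverseHeight N + 1
      omega
  have hP3 : Prepared G s3 := hP2.of_frame hf3 rfl rfl rfl rfl rfl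
  have ht3 : s3.scal 4 0 = t := by rw [hf3.scal 4 rfl, ht2]
  have hU3 : ∀ i, s3.scal 6 ((vectorIndex n).equiv i) = if i ∈ U then 1 else 0 := by
    rw [hf3.scal 6 rfl]
    exact hU2
  have hpx3 : s3.var 2 = (matrixIndex n).equiv p := (hf3.var 2 rfl).trans hpx
  refine wp_seq (R := fun s' => s'.scal 9 0 = G.inside U p.1 p.2 / 2 /
      (1 + G.inside U p.1 p.2 / 2 * ((B p.1 p.1 - B p.1 p.2) - (B p.2 p.1 - B p.2 p.2))))
    (fun hok => ⟨(SExpr.height_eval hok _).mono ?_, ?_⟩) fun s4 hf4 h4 => ?_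
  · change N + (1 + 0 + 1) + (1 + 0 + 1) + 2 + (1 + (N + (1 + 0 + 1) + (1 + 0 + 1) + 2 +
      (2 * inverseHeight N + 1 + (2 * inverseHeight N + 1) + 1)) + 1) ≤
      2 * N + 4 * inverseHeight N + 17
    omega
  · have e1 := pairWeight_eval hP3 hU3 hpx3
    have e2 := get_eval (n := n) h3 (rowOf_eval (e := .var 2) hP3.size hpx3)
    have e3 := get_eval (n := n) h3 (colOf_eval (e := .var 2) hP3.size hpx3)
    simp only [IExpr.eval, Function.update_self]
    rw [← e1, ← e2, ← e3]
    simp [SExpr.eval]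
  have hP4 : Prepared G s4 := hP3.of_frame hf4 rfl rfl rfl rfl rfl
  have ht4 : s4.scal 4 0 = t := by rw [hf4.scal 4 rfl, ht3]
  refine wp_fillEach (matrixIndex n) (resources_fits hn) hP4.size rfl rfl 7
    (fun q => (G.partialLaplacian U t (insert p S))⁻¹ q.1 q.2) ?_ fun s' _ h => h
  intro q s5 hok hf5 h5 hq h7
  have hP5 : Prepared G s5 := hP4.of_frame hf5 rfl rfl rfl rfl rfl
  have ht5 : s5.scal 4 0 = t := by rw [hf5.scal 4 rfl, ht4]
  refine wp_store hq ?_ fun _ => height_inv_partialLaplacian hn hok hP5 ht5 ht0 _ _ _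
  have h8 : ∀ i, s5.scal 8 ((vectorIndex n).equiv i) = B i p.1 - B i p.2 := by
    rw [hf5.scal 8 rfl, hf4.scal 8 rfl]
    exact h3
  have h9 : s5.scal 9 0 = _ := (congr_fun (hf5.scal 9 rfl) 0).trans h4
  have e1 : s5.scal 7 ((matrixIndex n).equiv q) = B q.1 q.2 := by
    rw [h7, hf4.scal 7 rfl, hf3.scal 7 rfl, hB]
  have e2 := get_eval (n := n) h8 (rowOf_eval (e := .var 3) h5 hq)
  have e3 := get_eval (n := n) h8 (colOf_eval (e := .var 3) h5 hq)
  rw [WeightedGraph.inv_partialLaplacian_insert ht0 hp, ← hBdef, ← h9, ← e1, ← e2, ← e3, ← hq]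
  rfl

end RAM

/-! ### The program: powers and the best candidate -/

namespace WeightedGraph

variable {V : Type*} [Fintype V] [DecidableEq V]

/-- The marginal cut as a sum over all ordered pairs, in the form in which a program finds it. -/
theorem marginal_eq_sum (G : WeightedGraph V) {U X : Finset V} (hX : X ⊆ Uᶜ) :
    G.marginal U X = ∑ p : V × V, G.w p.1 p.2 * (if p.1 ∈ X then 1 else 0) *
      (1 - if p.2 ∈ X then 1 else 0) * (1 - 2 * if p.2 ∈ U then 1 else 0) := by
  rw [marginal, kcut, Fintype.sum_prod_type]
  have hrow : ∀ u, ∑ v, G.w u v * (if u ∈ X then 1 else 0) * (1 - if v ∈ X then 1 else 0) *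
      (1 - 2 * if v ∈ U then 1 else 0) =
      if u ∈ X then ∑ v ∈ Xᶜ, G.inside U u v - G.bdry U u else 0 := by
    intro u
    split_ifs with hu
    · have hT : ∀ (T : Finset V) (f : V → ℝ), ∑ v ∈ T, f v = ∑ v, if v ∈ T then f v else 0 := by
        simp
      rw [bdry, hT Xᶜ, hT U, ← sum_sub_distrib]
      refine sum_congr rfl fun v _ => ?_
      have huU : u ∉ U := mem_compl.1 (hX hu)
      by_cases hvX : v ∈ X
      · have hvU : v ∉ U := mem_compl.1 (hX hvX)
        simp [hvX, hvU]
      · by_cases hvU : v ∈ U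
        · simp [inside, hvX, hvU]
          ring
        · simp [inside, hvX, hvU, huU]
    · simp
  simp only [hrow]
  rw [sum_ite_mem, univ_inter, sum_sub_distrib]

end WeightedGraph

namespace RAM

/-- The identity matrix. -/
def initPower : Cmd :=
  forTo 2 (.mul (.var 0) (.var 0)) (.ite (onDiagonal (.var 2))
    (.setScal 10 (.var 2) (.const 1)) (.setScal 10 (.var 2) (.const 0)))

/-- Multiplication with the inverse of the regularized Laplacian times the degree matrix. -/
def mulStep : Cmd :=
  forTo 3 (.mul (.var 0) (.var 0)) (.seq
    (sumTo 19 4 (.var 0) (.mul (.mul (entry 7 (rowOf (.var 3)) (.var 4)) (.get 1 (.var 4)))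
      (entry 10 (.var 4) (colOf (.var 3)))))
    (.setScal 11 (.var 3) (cell 19)))

/-- The power to be computed, one factor at a time. -/
def power : Cmd :=
  .seq initPower (forTo 2 (.var 0) (.seq mulStep
    (forTo 3 (.mul (.var 0) (.var 0)) (.setScal 10 (.var 3) (.get 11 (.var 3))))))

/-- The candidate set that belongs to the triple in register `2`. -/
def buildCandidate : Cmd :=
  forTo 3 (.var 0) (.ite
    (.and
      (.not (.slt (entry 10 (.var 3) (rowOf (rowOf (.var 2))))
        (entry 10 (colOf (rowOf (.var 2))) (rowOf (rowOf (.var 2))))))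
      (.not (.slt (entry 10 (colOf (.var 2)) (rowOf (rowOf (.var 2))))
        (entry 10 (.var 3) (rowOf (rowOf (.var 2)))))))
    (.setScal 12 (.var 3) (.sub (.const 1) (.get 6 (.var 3))))
    (.setScal 12 (.var 3) (.const 0)))

/-- The volume of the candidate. -/
def candidateVol : Cmd := sumTo 13 3 (.var 0) (.mul (.get 12 (.var 3)) (.get 1 (.var 3)))

/-- The marginal cut of the candidate. -/
def candidateCut : Cmd :=
  sumTo 14 3 (.mul (.var 0) (.var 0))
    (.mul (.mul (.mul (.get 0 (.var 3)) (.get 12 (rowOf (.var 3))))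
      (.sub (.const 1) (.get 12 (colOf (.var 3)))))
      (.sub (.const 1) (.mul (.const 2) (.get 6 (colOf (.var 3))))))

/-- Is the candidate admissible, and is it better than the best one so far? -/
def isBetter : BExpr :=
  .and (.slt (.const 0) (cell 13))
    (.and (.not (.slt (.sub (cell 2) (cell 5)) (.mul (.const 2) (cell 13))))
      (.slt (.mul (cell 14) (cell 15)) (.mul (cell 16) (cell 13))))

/-- Replace the best candidate. -/
def keepCandidate : Cmd :=
  .seq (.setScal 15 (.const 0) (cell 13)) (.seq (.setScal 16 (.const 0) (cell 14))
    (forTo 3 (.var 0) (.setScal 17 (.var 3) (.get 12 (.var 3)))))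

/-- The best admissible candidate, or the empty set if there is none. -/
def search : Cmd :=
  .seq (.setScal 15 (.const 0) (.const 0)) (.seq (.setScal 16 (.const 0) (.const 1))
    (.seq (forTo 2 (.var 0) (.setScal 17 (.var 2) (.const 0)))
      (forTo 2 (.mul (.mul (.var 0) (.var 0)) (.var 0))
        (.seq buildCandidate (.seq candidateVol (.seq candidateCut
          (.ite isBetter keepCandidate .skip)))))))

variable {n N : ℕ} {rat : Prop} {G : WeightedGraph (Fin n)} {s : State} {Q : State → Prop}
  {U : Finset (Fin n)}

theorem wp_power {B : Matrix (Fin n) (Fin n) ℝ} (hn : n ≤ N) (hP : Prepared G s)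
    (hB : ∀ p, s.scal 7 ((matrixIndex n).equiv p) = B p.1 p.2)
    (hQ : ∀ s', Frame power s s' → (∀ p, s'.scal 10 ((matrixIndex n).equiv p) =
      ((B * diagonal G.deg) ^ n) p.1 p.2) → Q s') :
    wp (resources rat N) power Q s := by
  suffices h : wp (resources rat N) power (fun s' => ∀ p,
      s'.scal 10 ((matrixIndex n).equiv p) = ((B * diagonal G.deg) ^ n) p.1 p.2) s from
    wp_conseq h hQ
  refine wp_seq (R := fun s' => ∀ p, s'.scal 10 ((matrixIndex n).equiv p) =
    (1 : Matrix (Fin n) (Fin n) ℝ) p.1 p.2) ?_ fun s1 hf1 h1 => ?_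
  · refine wp_fillEach (matrixIndex n) (resources_fits hn) hP.size rfl rfl 10 _ ?_ fun s' _ h => h
    intro p s1 _ hf h0 hp _
    have hdiag := onDiagonal_eval (e := .var 2) h0 hp
    refine ⟨fun hb => wp_store hp ?_ fun _ => ?_, fun hb => wp_store hp ?_ fun _ => ?_⟩
    · rw [one_apply, if_pos (hdiag.1 hb)]
      simp [SExpr.eval]
    · rw [one_apply, if_pos (hdiag.1 hb)]
      exact Height.one _
    · rw [one_apply, if_neg fun h => hb (hdiag.2 h)]
      simp [SExpr.eval]
    · rw [one_apply, if_neg fun h => hb (hdiag.2 h)]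
      exact Height.zero _
  have hP1 : Prepared G s1 := hP.of_frame hf1 rfl rfl rfl rfl rfl
  refine wp_forEach (vectorIndex n) (resources_fits hn) hP1.size rfl rfl (fun S _ σ => ∀ p,
    σ 10 ((matrixIndex n).equiv p) = ((B * diagonal G.deg) ^ S.card) p.1 p.2)
    (by simpa using h1) ?_ fun s' _ h => by simpa using h
  rintro S i hi s2 - hf2 h2 - hF
  have hP2 : Prepared G s2 := hP1.of_frame hf2 rfl rfl rfl rfl rfl
  have hB2 : ∀ p, s2.scal 7 ((matrixIndex n).equiv p) = B p.1 p.2 := by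
    rw [hf2.scal 7 rfl, hf1.scal 7 rfl]
    exact hB
  rw [card_insert_of_notMem hi]
  have hcard : S.card + 1 ≤ N := by
    have := card_le_univ (insert i S)
    rw [card_insert_of_notMem hi, Fintype.card_fin] at this
    omega
  refine wp_seq (R := fun s' => ∀ p, s'.scal 11 ((matrixIndex n).equiv p) =
    ((B * diagonal G.deg) ^ (S.card + 1)) p.1 p.2) ?_ fun s3 hf3 h3 => ?_
  · refine wp_fillEach (matrixIndex n) (resources_fits hn) h2 rfl rfl 11
      (fun p => ((B * diagonal G.deg) ^ (S.card + 1)) p.1 p.2) ?_ fun s' _ h => h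
    intro q s3 hok hf3 h3 hq _
    have hP3 : Prepared G s3 := hP2.of_frame hf3 rfl rfl rfl rfl rfl
    have hB3 : ∀ p, s3.scal 7 ((matrixIndex n).equiv p) = B p.1 p.2 := by
      rw [hf3.scal 7 rfl]
      exact hB2
    have hheight : Height rat (powerHeight N)
        (((B * diagonal G.deg) ^ (S.card + 1)) q.1 q.2) := by
      refine (Height.matrix_pow (h := inverseHeight N + degHeight N) (fun i j => ?_) _ _ _).mono ?_
      · rw [mul_diagonal]
        exact (hB3 (i, j) ▸ hok.scal 7 _ : Height rat _ _).mul
          (hP3.deg j ▸ hok.scal 1 _ : Height rat _ _)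
      · unfold powerHeight
        gcongr
    refine wp_seq (R := fun s' => s'.scal 19 0 = ((B * diagonal G.deg) ^ (S.card + 1)) q.1 q.2)
      ?_ fun s4 hf4 h4 => ?_
    · refine wp_sumEach (vectorIndex n) (resources_fits hn) h3 rfl
        (fun k => B q.1 k * G.deg k * ((B * diagonal G.deg) ^ S.card) k q.2)
        (Nat.mul_le_mul hn le_rfl) (fun k s4 hf4 h4 hk => ?_) fun s' _ h => ?_
      · have hP4 : Prepared G s4 := hP3.of_frame hf4 rfl rfl rfl rfl rfl
        have hq4 : s4.var 3 = (matrixIndex n).equiv q := (hf4.var 3 rfl).trans hq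
        have hB4 : ∀ p, s4.scal 7 ((matrixIndex n).equiv p) = B p.1 p.2 := by
          rw [hf4.scal 7 rfl]
          exact hB3
        have hF4 : ∀ p, s4.scal 10 ((matrixIndex n).equiv p) =
            ((B * diagonal G.deg) ^ S.card) p.1 p.2 := by
          rw [hf4.scal 10 rfl, hf3.scal 10 rfl]
          exact hF
        exact congr_arg₂ (· * ·) (congr_arg₂ (· * ·)
          (entry_eval h4 hB4 (rowOf_eval (e := .var 3) h4 hq4) hk) (get_eval (n := n) hP4.deg hk))
          (entry_eval h4 hF4 hk (colOf_eval (e := .var 3) h4 hq4))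
      · rw [h, pow_succ', mul_apply]
        simp only [mul_diagonal]
    · rw [← hf4.scal 11 rfl]
      exact wp_store ((hf4.var 3 rfl).trans hq) h4 fun _ => hheight
  · have hs3 : s3.var 0 = n := (hf3.var 0 rfl).trans h2
    refine wp_fillEach (matrixIndex n) (resources_fits hn) hs3 rfl rfl 10
      (fun p => ((B * diagonal G.deg) ^ (S.card + 1)) p.1 p.2) ?_ fun s' _ h => h
    intro q s4 _ hf4 h4 hq _
    have h11 : s4.scal 11 ((matrixIndex n).equiv q) = _ :=
      (congr_fun (hf4.scal 11 rfl) _).trans (h3 q)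
    rw [← h11, ← hq]
    exact wp_store rfl rfl fun hok => hok.scal 11 _

/-- What `search` has found among the candidates that belong to the triples in `S`. -/
def IsBest (G : WeightedGraph (Fin n)) (U : Finset (Fin n)) (F : Matrix (Fin n) (Fin n) ℝ)
    (S : Finset ((Fin n × Fin n) × Fin n)) (X : Finset (Fin n)) : Prop :=
  X ⊆ Uᶜ ∧ (X.Nonempty → 2 * G.vol X ≤ G.vol Uᶜ) ∧
    ∀ q ∈ S, (WeightedGraph.candidate U F q.1.1 q.1.2 q.2).Nonempty →
      2 * G.vol (WeightedGraph.candidate U F q.1.1 q.1.2 q.2) ≤ G.vol Uᶜ →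
      X.Nonempty ∧ G.marginal U X * G.vol (WeightedGraph.candidate U F q.1.1 q.1.2 q.2)
        ≤ G.marginal U (WeightedGraph.candidate U F q.1.1 q.1.2 q.2) * G.vol X

/-- `x` is the marginal cut of `X`, or `1` if `X` is empty, so that every candidate of positive volume is
better in the cross-multiplied comparison. -/
def IsMarginal (G : WeightedGraph (Fin n)) (U X : Finset (Fin n)) (x : ℝ) : Prop :=
  (X.Nonempty → x = G.marginal U X) ∧ (¬ X.Nonempty → x = 1)

theorem vol_pos_iff {X : Finset (Fin n)} : 0 < G.vol X ↔ X.Nonempty := by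
  refine ⟨fun h => ?_, G.vol_pos⟩
  rw [nonempty_iff_ne_empty]
  rintro rfl
  simp [WeightedGraph.vol] at h

theorem IsBest.replace {F : Matrix (Fin n) (Fin n) ℝ} {S : Finset ((Fin n × Fin n) × Fin n)}
    {X : Finset (Fin n)} {x : ℝ} (h : IsBest G U F S X) (hx : IsMarginal G U X x)
    {q : (Fin n × Fin n) × Fin n}
    (h1 : 0 < G.vol (WeightedGraph.candidate U F q.1.1 q.1.2 q.2))
    (h2 : 2 * G.vol (WeightedGraph.candidate U F q.1.1 q.1.2 q.2) ≤ G.vol Uᶜ)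
    (h3 : G.marginal U (WeightedGraph.candidate U F q.1.1 q.1.2 q.2) * G.vol X <
      x * G.vol (WeightedGraph.candidate U F q.1.1 q.1.2 q.2)) :
    IsBest G U F (insert q S) (WeightedGraph.candidate U F q.1.1 q.1.2 q.2) := by
  set Y := WeightedGraph.candidate U F q.1.1 q.1.2 q.2 with hY
  refine ⟨WeightedGraph.candidate_subset _ _ _ _ _, fun _ => h2, fun q' hq' h4 h5 => ?_⟩
  refine ⟨vol_pos_iff.1 h1, ?_⟩
  rcases mem_insert.1 hq' with rfl | hq'
  · exact le_rfl
  obtain ⟨h6, h7⟩ := h.2.2 q' hq' h4 h5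
  rw [hx.1 h6] at h3
  have hX : 0 < G.vol X := vol_pos_iff.2 h6
  have hZ := (vol_pos_iff.2 h4 : 0 < G.vol _)
  set Z := WeightedGraph.candidate U F q'.1.1 q'.1.2 q'.2
  refine le_of_mul_le_mul_right ?_ hX
  calc G.marginal U Y * G.vol Z * G.vol X = G.marginal U Y * G.vol X * G.vol Z := by ring
    _ ≤ G.marginal U X * G.vol Y * G.vol Z := by gcongr
    _ = G.marginal U X * G.vol Z * G.vol Y := by ring
    _ ≤ G.marginal U Z * G.vol X * G.vol Y := by gcongr
    _ = G.marginal U Z * G.vol Y * G.vol X := by ring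

theorem IsBest.keep {F : Matrix (Fin n) (Fin n) ℝ} {S : Finset ((Fin n × Fin n) × Fin n)}
    {X : Finset (Fin n)} {x : ℝ} (h : IsBest G U F S X) (hx : IsMarginal G U X x)
    {q : (Fin n × Fin n) × Fin n}
    (h1 : ¬ (0 < G.vol (WeightedGraph.candidate U F q.1.1 q.1.2 q.2) ∧
      2 * G.vol (WeightedGraph.candidate U F q.1.1 q.1.2 q.2) ≤ G.vol Uᶜ ∧
      G.marginal U (WeightedGraph.candidate U F q.1.1 q.1.2 q.2) * G.vol X <
        x * G.vol (WeightedGraph.candidate U F q.1.1 q.1.2 q.2))) :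
    IsBest G U F (insert q S) X := by
  refine ⟨h.1, h.2.1, fun q' hq' h4 h5 => ?_⟩
  rcases mem_insert.1 hq' with rfl | hq'
  · have hpos := (vol_pos_iff (G := G)).2 h4
    have hle := not_lt.1 fun h => h1 ⟨hpos, h5, h⟩
    have hX : X.Nonempty := by
      by_contra hX
      rw [hx.2 hX, not_nonempty_iff_eq_empty.1 hX] at hle
      simp only [WeightedGraph.vol, sum_empty, mul_zero, one_mul] at hle
      exact not_lt.2 hle hpos
    rw [hx.1 hX] at hle
    exact ⟨hX, hle⟩
  · exact h.2.2 q' hq' h4 h5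

theorem wp_buildCandidate {F : Matrix (Fin n) (Fin n) ℝ} (hn : n ≤ N) (h0 : s.var 0 = n)
    (hU : ∀ i, s.scal 6 ((vectorIndex n).equiv i) = if i ∈ U then 1 else 0)
    (hF : ∀ p, s.scal 10 ((matrixIndex n).equiv p) = F p.1 p.2)
    {q : (Fin n × Fin n) × Fin n} (hq : s.var 2 = (tripleIndex n).equiv q)
    (hQ : ∀ s', Frame buildCandidate s s' → (∀ i, s'.scal 12 ((vectorIndex n).equiv i) =
      if i ∈ WeightedGraph.candidate U F q.1.1 q.1.2 q.2 then 1 else 0) → Q s') :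
    wp (resources rat N) buildCandidate Q s := by
  refine wp_fillEach (vectorIndex n) (resources_fits hn) h0 rfl rfl 12 (fun i =>
    if i ∈ WeightedGraph.candidate U F q.1.1 q.1.2 q.2 then 1 else 0) ?_ hQ
  intro i s1 _ hf h1 hi _
  have hq1 : s1.var 2 = q.2 + n * ((matrixIndex n).equiv q.1 : ℕ) := (hf.var 2 rfl).trans hq
  have hU1 : ∀ i, s1.scal 6 ((vectorIndex n).equiv i) = if i ∈ U then 1 else 0 := by
    rw [hf.scal 6 rfl]
    exact hU
  have hF1 : ∀ p, s1.scal 10 ((matrixIndex n).equiv p) = F p.1 p.2 := by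
    rw [hf.scal 10 rfl]
    exact hF
  have hva : (rowOf (.var 2)).eval s1 = (matrixIndex n).equiv q.1 := rowOf_eval (e := .var 2) h1 hq1
  have hv := rowOf_eval h1 hva
  have ha := colOf_eval h1 hva
  have hb := colOf_eval (e := .var 2) h1 hq1
  have hmem : i ∈ WeightedGraph.candidate U F q.1.1 q.1.2 q.2 ↔
      (F q.1.2 q.1.1 ≤ F i q.1.1 ∧ F i q.1.1 ≤ F q.2 q.1.1) ∧ i ∉ U := by
    simp [WeightedGraph.candidate, WeightedGraph.interval, and_comm]
  have hle : Height rat 2 (if i ∈ WeightedGraph.candidate U F q.1.1 q.1.2 q.2 then 1 else 0) := by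
    split_ifs
    exacts [Height.one _, Height.zero _]
  have htest : ∀ e f : SExpr, (BExpr.not (.slt e f)).eval s1 ↔ f.eval s1 ≤ e.eval s1 :=
    fun e f => not_lt
  have hbe : ∀ b c : BExpr, (BExpr.and b c).eval s1 ↔ b.eval s1 ∧ c.eval s1 := fun _ _ => Iff.rfl
  have h3 := entry_eval (i := i) h1 hF1 (e := .var 3) hi hv
  have h4 := entry_eval h1 hF1 ha hv
  have h5 := entry_eval h1 hF1 hb hv
  refine ⟨fun hbt => wp_store hi ?_ fun _ => hle, fun hbt => wp_store hi ?_ fun _ => hle⟩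
  · rw [hbe, htest, htest, h3, h4, h5] at hbt
    have h6 := get_eval (i := i) hU1 (e := .var 3) hi
    have : (SExpr.sub (.const 1) (.get 6 (.var 3))).eval s1
        = ((1 : ℤ) : ℝ) - (SExpr.get 6 (.var 3)).eval s1 := rfl
    rw [this, h6]
    by_cases hiU : i ∈ U <;> simp [hmem, hiU, hbt]
  · rw [hbe, htest, htest, h3, h4, h5] at hbt
    rw [if_neg fun h => hbt (hmem.1 h).1]
    simp [SExpr.eval]

theorem wp_search {F : Matrix (Fin n) (Fin n) ℝ} (hn : n ≤ N) (hP : Prepared G s)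
    (hU : ∀ i, s.scal 6 ((vectorIndex n).equiv i) = if i ∈ U then 1 else 0)
    (hvol : s.scal 5 0 = G.vol U)
    (hF : ∀ p, s.scal 10 ((matrixIndex n).equiv p) = F p.1 p.2)
    (hQ : ∀ s', Frame search s s' → ∀ X, IsBest G U F univ X →
      (∀ i, s'.scal 17 ((vectorIndex n).equiv i) = if i ∈ X then 1 else 0) → Q s') :
    wp (resources rat N) search Q s := by
  suffices h : wp (resources rat N) search (fun s' => ∃ X, IsBest G U F univ X ∧
      ∀ i, s'.scal 17 ((vectorIndex n).equiv i) = if i ∈ X then 1 else 0) s from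
    wp_conseq h fun s' hf ⟨X, h1, h2⟩ => hQ s' hf X h1 h2
  have hcompl : G.vol Uᶜ = G.vol univ - G.vol U := by
    have : G.vol U + G.vol Uᶜ = G.vol univ := sum_add_sum_compl U G.deg
    linarith
  refine wp_seq (R := fun s' => s'.scal 15 0 = 0) (fun _ => ⟨?_, ?_⟩) fun s1 hf1 h15 => ?_
  · simpa [SExpr.eval] using Height.zero _
  · simp [SExpr.eval, IExpr.eval]
  refine wp_seq (R := fun s' => s'.scal 16 0 = 1) (fun _ => ⟨?_, ?_⟩) fun s2 hf2 h16 => ?_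
  · simpa [SExpr.eval] using Height.one _
  · simp [SExpr.eval, IExpr.eval]
  have hP2 : Prepared G s2 :=
    (hP.of_frame hf1 rfl rfl rfl rfl rfl).of_frame hf2 rfl rfl rfl rfl rfl
  refine wp_seq (R := fun s' => ∀ i, s'.scal 17 ((vectorIndex n).equiv i) = 0) ?_
    fun s3 hf3 h17 => ?_
  · refine wp_fillEach (vectorIndex n) (resources_fits hn) hP2.size rfl rfl 17 (fun _ => 0) ?_
      fun s' _ h => h
    intro i s3 _ _ _ hi _
    exact wp_store hi (by simp [SExpr.eval]) fun _ => Height.zero _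
  have hP3 : Prepared G s3 := hP2.of_frame hf3 rfl rfl rfl rfl rfl
  refine wp_forEach (tripleIndex n) (resources_fits hn) hP3.size rfl rfl
    (fun S _ σ => ∃ X, IsBest G U F S X ∧ IsMarginal G U X (σ 16 0) ∧ σ 15 0 = G.vol X ∧
      ∀ i, σ 17 ((vectorIndex n).equiv i) = if i ∈ X then 1 else 0) ?_ ?_
    fun s' _ ⟨X, h1, _, _, h2⟩ => ⟨X, h1, h2⟩
  · refine ⟨∅, ⟨empty_subset _, fun h => absurd h not_nonempty_empty, fun q hq =>
      absurd hq (notMem_empty q)⟩, ⟨fun h => absurd h not_nonempty_empty, fun _ => ?_⟩, ?_, ?_⟩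
    · rw [hf3.scal 16 rfl, h16]
    · rw [hf3.scal 15 rfl, hf2.scal 15 rfl, h15]
      simp [WeightedGraph.vol]
    · simpa using h17
  rintro S q hqS s4 - hf4 h4 hq ⟨X, hbest, hmarg, hvolX, hX⟩
  have hP4 : Prepared G s4 := hP3.of_frame hf4 rfl rfl rfl rfl rfl
  have hU4 : ∀ i, s4.scal 6 ((vectorIndex n).equiv i) = if i ∈ U then 1 else 0 := by
    rw [hf4.scal 6 rfl, hf3.scal 6 rfl, hf2.scal 6 rfl, hf1.scal 6 rfl]
    exact hU
  have hF4 : ∀ p, s4.scal 10 ((matrixIndex n).equiv p) = F p.1 p.2 := by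
    rw [hf4.scal 10 rfl, hf3.scal 10 rfl, hf2.scal 10 rfl, hf1.scal 10 rfl]
    exact hF
  have h5U : s4.scal 5 0 = G.vol U := by
    rw [hf4.scal 5 rfl, hf3.scal 5 rfl, hf2.scal 5 rfl, hf1.scal 5 rfl, hvol]
  refine wp_seq (wp_buildCandidate hn h4 hU4 hF4 hq fun s5 _ h => h) fun s5 hf5 h5 => ?_
  set Y := WeightedGraph.candidate U F q.1.1 q.1.2 q.2 with hY
  have hP5 : Prepared G s5 := hP4.of_frame hf5 rfl rfl rfl rfl rfl
  refine wp_seq (R := fun s' => s'.scal 13 0 = G.vol Y) ?_ fun s6 hf6 h6 => ?_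
  · refine wp_sumEach (vectorIndex n) (resources_fits hn) hP5.size rfl
      (fun i => (if i ∈ Y then 1 else 0) * G.deg i) ?_ (fun i s6 hf6 h6 hi => ?_) fun s' _ h => ?_
    · change n * (2 + degHeight N + 1) ≤ N * (degHeight N + 3)
      exact Nat.mul_le_mul hn (by omega)
    · have hP6 : Prepared G s6 := hP5.of_frame hf6 rfl rfl rfl rfl rfl
      have h12 : ∀ i, s6.scal 12 ((vectorIndex n).equiv i) = if i ∈ Y then 1 else 0 := by
        rw [hf6.scal 12 rfl]
        exact h5
      exact congr_arg₂ (· * ·) (get_eval (n := n) h12 hi) (get_eval (n := n) hP6.deg hi)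
    · rw [h, WeightedGraph.vol]
      simp
  have hP6 : Prepared G s6 := hP5.of_frame hf6 rfl rfl rfl rfl rfl
  refine wp_seq (R := fun s' => s'.scal 14 0 = G.marginal U Y) ?_ fun s7 hf7 h7 => ?_
  · refine wp_sumEach (matrixIndex n) (resources_fits hn) hP6.size rfl
      (fun p => G.w p.1 p.2 * (if p.1 ∈ Y then 1 else 0) *
        (1 - if p.2 ∈ Y then 1 else 0) * (1 - 2 * if p.2 ∈ U then 1 else 0)) ?_
      (fun p s7 hf7 h7 hp => ?_) fun s' _ h => ?_
    · change n * n * (N + 2 + (1 + 2 + 1) + (1 + (2 + 0) + 1) + 1) ≤ N * N * (N + 11)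
      exact Nat.mul_le_mul (Nat.mul_le_mul hn hn) (by omega)
    · have hP7 : Prepared G s7 := hP6.of_frame hf7 rfl rfl rfl rfl rfl
      have h12 : ∀ i, s7.scal 12 ((vectorIndex n).equiv i) = if i ∈ Y then 1 else 0 := by
        rw [hf7.scal 12 rfl, hf6.scal 12 rfl]
        exact h5
      have hU7 : ∀ i, s7.scal 6 ((vectorIndex n).equiv i) = if i ∈ U then 1 else 0 := by
        rw [hf7.scal 6 rfl, hf6.scal 6 rfl, hf5.scal 6 rfl]
        exact hU4
      have e1 := get_eval (n := n) h12 (rowOf_eval (e := .var 3) h7 hp)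
      have e2 := get_eval (n := n) h12 (colOf_eval (e := .var 3) h7 hp)
      have e3 := get_eval (n := n) hU7 (colOf_eval (e := .var 3) h7 hp)
      rw [← e1, ← e2, ← e3, ← hP7.weights p, ← hp]
      simp [SExpr.eval, IExpr.eval]
    · rw [h, WeightedGraph.marginal_eq_sum G (WeightedGraph.candidate_subset _ _ _ _ _)]
  have hP7 : Prepared G s7 := hP6.of_frame hf7 rfl rfl rfl rfl rfl
  have e5 : s7.scal 5 0 = G.vol U := by
    rw [hf7.scal 5 rfl, hf6.scal 5 rfl, hf5.scal 5 rfl, h5U]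
  have e13 : s7.scal 13 0 = G.vol Y := by rw [hf7.scal 13 rfl, h6]
  have e15 : s7.scal 15 0 = G.vol X := by
    rw [hf7.scal 15 rfl, hf6.scal 15 rfl, hf5.scal 15 rfl, hvolX]
  have e16 : s7.scal 16 0 = s4.scal 16 0 := by
    rw [hf7.scal 16 rfl, hf6.scal 16 rfl, hf5.scal 16 rfl]
  have e12 : ∀ i, s7.scal 12 ((vectorIndex n).equiv i) = if i ∈ Y then 1 else 0 := by
    rw [hf7.scal 12 rfl, hf6.scal 12 rfl]
    exact h5
  have htest : isBetter.eval s7 ↔ 0 < G.vol Y ∧ 2 * G.vol Y ≤ G.vol Uᶜ ∧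
      G.marginal U Y * G.vol X < s4.scal 16 0 * G.vol Y := by
    rw [← e16, ← h7, ← e15, ← e13, hcompl, ← hP7.vol, ← e5]
    simp [isBetter, BExpr.eval, SExpr.eval, cell, IExpr.eval]
  refine ⟨fun hb => ?_, fun hb => ?_⟩
  · obtain ⟨b1, b2, b3⟩ := htest.1 hb
    refine wp_seq (R := fun s' => s'.scal 15 0 = G.vol Y) (fun hok => ⟨hok.scal 13 0, ?_⟩)
      fun s8 hf8 h8 => ?_
    · simpa [IExpr.eval, SExpr.eval, cell] using e13
    refine wp_seq (R := fun s' => s'.scal 16 0 = G.marginal U Y) (fun hok => ⟨hok.scal 14 0, ?_⟩)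
      fun s9 hf9 h9 => ?_
    · have : s8.scal 14 0 = G.marginal U Y := by rw [hf8.scal 14 rfl, h7]
      simpa [IExpr.eval, SExpr.eval, cell] using this
    have hP9 : Prepared G s9 :=
      (hP7.of_frame hf8 rfl rfl rfl rfl rfl).of_frame hf9 rfl rfl rfl rfl rfl
    refine wp_fillEach (vectorIndex n) (resources_fits hn) hP9.size rfl rfl 17
      (fun i => if i ∈ Y then 1 else 0) (fun i s10 hok hf10 _ hi _ => ?_) fun s' hf h => ?_
    · have h12 : ∀ i, s10.scal 12 ((vectorIndex n).equiv i) = if i ∈ Y then 1 else 0 := by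
        rw [hf10.scal 12 rfl, hf9.scal 12 rfl, hf8.scal 12 rfl]
        exact e12
      refine wp_store hi (get_eval (n := n) h12 hi) fun hok => ?_
      rw [← h12]
      exact hok.scal 12 _
    · refine ⟨Y, hbest.replace hmarg b1 b2 b3, ⟨fun _ => ?_, fun h => ?_⟩, ?_, h⟩
      · rw [hf.scal 16 rfl, h9]
      · exact absurd (vol_pos_iff.1 b1) h
      · rw [hf.scal 15 rfl, hf9.scal 15 rfl, h8]
  · refine ⟨X, hbest.keep hmarg fun h => hb (htest.2 h), ?_, e15, ?_⟩
    · rw [e16]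
      exact hmarg
    · rw [hf7.scal 17 rfl, hf6.scal 17 rfl, hf5.scal 17 rfl]
      exact hX

end RAM

/-! ### The program: rounds and output -/

namespace RAM

/-- The volume of the current set. -/
def currentVol : Cmd := sumTo 5 2 (.var 0) (.mul (.get 6 (.var 2)) (.get 1 (.var 2)))

/-- Add the best candidate to the current set. -/
def extend : Cmd :=
  forTo 2 (.var 0) (.setScal 6 (.var 2) (.add (.get 6 (.var 2)) (.get 17 (.var 2))))

/-- One round of the algorithm, which does nothing if the current set has a fifth of the volume. -/
def round : Cmd :=
  .seq currentVol (.ite (.slt (.mul (.const 5) (cell 5)) (cell 2))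
    (.seq inverse (.seq power (.seq search extend))) .skip)

/-- Write the current set into the output array. -/
def output : Cmd :=
  forTo 2 (.var 0) (.ite (.slt (.const 0) (.get 6 (.var 2))) (.setInt 0 (.var 2) (.const 1)) .skip)

/-- The whole algorithm. A fixed number `n` of rounds is enough, since every effective round
adds a vertex. -/
def program : Cmd := .seq prepare (.seq (forTo 1 (.var 0) round) output)

variable {n N : ℕ} {rat : Prop} {G : WeightedGraph (Fin n)} {s : State} {Q : State → Prop}
  {U : Finset (Fin n)}

theorem wp_extend {X : Finset (Fin n)} (hn : n ≤ N) (h0 : s.var 0 = n) (hX : X ⊆ Uᶜ)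
    (hU : ∀ i, s.scal 6 ((vectorIndex n).equiv i) = if i ∈ U then 1 else 0)
    (h17 : ∀ i, s.scal 17 ((vectorIndex n).equiv i) = if i ∈ X then 1 else 0)
    (hQ : ∀ s', (∀ i, s'.scal 6 ((vectorIndex n).equiv i) = if i ∈ U ∪ X then 1 else 0) → Q s') :
    wp (resources rat N) extend Q s := by
  refine wp_fillEach (vectorIndex n) (resources_fits hn) h0 rfl rfl 6
    (fun i => if i ∈ U ∪ X then 1 else 0) (fun i s1 _ hf _ hi h6 => ?_) fun s' _ h => hQ s' h
  refine wp_store hi ?_ fun _ => ?_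
  · have h17' : s1.scal 17 ((vectorIndex n).equiv i) = if i ∈ X then 1 else 0 :=
      (congr_fun (hf.scal 17 rfl) _).trans (h17 i)
    have : (SExpr.add (.get 6 (.var 2)) (.get 17 (.var 2))).eval s1 =
      s1.scal 6 (s1.var 2) + s1.scal 17 (s1.var 2) := rfl
    rw [this, hi, h6, hU, h17']
    by_cases h1 : i ∈ U
    · have h2 : i ∉ X := fun h => mem_compl.1 (hX h) h1
      simp [h1, h2]
    · simp [h1]
  · change Height rat 0 _
    split_ifs
    exacts [Height.one 0, Height.zero 0]

theorem wp_round (hn : n ≤ N) (hP : Prepared G s)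
    (hU : ∀ i, s.scal 6 ((vectorIndex n).equiv i) = if i ∈ U then 1 else 0)
    (hQ : ∀ s' U', G.IsRound U U' →
      (∀ i, s'.scal 6 ((vectorIndex n).equiv i) = if i ∈ U' then 1 else 0) → Q s') :
    wp (resources rat N) round Q s := by
  refine wp_seq (R := fun s' => s'.scal 5 0 = G.vol U) ?_ fun s1 hf1 h1 => ?_
  · refine wp_sumEach (vectorIndex n) (resources_fits hn) hP.size rfl
      (fun i => (if i ∈ U then 1 else 0) * G.deg i) ?_ (fun i s' hf h hi => ?_) fun s' _ h => ?_
    · change n * (0 + degHeight N + 1) ≤ N * (degHeight N + 1)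
      exact Nat.mul_le_mul hn (by omega)
    · have hP' : Prepared G s' := hP.of_frame hf rfl rfl rfl rfl rfl
      have hU' : ∀ i, s'.scal 6 ((vectorIndex n).equiv i) = if i ∈ U then 1 else 0 := by
        rw [hf.scal 6 rfl]
        exact hU
      exact congr_arg₂ (· * ·) (get_eval (n := n) hU' hi) (get_eval (n := n) hP'.deg hi)
    · rw [h, WeightedGraph.vol]
      simp
  have hP1 : Prepared G s1 := hP.of_frame hf1 rfl rfl rfl rfl rfl
  have hU1 : ∀ i, s1.scal 6 ((vectorIndex n).equiv i) = if i ∈ U then 1 else 0 := by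
    rw [hf1.scal 6 rfl]
    exact hU
  have htest : (BExpr.slt (.mul (.const 5) (cell 5)) (cell 2)).eval s1 ↔
      5 * G.vol U < G.vol univ := by
    rw [← h1, ← hP1.vol]
    simp [BExpr.eval, SExpr.eval, cell, IExpr.eval]
  refine ⟨fun hb => ?_, fun hb => ?_⟩
  · have hlt := htest.1 hb
    have hvol : 0 < G.vol univ := by linarith [G.vol_nonneg U]
    obtain ⟨ht0, ht⟩ := hP1.reg hvol
    refine wp_seq (wp_inverse hn hP1 rfl ht0 hU1 fun s2 _ h => h) fun s2 hf2 h2 => ?_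
    have hP2 : Prepared G s2 := hP1.of_frame hf2 rfl rfl rfl rfl rfl
    refine wp_seq (wp_power hn hP2 h2 fun s3 _ h => h) fun s3 hf3 h3 => ?_
    have hP3 : Prepared G s3 := hP2.of_frame hf3 rfl rfl rfl rfl rfl
    have hU3 : ∀ i, s3.scal 6 ((vectorIndex n).equiv i) = if i ∈ U then 1 else 0 := by
      rw [hf3.scal 6 rfl, hf2.scal 6 rfl]
      exact hU1
    have h5 : s3.scal 5 0 = G.vol U := by rw [hf3.scal 5 rfl, hf2.scal 5 rfl, h1]
    refine wp_seq (R := fun s' => ∃ X, IsBest G U (((G.partialLaplacian U (s1.scal 4 0) univ)⁻¹ *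
      diagonal G.deg) ^ n) univ X ∧
        ∀ i, s'.scal 17 ((vectorIndex n).equiv i) = if i ∈ X then 1 else 0)
      (wp_search hn hP3 hU3 h5 h3 fun s4 _ X h h' => ⟨X, h, h'⟩) fun s4 hf4 ⟨X, hX, h17⟩ => ?_
    have hU4 : ∀ i, s4.scal 6 ((vectorIndex n).equiv i) = if i ∈ U then 1 else 0 := by
      rw [hf4.scal 6 rfl]
      exact hU3
    refine wp_extend hn ((hf4.var 0 rfl).trans hP3.size) hX.1 hU4 h17 fun s5 h6 =>
      hQ s5 (U ∪ X) ⟨fun h => absurd hlt (not_lt.2 h), fun _ => ?_⟩ h6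
    refine ⟨s1.scal 4 0, G.partialLaplacian U (s1.scal 4 0) univ,
      (G.partialLaplacian U (s1.scal 4 0) univ)⁻¹, ht0, WeightedGraph.partialLaplacian_univ,
      mul_nonsing_inv _ (isUnit_iff_ne_zero.2 (WeightedGraph.partialLaplacian_det_ne_zero ht0)),
      ht, ?_⟩
    rw [Fintype.card_fin]
    by_cases hne : X.Nonempty
    · exact Or.inr ⟨X, hX.1, hne, hX.2.1 hne, rfl, fun v a b h7 h8 =>
        (hX.2.2 ((v, a), b) (mem_univ _) h7 h8).2⟩
    · exact Or.inl fun v a b h7 h8 => hne (hX.2.2 ((v, a), b) (mem_univ _) h7 h8).1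
  · exact hQ s1 U ⟨fun _ => rfl, fun h => absurd (htest.2 h) hb⟩ hU1

theorem wp_output (hn : n ≤ N) (h0 : s.var 0 = n) (hint : ∀ i, s.int 0 i = 0)
    (hU : ∀ i, s.scal 6 ((vectorIndex n).equiv i) = if i ∈ U then 1 else 0) :
    wp (resources rat N) output (fun s' => outputSet n s' = U) s := by
  refine wp_forEach (vectorIndex n) (resources_fits hn) h0 rfl rfl
    (fun S ι _ => ∀ i : Fin n, ι 0 ((vectorIndex n).equiv i) ≠ 0 ↔ i ∈ S ∧ i ∈ U)
    (by simp [hint]) ?_ fun s' _ h => ?_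
  · rintro S i hi s1 - hf h1 hxi h
    have h6 : s1.scal 6 (s1.var 2) = if i ∈ U then 1 else 0 := by
      rw [hxi, hf.scal 6 rfl, hU]
    have htest : (BExpr.slt (.const 0) (.get 6 (.var 2))).eval s1 ↔ i ∈ U := by
      have : (BExpr.slt (.const 0) (.get 6 (.var 2))).eval s1 ↔
        ((0 : ℤ) : ℝ) < s1.scal 6 (s1.var 2) := Iff.rfl
      rw [this, h6]
      by_cases hiU : i ∈ U <;> simp [hiU]
    refine ⟨fun hb => ⟨Nat.le_add_left 1 _, fun j => ?_⟩, fun hb j => ?_⟩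
    · simp only [IExpr.eval, Function.update_self, hxi]
      rcases eq_or_ne j i with rfl | hji
      · simp [htest.1 hb]
      · have hne : ((vectorIndex n).equiv j : ℕ) ≠ (vectorIndex n).equiv i := fun h =>
          hji ((vectorIndex n).equiv.injective (Fin.ext h))
        rw [Function.update_of_ne hne, h j]
        simp [hji]
    · rw [h j, mem_insert]
      refine ⟨fun h => ⟨Or.inr h.1, h.2⟩, fun h => ⟨h.1.resolve_left ?_, h.2⟩⟩
      rintro rfl
      exact hb (htest.2 h.2)
  · ext i
    rw [outputSet, mem_filter]
    have := h i
    simp only [mem_univ, true_and] at this ⊢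
    exact this

theorem wp_program (hn : n ≤ N) : wp (resources rat N) program
    (fun s' => (∃ T, G.IsBisection T) → G.RoundInvariant n (outputSet n s')) (inputState G) := by
  have hw : ∀ p, (inputState G).scal 0 ((matrixIndex n).equiv p) = G.w p.1 p.2 := by
    intro p
    have hlt : ((matrixIndex n).equiv p : ℕ) < n * n := ((matrixIndex n).equiv p).isLt
    have hsymm : finProdFinEquiv.symm ((matrixIndex n).equiv p) = p := finProdFinEquiv.symm_apply_apply p
    have h : (inputState G).scal 0 ((matrixIndex n).equiv p) =
        G.w (finProdFinEquiv.symm ((matrixIndex n).equiv p)).1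
          (finProdFinEquiv.symm ((matrixIndex n).equiv p)).2 := dif_pos ⟨rfl, hlt⟩
    rw [h, hsymm]
  refine wp_seq (wp_prepare (s := inputState G) hn rfl hw fun s1 _ h => h) fun s1 hf1 hP1 => ?_
  have h6 : ∀ i, s1.scal 6 i = 0 := fun i => by
    rw [hf1.scal 6 rfl]
    simp [inputState]
  refine wp_seq (R := fun s' => ∃ U, ((∃ T, G.IsBisection T) → G.RoundInvariant n U) ∧
    ∀ i, s'.scal 6 ((vectorIndex n).equiv i) = if i ∈ U then 1 else 0) ?_
    fun s2 hf2 ⟨U, hU, h62⟩ => ?_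
  · refine wp_forEach (vectorIndex n) (resources_fits hn) hP1.size rfl rfl
      (fun S _ σ => ∃ U, ((∃ T, G.IsBisection T) → G.RoundInvariant S.card U) ∧
        ∀ i, σ 6 ((vectorIndex n).equiv i) = if i ∈ U then 1 else 0)
      ⟨∅, fun _ => .empty G, fun i => by simp [h6]⟩ ?_ fun s' _ ⟨U, h⟩ => ⟨U, by simpa using h⟩
    rintro S i hi s2 - hf2 - - ⟨U, hU, h62⟩
    refine wp_round hn (hP1.of_frame hf2 rfl rfl rfl rfl rfl) h62 fun s3 U' hround h63 =>
      ⟨U', fun hT => ?_, h63⟩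
    rw [card_insert_of_notMem hi]
    exact (hU hT).succ hT hround
  · refine wp_mono (fun s3 h3 => ?_) (wp_output hn ((hf2.var 0 rfl).trans hP1.size)
      (fun i => ?_) h62)
    · rw [h3]
      exact hU
    · rw [hf2.int 0 rfl, hf1.int 0 rfl]
      rfl

/-! ### Running time -/

theorem size_le_of_le_two_pow {m h : ℕ} (hm : m ≤ 2 ^ h) : Nat.size m ≤ h + 1 :=
  Nat.size_le.2 (hm.trans_lt (Nat.pow_lt_pow_right one_lt_two h.lt_succ_self))

theorem bitSize_le {h : ℕ} {x : ℝ} (hx : Height True h x) : bitSize x ≤ 2 * h + 4 := by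
  obtain ⟨a, b, hb, h1, h2, rfl⟩ := hx trivial
  have hex : ∃ q : ℚ, (q : ℝ) = (a : ℝ) / b := ⟨(a : ℚ) / b, by push_cast; rfl⟩
  have hq : hex.choose = (a : ℚ) / b := by
    have := hex.choose_spec
    exact_mod_cast this
  rw [bitSize, dif_pos hex, hq]
  have hden : ((a : ℚ) / b).den ≤ b := by
    have := Rat.den_dvd a b
    exact Nat.le_of_dvd hb (by exact_mod_cast this)
  have hnum : ((a : ℚ) / b).num.natAbs ≤ a.natAbs := by
    rcases eq_or_ne a 0 with rfl | ha
    · simp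
    · have := Rat.num_dvd a (b := b) (by exact_mod_cast hb.ne')
      exact Nat.le_of_dvd (Int.natAbs_pos.2 ha) (Int.natAbs_dvd_natAbs.2 (by exact_mod_cast this))
  have h3 := size_le_of_le_two_pow (hnum.trans h1)
  have h4 := size_le_of_le_two_pow (hden.trans h2)
  omega

theorem height_bitSize {rat : Prop} {x : ℝ} (hx : ∃ q : ℚ, (q : ℝ) = x) :
    Height rat (bitSize x) x := fun _ => by
  rw [bitSize, dif_pos hx]
  refine ⟨hx.choose.num, hx.choose.den, hx.choose.den_pos, ?_, ?_, ?_⟩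
  · exact (Nat.lt_size_self _).le.trans (Nat.pow_le_pow_right two_pos (Nat.le_add_right _ _))
  · exact (Nat.lt_size_self _).le.trans (Nat.pow_le_pow_right two_pos (Nat.le_add_left _ _))
  · conv_lhs => rw [← hx.choose_spec]
    exact_mod_cast (Rat.num_div_den _).symm

theorem resources_ok {rat : Prop} (hn : n ≤ N) (hw : ∀ u v, Height rat N (G.w u v)) :
    (resources rat N).Ok (inputState G) := by
  refine ⟨fun x => ?_, fun _ _ => Nat.zero_le _, fun a i => ?_⟩
  · change (if x = 0 then n else 0) ≤ N + N * N + N * N * N + 1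
    split_ifs <;> omega
  · simp only [inputState]
    split_ifs with h
    · obtain ⟨rfl, -⟩ := h
      exact hw _ _
    · exact Height.zero _

theorem polyBounded_arrayHeight (a : ℕ) : PolyBounded fun N => arrayHeight N a := by
  unfold arrayHeight
  split <;>
  · try simp only [powerHeight, inverseHeight, laplacianHeight, regHeight, minHeight, volHeight,
      degHeight]
    repeat' first
      | exact PolyBounded.const _
      | exact PolyBounded.id
      | apply PolyBounded.add
      | apply PolyBounded.mul

theorem polyBounded_cost : PolyBounded fun N => program.costBound (N + N * N + N * N * N + 1)
    (N + N * N + N * N * N) (arrayHeight N) := by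
  have h : PolyBounded fun N => N + N * N + N * N * N :=
    (PolyBounded.id.add (PolyBounded.id.mul PolyBounded.id)).add
      ((PolyBounded.id.mul PolyBounded.id).mul PolyBounded.id)
  exact PolyBounded.cmd_costBound (h.add (.const 1)) h polyBounded_arrayHeight program

end RAM

theorem theorem1p4 :
    ∃ (P : RAM.Cmd) (C : ℝ) (p q : Polynomial ℕ), 0 < C ∧
      ∀ (n : ℕ) (G : WeightedGraph (Fin n)), ∃ s : RAM.State,
        -- polynomially many arithmetic operations, for arbitrary real weights
        (∃ t : ℕ, RAM.Exec RAM.unitSize P (RAM.inputState G) s t ∧ t ≤ p.eval n) ∧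
        -- polynomially many bit operations, for rational weights
        (RAM.HasRationalWeights G →
          ∃ t : ℕ, RAM.Exec RAM.bitSize P (RAM.inputState G) s t ∧
            t ≤ q.eval (RAM.inputLength G)) ∧
        -- the output is a balanced separator
        ((∃ T, G.IsBisection T) →
          G.vol Finset.univ / 5 ≤ G.vol (RAM.outputSet n s) ∧
          G.vol (RAM.outputSet n s) ≤ 4 / 5 * G.vol Finset.univ ∧
          ∀ (k : ℕ) (hk : 2 ≤ k) (hkn : k ≤ Fintype.card (Fin n)),
            0 < G.lam k (one_le_two.trans hk) hkn →
              G.conductance (RAM.outputSet n s) ≤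
                C * (k * G.minBisectionConductance / G.lam k (one_le_two.trans hk) hkn)) := by
  obtain ⟨p, hp⟩ := RAM.polyBounded_cost
  refine ⟨RAM.program, 1512, p, p, by norm_num, fun n G => ?_⟩
  obtain ⟨s, t, hexec, hs, -, ht⟩ := RAM.exec_of_wp (size := RAM.unitSize)
    (E := RAM.resources False n) (fun h _ _ => by unfold RAM.unitSize; omega) RAM.program
    (RAM.resources_ok le_rfl fun _ _ h => h.elim) (RAM.wp_program (G := G) le_rfl)
  refine ⟨s, ⟨t, hexec, ht.trans (hp n)⟩, fun hrat => ?_, fun hT => ?_⟩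
  · have hn : n ≤ RAM.inputLength G := Nat.le_add_right _ _
    have hw : ∀ u v, RAM.Height True (RAM.inputLength G) (G.w u v) := fun u v =>
      (RAM.height_bitSize (hrat u v)).mono
        (((single_le_sum (f := fun v => RAM.bitSize (G.w u v)) (fun _ _ => Nat.zero_le _)
          (mem_univ v)).trans (single_le_sum (f := fun u => ∑ v, RAM.bitSize (G.w u v))
            (fun _ _ => Nat.zero_le _) (mem_univ u))).trans (Nat.le_add_left _ _))
    obtain ⟨s', t', hexec', -, -, ht'⟩ := RAM.exec_of_wp (size := RAM.bitSize)
      (E := RAM.resources True (RAM.inputLength G)) (fun h x hx => RAM.bitSize_le hx) RAM.program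
      (RAM.resources_ok hn hw) (RAM.wp_program (G := G) hn)
    rw [hexec.deterministic hexec']
    exact ⟨t', hexec', ht'.trans (hp _)⟩
  · exact WeightedGraph.RoundInvariant.balanced (by rw [Fintype.card_fin]; exact hs hT)
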